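/- **Conventions.** All manifolds, bundles and maps are smooth; $\Gamma E$ denotes the space of smooth sections of a vector bundle $E$. Let $M$ be a (Hausdorff, second countable) manifold and let $A\to M$ be a Lie algebroid with anchor $\rho_A$ and bracket $[\cdot,\cdot]_A$. $H^1(A)$ is the space of $\alpha\in\Gamma(A^*)$ with $\rho_A(a)\cdot\langle\alpha,b\rangle-\rho_A(b)\cdot\langle\alpha,a\rangle-\langle\alpha,[a,b]_A\rangle=0$ for all $a,b\in\Gamma A$, modulo the sections $d_Af$, $\langle d_Af,a\rangle=\rho_A(a)\cdot f$, $f\in C^\infty(M)$. A representation of $A$ on a vector bundle $E\to M$ is an $\mathbb R$-bilinear map $D:\Gamma A\times\Gamma E\to\Gamma E$ with $D_{fa}x=fD_ax$, $D_a(fx)=fD_ax+(\rho_A(a)\cdot f)x$ and $D_aD_b-D_bD_a=D_{[a,b]_A}$. If $D$ is a representation on a line bundle $L$ with a nowhere-vanishing section $\lambda$, its characteristic class $\operatorname{char}D\in H^1(A)$ is the class of the $\alpha$ with $D_a\lambda=\langle\alpha,a\rangle\lambda$ for all $a\in\Gamma A$; if $L$ is not orientable, $\operatorname{char}D=\tfrac12\operatorname{char}(D\otimes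 D)$, where $D\otimes D$ acts on $L\otimes L$. The modular class $\operatorname{Mod}A$ is the characteristic class of the representation $D_a(\omega\otimes\mu)=[a,\omega]_A\otimes\mu+\omega\otimes\mathcal L_{\rho_A(a)}\mu$ on $\wedge^{\rm top}A\otimes\wedge^{\rm top}T^*M$, where $[a,\cdot]_A$ is extended to $\Gamma(\wedge^{\rm top}A)$ as a derivation; $A$ is unimodular if $\operatorname{Mod}A=0$. A base-preserving morphism $\Phi:A\to A'$ of Lie algebroids over $M$ is a vector bundle map over the identity that preserves anchors and brackets; its modular class is $\operatorname{Mod}\Phi=\operatorname{Mod}A-\Phi^*(\operatorname{Mod}A')\in H^1(A)$. **Theorem 4.7.** Let $\Phi:A\to A'$ be a base-preserving morphism of Lie algebroids over $M$ whose image $B=\Phi(A)\subset A'$ has constant rank and whose kernel $C=\ker\Phi$ is a unimodular Lie algebra bundle (that is, $C$ is locally trivial as a family of Lie algebras and is unimodular as a Lie algebroid). Let $\Phi_B:A\to B$ be the morphism induced by $\Phi$. Then: 1. there is a unique representation $D^{B,\wedge^{\rm top}C}$ of $B$ on $\wedge^{\rm top}C$ such that $D^{B,\wedge^{\rm top}C}_{\Phi_B(X)}\lambda=D^{A,\wedge^{\rm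 top}C}_X\lambda$ for all $X\in\Gamma A$, $\lambda\in\Gamma(\wedge^{\rm top}C)$, where $D^{A,\wedge^{\rm top}C}$ is the extension, as a derivation, of the adjoint representation $X\cdot k=[X,k]_A$ of $A$ on $C$; 2. there is a unique representation $D^{B,\wedge^{\rm top}(A'/B)}$ of $B$ on $\wedge^{\rm top}(A'/B)$ that is the extension, as a derivation, of the representation $Y\cdot(Z \bmod B)=[Y,Z]_{A'}\bmod B$ of $B$ on $A'/B$; 3. the classes $\operatorname{Mod}A$, $\operatorname{Mod}A'$, $\operatorname{char}D^{B,\wedge^{\rm top}C}$ and $\operatorname{char}D^{B,\wedge^{\rm top}(A'/B)}$ exist and are uniquely determined, and $$\operatorname{Mod}\Phi=\Phi_B^*\bigl(\operatorname{char}D^{B,\wedge^{\rm top}C}-\operatorname{char}D^{B,\wedge^{\rm top}(A'/B)}\bigr)\quad\text{in }H^1(A).$$ -/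

import Mathlib

open scoped Manifold ContDiff Topology TensorProduct Bundle
open Bundle Module

universe u v w

noncomputable section

/-- A family of finite-dimensional real vector spaces of constant rank over a manifold `M`, together
with its space of smooth global sections, which is stable under multiplication by smooth functions.
This is the common carrier for the vector bundles below: every smooth vector bundle in the sense of
Mathlib gives one (`SmoothFamily.ofBundle`), and subbundles, quotients, duals, tensor products and
top exterior powers of vector bundles are described by their fibres and their smooth sections. -/
structure SmoothFamily (n : ℕ) (M : Type u) [TopologicalSpace M]
    [ChartedSpace (EuclideanSpace ℝ (Fin n)) M] where
  Fiber : M → Type v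
  [addCommGroup : ∀ x, AddCommGroup (Fiber x)]
  [module : ∀ x, Module ℝ (Fiber x)]
  rank : ℕ
  finite : ∀ x, Module.Finite ℝ (Fiber x)
  finrank_fiber : ∀ x, finrank ℝ (Fiber x) = rank
  /-- the space of smooth global sections -/
  sec : Submodule ℝ (∀ x, Fiber x)
  smul_mem : ∀ (f : C^∞⟮𝓡 n, M; ℝ⟯) (s : ∀ x, Fiber x), s ∈ sec → (fun x => f x • s x) ∈ sec

attribute [instance] SmoothFamily.addCommGroup SmoothFamily.module SmoothFamily.finite

section Basic

variable {n : ℕ} {M : Type u} [TopologicalSpace M] [ChartedSpace (EuclideanSpace ℝ (Fin n)) M]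

/-- The derivative `v · f` of a function `f` along a tangent vector `v` at `x`. -/
def dirDeriv (f : M → ℝ) (x : M) (v : TangentSpace (𝓡 n) x) : ℝ :=
  mfderiv (𝓡 n) 𝓘(ℝ, ℝ) f x v

theorem dirDeriv_add {f g : M → ℝ} (hf : ContMDiff (𝓡 n) 𝓘(ℝ, ℝ) ∞ f)
    (hg : ContMDiff (𝓡 n) 𝓘(ℝ, ℝ) ∞ g) (x : M) (v : TangentSpace (𝓡 n) x) :
    dirDeriv (fun y => f y + g y) x v = dirDeriv f x v + dirDeriv g x v := by
  have h := mfderiv_add (hf.mdifferentiable (by simp) x) (hg.mdifferentiable (by simp) x)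
  exact congrArg (fun L => L v) h

theorem dirDeriv_const_mul {f : M → ℝ} (hf : ContMDiff (𝓡 n) 𝓘(ℝ, ℝ) ∞ f) (c : ℝ)
    (x : M) (v : TangentSpace (𝓡 n) x) :
    dirDeriv (fun y => c * f y) x v = c * dirDeriv f x v := by
  have h := const_smul_mfderiv (hf.mdifferentiable (by simp) x) c
  exact congrArg (fun L => L v) h

theorem dirDeriv_zero (x : M) (v : TangentSpace (𝓡 n) x) :
    dirDeriv (fun _ : M => (0 : ℝ)) x v = 0 := by
  have h := mfderiv_const (I := 𝓡 n) (I' := 𝓘(ℝ, ℝ)) (x := x) (c := (0 : ℝ))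
  exact congrArg (fun L => L v) h

namespace SmoothFamily

instance (E : SmoothFamily.{u, v} n M) : SMul C^∞⟮𝓡 n, M; ℝ⟯ E.sec :=
  ⟨fun f s => ⟨fun x => f x • s.1 x, E.smul_mem f s.1 s.2⟩⟩

/-- The family of fibres of a smooth vector bundle, with its smooth sections. -/
@[reducible] def ofBundle (n : ℕ) {M : Type u} [TopologicalSpace M]
    [ChartedSpace (EuclideanSpace ℝ (Fin n)) M]
    (F : Type w) [NormedAddCommGroup F] [NormedSpace ℝ F] [FiniteDimensional ℝ F]
    (V : M → Type v) [∀ x, AddCommGroup (V x)] [∀ x, Module ℝ (V x)]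
    [∀ x, TopologicalSpace (V x)] [TopologicalSpace (TotalSpace F V)]
    [FiberBundle F V] [VectorBundle ℝ F V] : SmoothFamily.{u, v} n M where
  Fiber := V
  rank := finrank ℝ F
  finite x := Module.Finite.equiv (VectorBundle.continuousLinearEquivAt ℝ F V x).symm.toLinearEquiv
  finrank_fiber x := (VectorBundle.continuousLinearEquivAt ℝ F V x).toLinearEquiv.finrank_eq
  sec :=
    { carrier := {s | ContMDiff (𝓡 n) ((𝓡 n).prod 𝓘(ℝ, F)) ∞ (fun x => TotalSpace.mk' F x (s x))}
      add_mem' := fun hs ht => ContMDiff.add_section hs ht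
      zero_mem' := contMDiff_zeroSection ℝ V
      smul_mem' := fun _ _ hs => ContMDiff.const_smul_section hs }
  smul_mem f _ hs := ContMDiff.smul_section f.contMDiff hs

/-- The tangent bundle. -/
@[reducible] def tangent (n : ℕ) (M : Type u) [TopologicalSpace M]
    [ChartedSpace (EuclideanSpace ℝ (Fin n)) M] [IsManifold (𝓡 n) ∞ M] :
    SmoothFamily.{u, 0} n M :=
  haveI : IsManifold (𝓡 n) 1 M := IsManifold.of_le (n := ∞) (by simp)
  ofBundle n (EuclideanSpace ℝ (Fin n)) (fun x : M => TangentSpace (𝓡 n) x)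

/-- The subbundle of `E` with fibres `W x`: its smooth sections are the smooth sections of `E` with
values in `W`. -/
@[reducible] def sub (E : SmoothFamily.{u, v} n M) (W : ∀ x, Submodule ℝ (E.Fiber x)) (r : ℕ)
    (hr : ∀ x, finrank ℝ (W x) = r) : SmoothFamily.{u, v} n M where
  Fiber x := W x
  rank := r
  finite _ := inferInstance
  finrank_fiber := hr
  sec :=
    { carrier := {s | (fun x => (s x : E.Fiber x)) ∈ E.sec}
      add_mem' := fun hs ht => E.sec.add_mem hs ht
      zero_mem' := E.sec.zero_mem
      smul_mem' := fun c _ hs => E.sec.smul_mem c hs }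
  smul_mem f _ hs := E.smul_mem f _ hs

/-- The inclusion of a subbundle, on sections. -/
def subIncl (E : SmoothFamily.{u, v} n M) {W : ∀ x, Submodule ℝ (E.Fiber x)} {r : ℕ}
    {hr : ∀ x, finrank ℝ (W x) = r} : (E.sub W r hr).sec →ₗ[ℝ] E.sec where
  toFun s := ⟨fun x => s.1 x, s.2⟩
  map_add' _ _ := rfl
  map_smul' _ _ := rfl

/-- The dual bundle: a section `α` is smooth iff its pairing with every smooth section of `E` is
smooth. -/
def dual (E : SmoothFamily.{u, v} n M) : SmoothFamily.{u, v} n M where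
  Fiber x := Dual ℝ (E.Fiber x)
  rank := E.rank
  finite _ := inferInstance
  finrank_fiber x := by rw [Subspace.dual_finrank_eq, E.finrank_fiber]
  sec :=
    { carrier := {α | ∀ s ∈ E.sec, ContMDiff (𝓡 n) 𝓘(ℝ, ℝ) ∞ (fun x => α x (s x))}
      add_mem' := fun ha hb s hs => (ha s hs).add (hb s hs)
      zero_mem' := fun _ _ => contMDiff_const
      smul_mem' := fun c _ ha s hs => (contMDiff_const (c := c)).mul (ha s hs) }
  smul_mem f _ ha s hs := f.contMDiff.mul (ha s hs)

/-- The value `⟨α, a⟩` of a smooth section of the dual bundle on a vector `a` at `x`. -/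
def pair {E : SmoothFamily.{u, v} n M} (α : E.dual.sec) (x : M) (a : E.Fiber x) : ℝ :=
  (show Dual ℝ (E.Fiber x) from α.1 x) a

theorem contMDiff_pair {E : SmoothFamily.{u, v} n M} (α : E.dual.sec) (s : E.sec) :
    ContMDiff (𝓡 n) 𝓘(ℝ, ℝ) ∞ (fun x => pair α x (s.1 x)) := α.2 s.1 s.2

theorem pair_add {E : SmoothFamily.{u, v} n M} (α β : E.dual.sec) (x : M) (a : E.Fiber x) :
    pair (α + β) x a = pair α x a + pair β x a := rfl

theorem pair_smul {E : SmoothFamily.{u, v} n M} (c : ℝ) (α : E.dual.sec) (x : M) (a : E.Fiber x) :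
    pair (c • α) x a = c * pair α x a := rfl

theorem pair_zero {E : SmoothFamily.{u, v} n M} (x : M) (a : E.Fiber x) :
    pair (0 : E.dual.sec) x a = 0 := rfl

/-- The space of sections which locally, near each point, coincide with a finite combination, with
smooth functions as coefficients, of members of `G`. -/
def locallyGenerated (Fiber : M → Type v) [∀ x, AddCommGroup (Fiber x)] [∀ x, Module ℝ (Fiber x)]
    (G : Set (∀ x, Fiber x)) : Submodule ℝ (∀ x, Fiber x) where
  carrier := {s | ∀ x₀ : M, ∃ t ∈ Submodule.span ℝ
    {h : ∀ x, Fiber x | ∃ f : C^∞⟮𝓡 n, M; ℝ⟯, ∃ g ∈ G, h = fun x => f x • g x},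
    ∀ᶠ x in 𝓝 x₀, s x = t x}
  add_mem' := fun {s s'} hs hs' x₀ => by
    obtain ⟨t, ht, h⟩ := hs x₀
    obtain ⟨t', ht', h'⟩ := hs' x₀
    refine ⟨t + t', Submodule.add_mem _ ht ht', ?_⟩
    filter_upwards [h, h'] with x hx hx'
    simp [hx, hx']
  zero_mem' := fun x₀ => ⟨0, Submodule.zero_mem _, Filter.Eventually.of_forall fun _ => rfl⟩
  smul_mem' := fun c s hs x₀ => by
    obtain ⟨t, ht, h⟩ := hs x₀
    refine ⟨c • t, Submodule.smul_mem _ c ht, ?_⟩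
    filter_upwards [h] with x hx
    simp [hx]

theorem locallyGenerated_smul_mem (Fiber : M → Type v) [∀ x, AddCommGroup (Fiber x)]
    [∀ x, Module ℝ (Fiber x)] (G : Set (∀ x, Fiber x)) (f : C^∞⟮𝓡 n, M; ℝ⟯) (s : ∀ x, Fiber x)
    (hs : s ∈ locallyGenerated (n := n) Fiber G) :
    (fun x => f x • s x) ∈ locallyGenerated (n := n) Fiber G := by
  intro x₀
  obtain ⟨t, ht, h⟩ := hs x₀
  refine ⟨fun x => f x • t x, ?_, ?_⟩
  · clear h
    induction ht using Submodule.span_induction with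
    | mem t ht =>
      obtain ⟨g, s', hs', rfl⟩ := ht
      exact Submodule.subset_span ⟨f * g, s', hs', by funext x; simp [mul_smul]⟩
    | zero =>
      have h0 : (fun x => f x • (0 : ∀ x, Fiber x) x) = 0 := by funext x; simp
      rw [h0]
      exact Submodule.zero_mem _
    | add a b _ _ ha hb =>
      have h0 : (fun x => f x • (a + b) x) = (fun x => f x • a x) + fun x => f x • b x := by
        funext x; simp
      rw [h0]
      exact Submodule.add_mem _ ha hb
    | smul c a _ ha =>
      have h0 : (fun x => f x • (c • a) x) = c • fun x => f x • a x := by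
        funext x; simp [smul_comm c]
      rw [h0]
      exact Submodule.smul_mem _ c ha
  · filter_upwards [h] with x hx
    rw [hx]

theorem mem_locallyGenerated (Fiber : M → Type v) [∀ x, AddCommGroup (Fiber x)]
    [∀ x, Module ℝ (Fiber x)] (G : Set (∀ x, Fiber x)) (s : ∀ x, Fiber x) (hs : s ∈ G) :
    s ∈ locallyGenerated (n := n) Fiber G := fun _ =>
  ⟨s, Submodule.subset_span ⟨1, s, hs, by funext x; simp⟩, Filter.Eventually.of_forall fun _ => rfl⟩

/-- The quotient bundle `E / W`: its smooth sections lift locally to smooth sections of `E`. -/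
@[reducible] def quot (E : SmoothFamily.{u, v} n M) (W : ∀ x, Submodule ℝ (E.Fiber x)) (r : ℕ)
    (hr : ∀ x, finrank ℝ (W x) = r) : SmoothFamily.{u, v} n M where
  Fiber x := E.Fiber x ⧸ W x
  rank := E.rank - r
  finite _ := inferInstance
  finrank_fiber x := by rw [Submodule.finrank_quotient, E.finrank_fiber, hr]
  sec := locallyGenerated (n := n) _ {q | ∃ s : E.sec, q = fun x => (W x).mkQ (s.1 x)}
  smul_mem := locallyGenerated_smul_mem _ _

/-- The image in `Γ(E / W)` of a smooth section of `E`. -/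
def quotMk (E : SmoothFamily.{u, v} n M) (W : ∀ x, Submodule ℝ (E.Fiber x)) (r : ℕ)
    (hr : ∀ x, finrank ℝ (W x) = r) (s : E.sec) : (E.quot W r hr).sec :=
  ⟨fun x => (W x).mkQ (s.1 x), mem_locallyGenerated _ _ _ ⟨s, rfl⟩⟩

/-- The tensor product bundle. -/
@[reducible] def tensor (E : SmoothFamily.{u, v} n M) (E' : SmoothFamily.{u, w} n M) :
    SmoothFamily.{u, max v w} n M where
  Fiber x := E.Fiber x ⊗[ℝ] E'.Fiber x
  rank := E.rank * E'.rank
  finite _ := inferInstance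
  finrank_fiber x := by rw [finrank_tensorProduct, E.finrank_fiber, E'.finrank_fiber]
  sec := locallyGenerated (n := n) _
    {q | ∃ (s : E.sec) (t : E'.sec), q = fun x => s.1 x ⊗ₜ[ℝ] t.1 x}
  smul_mem := locallyGenerated_smul_mem _ _

/-- The section `s ⊗ t`. -/
def tmul {E : SmoothFamily.{u, v} n M} {E' : SmoothFamily.{u, w} n M} (s : E.sec) (t : E'.sec) :
    (E.tensor E').sec :=
  ⟨fun x => s.1 x ⊗ₜ[ℝ] t.1 x, mem_locallyGenerated _ _ _ ⟨s, t, rfl⟩⟩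

/-- The top exterior power `⋀^top E`, a line bundle. -/
@[reducible] def top (E : SmoothFamily.{u, v} n M) : SmoothFamily.{u, v} n M where
  Fiber x := ⋀[ℝ]^E.rank (E.Fiber x)
  rank := 1
  finite _ := inferInstance
  finrank_fiber x := by rw [exteriorPower.finrank_eq, E.finrank_fiber, Nat.choose_self]
  sec := locallyGenerated (n := n) _
    {q | ∃ s : Fin E.rank → E.sec, q = fun x => exteriorPower.ιMulti ℝ E.rank fun i => (s i).1 x}
  smul_mem := locallyGenerated_smul_mem _ _

/-- The section `s₁ ∧ ⋯ ∧ s_r` of the top exterior power. -/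
def wedge {E : SmoothFamily.{u, v} n M} (s : Fin E.rank → E.sec) : E.top.sec :=
  ⟨fun x => exteriorPower.ιMulti ℝ E.rank fun i => (s i).1 x, mem_locallyGenerated _ _ _ ⟨s, rfl⟩⟩

/-- For an operator `D` on sections of `E`, the section
`∑ i, s₁ ∧ ⋯ ∧ D sᵢ ∧ ⋯ ∧ s_r` of the top exterior power. -/
def wedgeDeriv {E : SmoothFamily.{u, v} n M} (D : E.sec → E.sec) (s : Fin E.rank → E.sec) :
    E.top.sec :=
  ∑ i, wedge (Function.update s i (D (s i)))

end SmoothFamily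

end Basic

section Algebroids

variable {n : ℕ} {M : Type u} [TopologicalSpace M] [ChartedSpace (EuclideanSpace ℝ (Fin n)) M]
  [IsManifold (𝓡 n) ∞ M]

/-- A Lie algebroid structure on `A`: a smooth anchor `A → TM` and an `ℝ`-Lie algebra structure on
the smooth sections, with the Leibniz rule. -/
structure LieAlgebroid (A : SmoothFamily.{u, v} n M) where
  anchor : ∀ x, A.Fiber x →ₗ[ℝ] TangentSpace (𝓡 n) x
  anchor_mem : ∀ s : A.sec, (fun x => anchor x (s.1 x)) ∈ (SmoothFamily.tangent n M).sec
  bracket : A.sec →ₗ[ℝ] A.sec →ₗ[ℝ] A.sec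
  bracket_self : ∀ s, bracket s s = 0
  jacobi : ∀ s t r, bracket s (bracket t r) = bracket (bracket s t) r + bracket t (bracket s r)
  leibniz : ∀ (s : A.sec) (f : C^∞⟮𝓡 n, M; ℝ⟯) (t : A.sec) (x : M),
    (bracket s (f • t)).1 x =
      f x • (bracket s t).1 x + dirDeriv f x (anchor x (s.1 x)) • t.1 x
  anchor_bracket : ∀ (s t : A.sec) (x : M), anchor x ((bracket s t).1 x) =
    VectorField.mlieBracket (𝓡 n) (fun y => anchor y (s.1 y)) (fun y => anchor y (t.1 y)) x

namespace LieAlgebroid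

open SmoothFamily

variable {A : SmoothFamily.{u, v} n M} (L : LieAlgebroid A)

/-- The vector field `ρ(s)`. -/
def anchorSec (s : A.sec) : (SmoothFamily.tangent n M).sec :=
  ⟨fun x => L.anchor x (s.1 x), L.anchor_mem s⟩

/-- The space of `d_A`-closed smooth sections of `A^*`. -/
def cocycles : Submodule ℝ A.dual.sec where
  carrier := {α | ∀ (s t : A.sec) (x : M),
    dirDeriv (fun y => pair α y (t.1 y)) x (L.anchor x (s.1 x))
      - dirDeriv (fun y => pair α y (s.1 y)) x (L.anchor x (t.1 x))
      - pair α x ((L.bracket s t).1 x) = 0}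
  add_mem' := fun {α β} ha hb s t x => by
    have h1 := ha s t x
    have h2 := hb s t x
    simp only [pair_add]
    rw [dirDeriv_add (contMDiff_pair α t) (contMDiff_pair β t),
      dirDeriv_add (contMDiff_pair α s) (contMDiff_pair β s)]
    linarith
  zero_mem' := fun s t x => by simp [pair_zero, dirDeriv_zero]
  smul_mem' := fun c α ha s t x => by
    have h1 := ha s t x
    simp only [pair_smul]
    rw [dirDeriv_const_mul (contMDiff_pair α t), dirDeriv_const_mul (contMDiff_pair α s),
      ← mul_sub, ← mul_sub, h1, mul_zero]

/-- A `1`-cocycle. -/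
def Cocycle : Type _ := L.cocycles

instance : AddCommGroup L.Cocycle := inferInstanceAs (AddCommGroup L.cocycles)

instance : Module ℝ L.Cocycle := inferInstanceAs (Module ℝ L.cocycles)

/-- The exact `1`-cocycles: those of the form `d_A f`, with `⟨d_A f, a⟩ = ρ(a) · f`. -/
def coboundaries : Submodule ℝ L.Cocycle where
  carrier := {α | ∃ f : C^∞⟮𝓡 n, M; ℝ⟯, ∀ (x : M) (a : A.Fiber x),
    pair α.1 x a = dirDeriv f x (L.anchor x a)}
  add_mem' := fun {α β} ⟨f, hf⟩ ⟨g, hg⟩ => ⟨f + g, fun x a => by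
    have h := dirDeriv_add f.contMDiff g.contMDiff x (L.anchor x a)
    have e : pair (α + β).1 x a = pair α.1 x a + pair β.1 x a := rfl
    rw [e, hf, hg]
    exact h.symm⟩
  zero_mem' := ⟨0, fun x a => (dirDeriv_zero x (L.anchor x a)).symm⟩
  smul_mem' := fun c α ⟨f, hf⟩ => ⟨c • f, fun x a => by
    have h := dirDeriv_const_mul f.contMDiff c x (L.anchor x a)
    have e : pair (c • α).1 x a = c * pair α.1 x a := rfl
    rw [e, hf]
    exact h.symm⟩

/-- The Lie algebroid cohomology `H¹(A)`. -/
abbrev H1 : Type _ := L.Cocycle ⧸ L.coboundaries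

/-- The class of a `1`-cocycle. -/
def cls (α : L.Cocycle) : L.H1 := L.coboundaries.mkQ α

/-- A representation of the Lie algebroid on `E`. -/
@[ext] structure Rep (E : SmoothFamily.{u, w} n M) where
  D : A.sec →ₗ[ℝ] E.sec →ₗ[ℝ] E.sec
  smul_left : ∀ (f : C^∞⟮𝓡 n, M; ℝ⟯) (a : A.sec) (e : E.sec), D (f • a) e = f • D a e
  leibniz : ∀ (a : A.sec) (f : C^∞⟮𝓡 n, M; ℝ⟯) (e : E.sec) (x : M),
    (D a (f • e)).1 x = f x • (D a e).1 x + dirDeriv f x (L.anchor x (a.1 x)) • e.1 x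
  flat : ∀ (a b : A.sec) (e : E.sec), D a (D b e) - D b (D a e) = D (L.bracket a b) e

namespace Rep

variable {L} {E : SmoothFamily.{u, w} n M}

/-- `R'` is the representation on `⋀^top E` induced by the representation `R` on `E`. -/
def IsTop (R : L.Rep E) (R' : L.Rep E.top) : Prop :=
  ∀ (a : A.sec) (s : Fin E.rank → E.sec),
    R'.D a (SmoothFamily.wedge s) = SmoothFamily.wedgeDeriv (R.D a) s

/-- `R'` is the representation `R₁ ⊗ R₂`. -/
def IsTensor {E' : SmoothFamily.{u, w} n M} (R₁ : L.Rep E) (R₂ : L.Rep E')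
    (R' : L.Rep (E.tensor E')) : Prop :=
  ∀ (a : A.sec) (s : E.sec) (t : E'.sec), R'.D a (SmoothFamily.tmul s t) =
    SmoothFamily.tmul (R₁.D a s) t + SmoothFamily.tmul s (R₂.D a t)

/-- `α` is a characteristic cocycle of the representation `R` on a line bundle: there is a
nowhere-vanishing smooth section `lam` with `a · lam = ⟨α, a⟩ lam` for all `a`. -/
def IsCharCocycle (R : L.Rep E) (α : L.Cocycle) : Prop :=
  ∃ lam : E.sec, (∀ x, lam.1 x ≠ 0) ∧
    ∀ (a : A.sec) (x : M), (R.D a lam).1 x = pair α.1 x (a.1 x) • lam.1 x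

/-- `c` is the characteristic class of the representation `R` on the line bundle `E`. If `E` is
orientable it is the class of a characteristic cocycle; otherwise it is one half of the class of a
characteristic cocycle of `R ⊗ R` on `E ⊗ E`. -/
def IsCharClass (R : L.Rep E) (c : L.H1) : Prop :=
  (∃ α, R.IsCharCocycle α ∧ c = L.cls α) ∨
  ((¬ ∃ lam : E.sec, ∀ x, lam.1 x ≠ 0) ∧
    ∃ R' : L.Rep (E.tensor E), R.IsTensor R R' ∧
      ∃ α, R'.IsCharCocycle α ∧ c = (1 / 2 : ℝ) • L.cls α)

/-- The characteristic class of a representation on a line bundle. -/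
def char (R : L.Rep E) : L.H1 := Classical.epsilon R.IsCharClass

end Rep

/-- The line bundle `⋀^top A ⊗ ⋀^top T^*M`. -/
abbrev modularLine (A : SmoothFamily.{u, v} n M) : SmoothFamily.{u, v} n M :=
  A.top.tensor (SmoothFamily.tangent n M).dual.top

/-- `η` is the Lie derivative of the `1`-form `ξ` along the vector field `X`. -/
def IsLieDerivative (X : (SmoothFamily.tangent n M).sec)
    (ξ η : (SmoothFamily.tangent n M).dual.sec) : Prop :=
  ∀ (Y : (SmoothFamily.tangent n M).sec) (x : M), pair η x (Y.1 x) =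
    dirDeriv (fun y => pair ξ y (Y.1 y)) x (X.1 x) -
      pair ξ x (VectorField.mlieBracket (𝓡 n) (fun y => X.1 y) (fun y => Y.1 y) x)

/-- `R` is the canonical representation on `⋀^top A ⊗ ⋀^top T^*M`:
`a · (ω ⊗ μ) = [a, ω] ⊗ μ + ω ⊗ 𝓛_{ρ(a)} μ`, where `[a, ·]` and `𝓛_{ρ(a)}` are extended from
sections of `A` and from `1`-forms as derivations of the exterior product. -/
def IsCanonicalRep (R : L.Rep (modularLine A)) : Prop :=
  ∀ a : A.sec, ∃ lie : (SmoothFamily.tangent n M).dual.sec → (SmoothFamily.tangent n M).dual.sec,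
    (∀ ξ, IsLieDerivative (L.anchorSec a) ξ (lie ξ)) ∧
    ∀ (s : Fin A.rank → A.sec)
      (ξ : Fin (SmoothFamily.tangent n M).dual.rank → (SmoothFamily.tangent n M).dual.sec),
      R.D a (SmoothFamily.tmul (SmoothFamily.wedge s) (SmoothFamily.wedge ξ)) =
        SmoothFamily.tmul (SmoothFamily.wedgeDeriv (L.bracket a) s) (SmoothFamily.wedge ξ) +
        SmoothFamily.tmul (SmoothFamily.wedge s) (SmoothFamily.wedgeDeriv lie ξ)

/-- `c` is the modular class of the Lie algebroid: the characteristic class of the canonical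
representation. -/
def IsModularClass (c : L.H1) : Prop :=
  ∃ R : L.Rep (modularLine A), L.IsCanonicalRep R ∧ R.IsCharClass c

/-- The modular class `Mod A`. -/
def modularClass : L.H1 := Classical.epsilon L.IsModularClass

/-- A Lie algebroid is unimodular if its modular class vanishes. -/
def IsUnimodular : Prop := L.IsModularClass 0

/-- A Lie algebra bundle: the anchor vanishes, and near each point there is a smooth frame in which
the bracket has constant structure coefficients, i.e. the bundle is locally trivial as a family of
Lie algebras. -/
def IsLieAlgebraBundle : Prop :=
  (∀ x, L.anchor x = 0) ∧
  ∀ x₀ : M, ∃ (e : Fin A.rank → A.sec) (c : Fin A.rank → Fin A.rank → Fin A.rank → ℝ),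
    ∀ᶠ x in 𝓝 x₀, LinearIndependent ℝ (fun i => (e i).1 x) ∧
      ∀ i j, (L.bracket (e i) (e j)).1 x = ∑ k, c i j k • (e k).1 x

/-- The bracket is local in its second argument. -/
theorem bracket_eq_zero_of_eventually [T2Space M] (s t : A.sec) (x₀ : M)
    (h : ∀ᶠ x in 𝓝 x₀, t.1 x = 0) : (L.bracket s t).1 x₀ = 0 := by
  obtain ⟨f, -, hf⟩ := (SmoothBumpFunction.nhds_basis_tsupport (I := 𝓡 n) x₀).mem_iff.1 h
  let g : C^∞⟮𝓡 n, M; ℝ⟯ := 1 - ⟨f, f.contMDiff⟩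
  have hg : ∀ x, g x = 1 - f x := fun _ => rfl
  have ht : g • t = t := by
    ext x
    change g x • t.1 x = t.1 x
    by_cases hx : x ∈ tsupport f
    · have h0 : t.1 x = 0 := hf hx
      simp [h0]
    · simp [hg, image_eq_zero_of_notMem_tsupport hx]
  have h0 : t.1 x₀ = 0 := h.self_of_nhds
  have h1 := L.leibniz s g t x₀
  rw [ht, h0, hg, f.eq_one] at h1
  simpa using h1

theorem bracket_skew (a b : A.sec) : L.bracket a b = - L.bracket b a := by
  have h := L.bracket_self (a + b)
  simp only [map_add, LinearMap.add_apply, L.bracket_self, zero_add, add_zero] at h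
  exact eq_neg_of_add_eq_zero_right h

theorem bracket_congr [T2Space M] (s s' t t' : A.sec) (x₀ : M)
    (hs : ∀ᶠ x in 𝓝 x₀, s.1 x = s'.1 x) (ht : ∀ᶠ x in 𝓝 x₀, t.1 x = t'.1 x) :
    (L.bracket s t).1 x₀ = (L.bracket s' t').1 x₀ := by
  have h1 : (L.bracket s (t - t')).1 x₀ = 0 :=
    L.bracket_eq_zero_of_eventually s _ x₀ (by
      filter_upwards [ht] with x hx
      simp [hx])
  have h2 : (L.bracket t' (s - s')).1 x₀ = 0 :=
    L.bracket_eq_zero_of_eventually t' _ x₀ (by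
      filter_upwards [hs] with x hx
      simp [hx])
  rw [map_sub] at h1 h2
  rw [L.bracket_skew t' s, L.bracket_skew t' s'] at h2
  have h1' : (L.bracket s t).1 x₀ - (L.bracket s t').1 x₀ = 0 := h1
  have h2' : -(L.bracket s t').1 x₀ - -(L.bracket s' t').1 x₀ = 0 := h2
  rw [sub_eq_zero] at h1' h2'
  rw [h1', neg_injective h2']

/-- The Lie algebroid structure on a subbundle whose sections are closed under the bracket. -/
def sub (W : ∀ x, Submodule ℝ (A.Fiber x)) (r : ℕ) (hr : ∀ x, finrank ℝ (W x) = r)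
    (hW : ∀ (s t : A.sec), (∀ x, s.1 x ∈ W x) → (∀ x, t.1 x ∈ W x) →
      ∀ x, (L.bracket s t).1 x ∈ W x) : LieAlgebroid (A.sub W r hr) where
  anchor x := (L.anchor x).comp (W x).subtype
  anchor_mem s := L.anchor_mem (A.subIncl s)
  bracket := LinearMap.mk₂ ℝ
    (fun s t => ⟨fun x => ⟨(L.bracket (A.subIncl s) (A.subIncl t)).1 x,
      hW _ _ (fun y => (s.1 y).2) (fun y => (t.1 y).2) x⟩,
      (L.bracket (A.subIncl s) (A.subIncl t)).2⟩)
    (fun s s' t => by ext x; simp [map_add])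
    (fun c s t => by ext x; simp [map_smul])
    (fun s t t' => by ext x; simp [map_add])
    (fun c s t => by ext x; simp [map_smul])
  bracket_self s := by
    ext x
    exact congrFun (congrArg Subtype.val (L.bracket_self (A.subIncl s))) x
  jacobi s t r := by
    ext x
    exact congrFun (congrArg Subtype.val
      (L.jacobi (A.subIncl s) (A.subIncl t) (A.subIncl r))) x
  leibniz s f t x := by
    ext
    exact L.leibniz (A.subIncl s) f (A.subIncl t) x
  anchor_bracket s t x := L.anchor_bracket (A.subIncl s) (A.subIncl t) x

/-- A base-preserving morphism of Lie algebroids: a smooth vector bundle map preserving anchors and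
brackets. -/
structure Hom {A' : SmoothFamily.{u, w} n M} (L : LieAlgebroid A) (L' : LieAlgebroid A') where
  map : ∀ x, A.Fiber x →ₗ[ℝ] A'.Fiber x
  map_mem : ∀ s : A.sec, (fun x => map x (s.1 x)) ∈ A'.sec
  anchor_map : ∀ (x : M) (a : A.Fiber x), L'.anchor x (map x a) = L.anchor x a
  map_bracket : ∀ (s t : A.sec) (x : M), map x ((L.bracket s t).1 x) =
    (L'.bracket ⟨fun y => map y (s.1 y), map_mem s⟩ ⟨fun y => map y (t.1 y), map_mem t⟩).1 x

namespace Hom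

variable {A' : SmoothFamily.{u, w} n M} {L} {L' : LieAlgebroid A'} (Φ : L.Hom L')

/-- The map induced by a morphism on sections. -/
def onSec : A.sec →ₗ[ℝ] A'.sec where
  toFun s := ⟨fun x => Φ.map x (s.1 x), Φ.map_mem s⟩
  map_add' s t := by ext x; simp
  map_smul' c s := by ext x; simp

theorem onSec_bracket (s t : A.sec) :
    Φ.onSec (L.bracket s t) = L'.bracket (Φ.onSec s) (Φ.onSec t) := by
  ext x
  exact Φ.map_bracket s t x

/-- The pull-back `Φ^*` on `1`-cocycles. -/
def pullbackCocycle : L'.Cocycle →ₗ[ℝ] L.Cocycle where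
  toFun α := ⟨⟨fun x => (show Dual ℝ (A'.Fiber x) from α.1.1 x).comp (Φ.map x),
    fun s hs => α.1.2 _ (Φ.map_mem ⟨s, hs⟩)⟩, fun s t x => by
      have h := α.2 (Φ.onSec s) (Φ.onSec t) x
      rw [← Φ.onSec_bracket] at h
      have h1 := Φ.anchor_map x (s.1 x)
      have h2 := Φ.anchor_map x (t.1 x)
      rw [← h1, ← h2]
      exact h⟩
  map_add' _ _ := rfl
  map_smul' _ _ := rfl

/-- The pull-back `Φ^* : H¹(A') → H¹(A)`. -/
def pullback : L'.H1 →ₗ[ℝ] L.H1 :=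
  Submodule.mapQ _ _ Φ.pullbackCocycle (by
    rintro α ⟨f, hf⟩
    refine ⟨f, fun x a => ?_⟩
    rw [← Φ.anchor_map x a]
    exact hf x (Φ.map x a))

/-- The modular class of a base-preserving morphism, `Mod Φ = Mod A - Φ^* (Mod A')`. -/
def modularClass : L.H1 := L.modularClass - Φ.pullback L'.modularClass

/-! ### Kernel and image of a morphism of constant rank -/

/-- The kernel of a morphism of constant rank `b`, a subbundle of `A`. -/
@[reducible] def kerBundle (b : ℕ) (hb : ∀ x, finrank ℝ (LinearMap.range (Φ.map x)) = b) :
    SmoothFamily.{u, v} n M :=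
  A.sub (fun x => LinearMap.ker (Φ.map x)) (A.rank - b) fun x => by
    have h := (Φ.map x).finrank_range_add_finrank_ker
    rw [A.finrank_fiber, hb] at h
    omega

/-- The image of a morphism of constant rank `b`, a subbundle of `A'`. -/
@[reducible] def imBundle (b : ℕ) (hb : ∀ x, finrank ℝ (LinearMap.range (Φ.map x)) = b) :
    SmoothFamily.{u, w} n M :=
  A'.sub (fun x => LinearMap.range (Φ.map x)) b hb

/-- The quotient `A' / B` of the target by the image `B`. -/
@[reducible] def cokerBundle (b : ℕ) (hb : ∀ x, finrank ℝ (LinearMap.range (Φ.map x)) = b) :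
    SmoothFamily.{u, w} n M :=
  A'.quot (fun x => LinearMap.range (Φ.map x)) b hb

theorem bracket_mem_ker (s t : A.sec) (ht : ∀ x, t.1 x ∈ LinearMap.ker (Φ.map x)) (x : M) :
    (L.bracket s t).1 x ∈ LinearMap.ker (Φ.map x) := by
  have h0 : Φ.onSec t = 0 := by
    ext y
    exact LinearMap.mem_ker.1 (ht y)
  have h := Φ.onSec_bracket s t
  rw [h0, map_zero] at h
  exact LinearMap.mem_ker.2 (congrFun (congrArg Subtype.val h) x)

variable (b : ℕ) (hb : ∀ x, finrank ℝ (LinearMap.range (Φ.map x)) = b)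

/-- The Lie algebroid `C = ker Φ`. -/
def kernel : LieAlgebroid (Φ.kerBundle b hb) :=
  L.sub _ _ _ fun s t _ ht => Φ.bracket_mem_ker s t ht

/-- The adjoint representation `D^{A,C}` of `A` on the kernel `C`: `X · k = [X, k]`. -/
def adjointRep : L.Rep (Φ.kerBundle b hb) where
  D := LinearMap.mk₂ ℝ
    (fun s t => ⟨fun x => ⟨(L.bracket s (A.subIncl t)).1 x,
      Φ.bracket_mem_ker s _ (fun y => (t.1 y).2) x⟩, (L.bracket s (A.subIncl t)).2⟩)
    (fun s s' t => by ext x; simp [map_add])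
    (fun c s t => by ext x; simp [map_smul])
    (fun s t t' => by ext x; simp [map_add])
    (fun c s t => by ext x; simp [map_smul])
  smul_left f a e := by
    ext x
    have h1 := L.bracket_skew (f • a) (A.subIncl e)
    have h2 := L.leibniz (A.subIncl e) f a x
    have h3 : L.anchor x ((A.subIncl e).1 x) = 0 := by
      have h4 : Φ.map x ((A.subIncl e).1 x) = 0 := LinearMap.mem_ker.1 (e.1 x).2
      rw [← Φ.anchor_map, h4, map_zero]
    have h5 : dirDeriv f x (0 : TangentSpace (𝓡 n) x) = 0 := map_zero (mfderiv (𝓡 n) 𝓘(ℝ, ℝ) f x)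
    rw [h3, h5, zero_smul, add_zero] at h2
    change (L.bracket (f • a) (A.subIncl e)).1 x = f x • (L.bracket a (A.subIncl e)).1 x
    rw [h1, L.bracket_skew a]
    change -(L.bracket (A.subIncl e) (f • a)).1 x = f x • -(L.bracket (A.subIncl e) a).1 x
    rw [h2, smul_neg]
  leibniz a f e x := by
    ext
    exact L.leibniz a f (A.subIncl e) x
  flat a b' e := by
    ext x
    have h := congrFun (congrArg Subtype.val (L.jacobi a b' (A.subIncl e))) x
    exact sub_eq_iff_eq_add.2 h

end Hom

section Image

variable {F : Type*} [NormedAddCommGroup F] [NormedSpace ℝ F] [FiniteDimensional ℝ F]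
  {V : M → Type v} [∀ x, AddCommGroup (V x)] [∀ x, Module ℝ (V x)] [∀ x, TopologicalSpace (V x)]
  [TopologicalSpace (TotalSpace F V)] [FiberBundle F V] [VectorBundle ℝ F V]
  {F' : Type*} [NormedAddCommGroup F'] [NormedSpace ℝ F'] [FiniteDimensional ℝ F']
  {V' : M → Type w} [∀ x, AddCommGroup (V' x)] [∀ x, Module ℝ (V' x)]
  [∀ x, TopologicalSpace (V' x)] [TopologicalSpace (TotalSpace F' V')] [FiberBundle F' V']
  [VectorBundle ℝ F' V'] [ContMDiffVectorBundle ∞ F' V' (𝓡 n)]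

/-- A section which is smooth near a point agrees near it with a global smooth section. -/
theorem exists_sec_eventuallyEq [T2Space M] (s : ∀ x, V x) (x₀ : M)
    (h : ∃ U ∈ 𝓝 x₀, ContMDiffOn (𝓡 n) ((𝓡 n).prod 𝓘(ℝ, F)) ∞
      (fun x => TotalSpace.mk' F x (s x)) U) :
    ∃ σ : (SmoothFamily.ofBundle n F V).sec, ∀ᶠ x in 𝓝 x₀, σ.1 x = s x := by
  obtain ⟨U, hU, hs⟩ := h
  obtain ⟨U', hU'U, hU'o, hx₀⟩ := mem_nhds_iff.1 hU
  obtain ⟨f, -, hf⟩ :=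
    ((SmoothBumpFunction.nhds_basis_tsupport (I := 𝓡 n) x₀).mem_iff.1 (hU'o.mem_nhds hx₀))
  refine ⟨⟨fun x => f x • s x, ?_⟩, ?_⟩
  · exact ContMDiffOn.smul_section_of_tsupport (u := U') f.contMDiff.contMDiffOn hU'o hf
      (hs.mono hU'U)
  · filter_upwards [f.eventuallyEq_one] with x hx
    have hx' : f x = 1 := hx
    simp [hx']

variable [ContMDiffVectorBundle ∞ F V (𝓡 n)]

/-- Sections of the image of a morphism of constant rank lift locally. -/
theorem Hom.exists_local_lift [T2Space M] {L : LieAlgebroid (SmoothFamily.ofBundle n F V)}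
    {L' : LieAlgebroid (SmoothFamily.ofBundle n F' V')} (Φ : L.Hom L') (b : ℕ)
    (hb : ∀ x, finrank ℝ (LinearMap.range (Φ.map x)) = b)
    (y : (SmoothFamily.ofBundle n F' V').sec) (hy : ∀ x, y.1 x ∈ LinearMap.range (Φ.map x))
    (x₀ : M) :
    ∃ X : (SmoothFamily.ofBundle n F V).sec, ∀ᶠ x in 𝓝 x₀, Φ.map x (X.1 x) = y.1 x := by
  classical
  -- sections `a i` of the source whose images at `x₀` form a basis of the image
  have : ∀ x, Module.Finite ℝ (V' x) := (SmoothFamily.ofBundle n F' V').finite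
  let B : Basis (Fin b) ℝ (LinearMap.range (Φ.map x₀)) := finBasisOfFinrankEq ℝ _ (hb x₀)
  choose v hv using fun i => LinearMap.mem_range.1 (B i).2
  choose a ha using fun i : Fin b => exists_sec_eventuallyEq (n := n) (F := F)
    (FiberBundle.extend F (v i)) x₀ (FiberBundle.exists_contMDiffOn_extend (I := 𝓡 n) F (v i))
  have ha₀ : ∀ i, Φ.map x₀ ((a i).1 x₀) = (B i : V' x₀) := fun i => by
    rw [(ha i).self_of_nhds, FiberBundle.extend_apply_self, hv]
  -- a dual family at `x₀`
  obtain ⟨p, hp⟩ : ∃ p : Fin b → (V' x₀ →ₗ[ℝ] ℝ), ∀ i j, p i (B j : V' x₀) = if i = j then 1 else 0 := by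
    choose p hp using fun i => LinearMap.exists_extend (B.coord i)
    refine ⟨p, fun i j => ?_⟩
    have h := congrArg (fun g => g (B j)) (hp i)
    simpa [Finsupp.single_apply, eq_comm] using h
  let e := trivializationAt F' V' x₀
  have hx₀ : x₀ ∈ e.baseSet := FiberBundle.mem_baseSet_trivializationAt' x₀
  let β := finBasis ℝ F'
  -- its extension to functionals near `x₀`
  let pr : Fin b → ∀ x, V' x →ₗ[ℝ] ℝ := fun i x =>
    ∑ k, p i (e.localFrame β k x₀) • e.localFrameCoeff (𝓡 n) β k x
  have hpr₀ : ∀ i w, pr i x₀ w = p i w := fun i w => by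
    have h := e.eq_sum_localFrameCoeff_smul (I := 𝓡 n) (b := β)
      (s := fun x => if h : x = x₀ then h ▸ w else 0) hx₀
    simp only [dite_true] at h
    conv_rhs => rw [h]
    simp [pr, mul_comm]
  have hprs : ∀ (i) (s : (SmoothFamily.ofBundle n F' V').sec) (x), x ∈ e.baseSet →
      ContMDiffAt (𝓡 n) 𝓘(ℝ, ℝ) ∞ (fun x => pr i x (s.1 x)) x := fun i s x hx => by
    have h : ∀ k, ContMDiffAt (𝓡 n) 𝓘(ℝ, ℝ) ∞
        (fun x => e.localFrameCoeff (𝓡 n) β k x (s.1 x)) x := fun k =>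
      contMDiffAt_localFrameCoeff β hx (s.2 x) k
    have h2 : (fun x => pr i x (s.1 x)) = fun x =>
        ∑ k, p i (e.localFrame β k x₀) * e.localFrameCoeff (𝓡 n) β k x (s.1 x) := by
      funext x
      simp [pr]
    rw [h2]
    exact contMDiffAt_finsetSum fun k _ => contMDiffAt_const.mul (h k)
  let w : Fin b → (SmoothFamily.ofBundle n F' V').sec := fun j => Φ.onSec (a j)
  let m : M → Matrix (Fin b) (Fin b) ℝ := fun x => Matrix.of fun i j => pr i x ((w j).1 x)
  let q : M → Fin b → ℝ := fun x i => pr i x (y.1 x)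
  have hdet : ∀ (m : M → Matrix (Fin b) (Fin b) ℝ) (x : M),
      (∀ i j, ContMDiffAt (𝓡 n) 𝓘(ℝ, ℝ) ∞ (fun x => m x i j) x) →
      ContMDiffAt (𝓡 n) 𝓘(ℝ, ℝ) ∞ (fun x => (m x).det) x := fun m x hm => by
    simp only [Matrix.det_apply']
    exact contMDiffAt_finsetSum fun σ _ => contMDiffAt_const.mul
      (contMDiffAt_finsetProd fun i _ => hm _ _)
  have hm : ∀ x ∈ e.baseSet, ∀ i j, ContMDiffAt (𝓡 n) 𝓘(ℝ, ℝ) ∞ (fun x => m x i j) x :=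
    fun x hx i j => hprs i (w j) x hx
  have hm₀ : m x₀ = 1 := by
    ext i j
    simp only [m, Matrix.of_apply, hpr₀, Matrix.one_apply]
    rw [← hp i j, ← ha₀ j]
    rfl
  have hdm : ∀ x ∈ e.baseSet, ContMDiffAt (𝓡 n) 𝓘(ℝ, ℝ) ∞ (fun x => (m x).det) x :=
    fun x hx => hdet m x (hm x hx)
  let U : Set M := {x | x ∈ e.baseSet ∧ (m x).det ≠ 0}
  have hU : U ∈ 𝓝 x₀ := by
    have h1 : ∀ᶠ x in 𝓝 x₀, (m x).det ≠ 0 :=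
      (hdm x₀ hx₀).continuousAt.eventually_ne (by simp [hm₀])
    filter_upwards [h1, e.open_baseSet.mem_nhds hx₀] with x h h' using ⟨h', h⟩
  -- the coefficients, by Cramer's rule
  let c : Fin b → M → ℝ := fun i x => (m x).det⁻¹ * ((m x).updateCol i (q x)).det
  have hc : ∀ i, ∀ x ∈ U, ContMDiffAt (𝓡 n) 𝓘(ℝ, ℝ) ∞ (c i) x := fun i x hx => by
    refine ContMDiffAt.mul ?_ (hdet _ x fun j k => ?_)
    · exact ((contDiffAt_inv ℝ hx.2).contMDiffAt).comp x (hdm x hx.1)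
    · by_cases hk : k = i
      · subst hk
        simpa using hprs j y x hx.1
      · simpa [Matrix.updateCol_ne hk] using hm x hx.1 j k
  obtain ⟨X, hX⟩ := exists_sec_eventuallyEq (n := n) (F := F)
    (fun x => ∑ i, c i x • (a i).1 x) x₀ ⟨U, hU, fun x hx => by
      refine ContMDiffWithinAt.sum_section fun i _ => ?_
      exact ContMDiffWithinAt.smul_section (hc i x hx).contMDiffWithinAt
        ((a i).2 x).contMDiffWithinAt⟩
  refine ⟨X, ?_⟩
  filter_upwards [hX, hU] with x hX hx
  rw [hX]
  -- the images of the `a i` span the image at `x`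
  have hmul : ∀ d : Fin b → ℝ, (fun i => pr i x (∑ j, d j • (w j).1 x)) = (m x).mulVec d :=
    fun d => by
      funext i
      simp [m, Matrix.mulVec, dotProduct, mul_comm]
  have hinj : ∀ d : Fin b → ℝ, (m x).mulVec d = 0 → d = 0 := fun d hd => by
    exact Matrix.eq_zero_of_mulVec_eq_zero hx.2 hd
  have hwli : LinearIndependent ℝ (fun j => (w j).1 x) := by
    rw [Fintype.linearIndependent_iff]
    intro d hd i
    have h := hmul d
    rw [hd] at h
    exact congrFun (hinj d (by rw [← h]; funext i; simp)) i
  have hspan : Submodule.span ℝ (Set.range fun j => (w j).1 x) = LinearMap.range (Φ.map x) := by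
    refine Submodule.eq_of_le_of_finrank_eq ?_ ?_
    · rw [Submodule.span_le]
      rintro _ ⟨j, rfl⟩
      exact ⟨(a j).1 x, rfl⟩
    · rw [finrank_span_eq_card hwli, hb, Fintype.card_fin]
  have hyx := hy x
  rw [← hspan, Submodule.mem_span_range_iff_exists_fun] at hyx
  obtain ⟨d, hd⟩ := hyx
  have hq : q x = (m x).mulVec d := by
    rw [← hmul d]
    funext i
    simp only [q, hd]
  have hcd : ∀ i, c i x = d i := by
    have h1 : (fun i => c i x) = (m x).det⁻¹ • Matrix.cramer (m x) (q x) := by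
      funext i
      simp [c, Matrix.cramer_apply]
    have h2 : (m x).mulVec ((fun i => c i x) - d) = 0 := by
      rw [Matrix.mulVec_sub, h1, Matrix.mulVec_smul, Matrix.mulVec_cramer, ← hq, smul_smul,
        inv_mul_cancel₀ hx.2, one_smul, sub_self]
    intro i
    exact sub_eq_zero.1 (congrFun (hinj _ h2) i)
  rw [map_sum, ← hd]
  refine Finset.sum_congr rfl fun i _ => ?_
  rw [map_smul, hcd]
  rfl

namespace Hom

variable [T2Space M] {L : LieAlgebroid (SmoothFamily.ofBundle n F V)}
  {L' : LieAlgebroid (SmoothFamily.ofBundle n F' V')} (Φ : L.Hom L') (b : ℕ)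
  (hb : ∀ x, finrank ℝ (LinearMap.range (Φ.map x)) = b)

theorem bracket_mem_range (b : ℕ) (hb : ∀ x, finrank ℝ (LinearMap.range (Φ.map x)) = b) (s t : (SmoothFamily.ofBundle n F' V').sec)
    (hs : ∀ x, s.1 x ∈ LinearMap.range (Φ.map x)) (ht : ∀ x, t.1 x ∈ LinearMap.range (Φ.map x))
    (x : M) : (L'.bracket s t).1 x ∈ LinearMap.range (Φ.map x) := by
  obtain ⟨X, hX⟩ := Φ.exists_local_lift b hb s hs x
  obtain ⟨Y, hY⟩ := Φ.exists_local_lift b hb t ht x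
  have h := L'.bracket_congr (Φ.onSec X) s (Φ.onSec Y) t x hX hY
  rw [← h, ← Φ.onSec_bracket]
  exact ⟨(L.bracket X Y).1 x, rfl⟩

/-- The image `B` of a morphism of constant rank, a Lie subalgebroid of `A'`. -/
def image : LieAlgebroid (Φ.imBundle b hb) :=
  L'.sub _ _ _ (Φ.bracket_mem_range b hb)

/-- The surjective morphism `Φ_B : A → B` induced by `Φ`. -/
def toImage : L.Hom (Φ.image b hb) where
  map x := (Φ.map x).rangeRestrict
  map_mem s := Φ.map_mem s
  anchor_map x a := Φ.anchor_map x a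
  map_bracket s t x := by
    ext
    exact Φ.map_bracket s t x

/-- `R` is the representation `D^{B,K}` of `B` on `K = ⋀^top C`: one has
`D^{B,K}_{Φ X} = D^{A,K}_X` for all `X`, where `D^{A,K}` is the representation of `A` on
`⋀^top C` induced by the adjoint representation on `C`. -/
def IsKernelRep (R : (Φ.image b hb).Rep (Φ.kerBundle b hb).top) : Prop :=
  ∃ R' : L.Rep (Φ.kerBundle b hb).top, (Φ.adjointRep b hb).IsTop R' ∧
    ∀ (X : (SmoothFamily.ofBundle n F V).sec) (lam : (Φ.kerBundle b hb).top.sec),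
      R.D ((Φ.toImage b hb).onSec X) lam = R'.D X lam

/-- `R` is the representation of `B` on `⋀^top (A'/B)` induced by the representation of `B` on
`A'/B` given by the bracket, `Y · [Z] = [[Y, Z]]`. -/
def IsCokernelRep (R : (Φ.image b hb).Rep (Φ.cokerBundle b hb).top) : Prop :=
  ∃ R' : (Φ.image b hb).Rep (Φ.cokerBundle b hb),
    (∀ (Y : (Φ.imBundle b hb).sec) (Z : (SmoothFamily.ofBundle n F' V').sec),
      R'.D Y (SmoothFamily.quotMk _ _ b hb Z) =
        SmoothFamily.quotMk _ _ b hb (L'.bracket (SmoothFamily.subIncl _ Y) Z)) ∧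
    R'.IsTop R

end Hom

end Image

end LieAlgebroid

end Algebroids

/-!
Every characteristic class is half the class of a characteristic cocycle of the square of the
representation, and the square of a line bundle always has a nowhere-vanishing section
(`LocallyLine.exists_sec_tensor_ne_zero`, `Rep.isCharClass_iff`). So orientability plays no role:
the theorem is a statement about the cocycles of four line bundles,
`⋀^top A ⊗ ⋀^top T^*M`, `⋀^top A' ⊗ ⋀^top T^*M`, `⋀^top C` and `⋀^top (A'/B)`.

Near each point there is an adapted frame (`Hom.exists_adaptedFrame`): sections `k` of `C`, `a` of
`A` and `z` of `A'` such that `(k, a)`, `(Φ a, z)`, `k` and `z mod B` are frames of `A`, `A'`, `C`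
and `A'/B`. In such a frame `[X, ·]` and `[Φ X, ·]` are block-triangular with diagonal blocks
`(κ, β)` and `(β, ζ)`, where `κ`, `β` and `ζ` describe the actions of `X` on `C`, `B` and `A'/B`, and
a representation on a top exterior power acts by the trace (`wedgeDeriv_eq_trace`). If `τ` is the
trace of the Lie derivative on `1`-forms, the identity
`(κ + β + τ) - (β + ζ + τ) - (κ - ζ) = 0` of traces gives the formula locally, up to the
differential of the logarithm of a function `hA hQ / (hA' hK)` which compares the chosen global
sections of the four squares with the generators given by the frame. This function does not depend
on the adapted frame (`Hom.IsAdaptedData.ratio_eq`), because the four generators change by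
block-triangular determinants whose combined effect cancels; hence the difference of the two sides
is globally exact (`Hom.modularClass_eq`).

The representations are constructed from derivations (`IsDer`): a derivation of a locally free
family extends to its top exterior power (`exists_isDer_top`), its dual and, for line bundles, to
tensor products, and a family of derivations of a line bundle is a representation as soon as it is
linear and flat on local generators (`exists_rep`). The canonical representation is linear over the
functions because the defects of `[f a, ·]` and of the Lie derivative along `ρ(f a)` have opposite
traces. The representation of `A` on `⋀^top C` descends to `B` because unimodularity of `C`, whose
anchor vanishes, means that the operators `[k, ·]` on `C` are trace-free
(`IsUnimodular.wedgeDeriv_bracket_eq_zero`), and because sections of `B` lift to sections of `A`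
(`Hom.toImage_onSec_surjective`).
-/

/-! ### Calculus of real functions on the manifold -/

section Calculus

variable {n : ℕ} {M : Type u} [TopologicalSpace M] [ChartedSpace (EuclideanSpace ℝ (Fin n)) M]

/-- Smoothness of a real function at a point of the manifold. -/
abbrev SmoothAt (n : ℕ) {M : Type u} [TopologicalSpace M]
    [ChartedSpace (EuclideanSpace ℝ (Fin n)) M] (f : M → ℝ) (x : M) : Prop :=
  ContMDiffAt (𝓡 n) 𝓘(ℝ, ℝ) ∞ f x

theorem SmoothAt.mdifferentiableAt' {f : M → ℝ} {x : M} (hf : SmoothAt n f x) :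
    MDifferentiableAt (𝓡 n) 𝓘(ℝ, ℝ) f x :=
  hf.mdifferentiableAt (by simp)

theorem smoothAt_coe (f : C^∞⟮𝓡 n, M; ℝ⟯) (x : M) : SmoothAt n f x := f.contMDiff x

theorem dirDeriv_congr {f g : M → ℝ} {x : M} (h : f =ᶠ[𝓝 x] g) (v : TangentSpace (𝓡 n) x) :
    dirDeriv f x v = dirDeriv g x v := by
  unfold dirDeriv
  rw [h.mfderiv_eq]
  rfl

theorem dirDeriv_const (c : ℝ) (x : M) (v : TangentSpace (𝓡 n) x) :
    dirDeriv (fun _ : M => c) x v = 0 :=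
  congrArg (fun L => L v) (mfderiv_const (I := 𝓡 n) (I' := 𝓘(ℝ, ℝ)) (x := x) (c := c))

theorem dirDeriv_add_at {f g : M → ℝ} {x : M} (hf : SmoothAt n f x) (hg : SmoothAt n g x)
    (v : TangentSpace (𝓡 n) x) :
    dirDeriv (fun y => f y + g y) x v = dirDeriv f x v + dirDeriv g x v :=
  congrArg (fun L => L v) (mfderiv_add hf.mdifferentiableAt' hg.mdifferentiableAt')

theorem dirDeriv_mul {f g : M → ℝ} {x : M} (hf : SmoothAt n f x) (hg : SmoothAt n g x)
    (v : TangentSpace (𝓡 n) x) :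
    dirDeriv (fun y => f y * g y) x v = f x * dirDeriv g x v + g x * dirDeriv f x v :=
  congrArg (fun L => L v)
    (hf.mdifferentiableAt'.hasMFDerivAt.mul hg.mdifferentiableAt'.hasMFDerivAt).mfderiv

theorem dirDeriv_sum {ι : Type*} (t : Finset ι) {f : ι → M → ℝ} {x : M}
    (hf : ∀ i ∈ t, SmoothAt n (f i) x) (v : TangentSpace (𝓡 n) x) :
    dirDeriv (fun y => ∑ i ∈ t, f i y) x v = ∑ i ∈ t, dirDeriv (f i) x v := by
  classical
  induction t using Finset.induction_on with
  | empty => simpa using dirDeriv_const 0 x v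
  | insert i t hi ih =>
    simp only [Finset.sum_insert hi]
    rw [dirDeriv_add_at (hf i (by simp))
      (contMDiffAt_finsetSum fun j hj => hf j (Finset.mem_insert_of_mem hj)),
      ih fun j hj => hf j (Finset.mem_insert_of_mem hj)]

theorem dirDeriv_prod {ι : Type*} [DecidableEq ι] (t : Finset ι) {f : ι → M → ℝ} {x : M}
    (hf : ∀ i ∈ t, SmoothAt n (f i) x) (v : TangentSpace (𝓡 n) x) :
    dirDeriv (fun y => ∏ i ∈ t, f i y) x v =
      ∑ i ∈ t, (∏ j ∈ t.erase i, f j x) * dirDeriv (f i) x v := by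
  induction t using Finset.induction_on with
  | empty => simpa using dirDeriv_const 1 x v
  | insert i t hi ih =>
    simp only [Finset.prod_insert hi, Finset.sum_insert hi, Finset.erase_insert hi]
    rw [dirDeriv_mul (hf i (by simp))
      (contMDiffAt_finsetProd fun j hj => hf j (Finset.mem_insert_of_mem hj)),
      ih fun j hj => hf j (Finset.mem_insert_of_mem hj), add_comm, Finset.mul_sum]
    congr 1
    refine Finset.sum_congr rfl fun j hj => ?_
    have hji : i ≠ j := fun h => hi (h ▸ hj)
    rw [Finset.erase_insert_of_ne hji, Finset.prod_insert (by simp [hi])]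
    ring

theorem smoothAt_det {ι : Type*} [Fintype ι] [DecidableEq ι] {c : ι → ι → M → ℝ} {x : M}
    (hc : ∀ i j, SmoothAt n (c i j) x) :
    SmoothAt n (fun y => (Matrix.of fun i j => c i j y).det) x := by
  simp only [Matrix.det_apply', Matrix.of_apply]
  exact contMDiffAt_finsetSum fun σ _ => contMDiffAt_const.mul
    (contMDiffAt_finsetProd fun i _ => hc _ _)

/-- Expansion of the sum of the determinants obtained by replacing one row at a time. -/
theorem Matrix.sum_det_updateRow {ι R : Type*} [Fintype ι] [DecidableEq ι] [CommRing R]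
    (c d : Matrix ι ι R) :
    ∑ i, (c.updateRow i (d i)).det = (d * c.adjugate).trace := by
  rw [Matrix.trace]
  refine Finset.sum_congr rfl fun i _ => ?_
  rw [Matrix.diag_apply, Matrix.mul_apply]
  have h := Matrix.cramer_eq_adjugate_mulVec c.transpose (d i)
  have h2 := congrFun h i
  rw [Matrix.cramer_transpose_apply] at h2
  rw [h2, ← Matrix.adjugate_transpose]
  simp [Matrix.mulVec, dotProduct, mul_comm]

/-- Jacobi's formula for the derivative of a determinant. -/
theorem dirDeriv_det {ι : Type*} [Fintype ι] [DecidableEq ι] {c : ι → ι → M → ℝ} {x : M}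
    (hc : ∀ i j, SmoothAt n (c i j) x) (v : TangentSpace (𝓡 n) x) :
    dirDeriv (fun y => (Matrix.of fun i j => c i j y).det) x v =
      ((Matrix.of fun i j => dirDeriv (c i j) x v) *
        (Matrix.of fun i j => c i j x).adjugate).trace := by
  rw [← Matrix.sum_det_updateRow]
  have h1 : ∀ i, ((Matrix.of fun i j => c i j x).updateRow i
      ((Matrix.of fun i j => dirDeriv (c i j) x v) i)).det =
      ∑ σ : Equiv.Perm ι, (Equiv.Perm.sign σ : ℝ) *
        ((∏ j ∈ Finset.univ.erase i, c j (σ j) x) * dirDeriv (c i (σ i)) x v) := fun i => by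
    rw [← Matrix.det_transpose, Matrix.det_apply']
    refine Finset.sum_congr rfl fun σ _ => ?_
    rw [← Finset.prod_erase_mul _ _ (Finset.mem_univ i)]
    congr 2
    · refine Finset.prod_congr rfl fun j hj => ?_
      simp [Matrix.updateRow_ne (Finset.ne_of_mem_erase hj)]
    · simp
  simp_rw [h1]
  rw [Finset.sum_comm]
  simp_rw [← Finset.mul_sum]
  have h2 : (fun y => (Matrix.of fun i j => c i j y).det) = fun y =>
      ∑ σ : Equiv.Perm ι, (Equiv.Perm.sign σ : ℝ) * ∏ i, c i (σ i) y := by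
    funext y
    rw [← Matrix.det_transpose, Matrix.det_apply']
    simp
  rw [h2, dirDeriv_sum _ (f := fun σ y => (Equiv.Perm.sign σ : ℝ) * ∏ i, c i (σ i) y)
    fun σ _ => contMDiffAt_const.mul (contMDiffAt_finsetProd fun i _ => hc _ _)]
  refine Finset.sum_congr rfl fun σ _ => ?_
  rw [dirDeriv_mul contMDiffAt_const (contMDiffAt_finsetProd fun i _ => hc _ _),
    dirDeriv_const, mul_zero, add_zero, dirDeriv_prod _ fun i _ => hc _ _]

theorem smoothAt_inv {f : M → ℝ} {x : M} (hf : SmoothAt n f x) (h0 : f x ≠ 0) :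
    SmoothAt n (fun y => (f y)⁻¹) x :=
  ((contDiffAt_inv ℝ h0).contMDiffAt).comp x hf

theorem smoothAt_log {f : M → ℝ} {x : M} (hf : SmoothAt n f x) (h0 : f x ≠ 0) :
    SmoothAt n (fun y => Real.log (f y)) x :=
  ((Real.contDiffAt_log.2 h0).contMDiffAt).comp x hf

theorem dirDeriv_log {f : M → ℝ} {x : M} (hf : SmoothAt n f x) (h0 : f x ≠ 0)
    (v : TangentSpace (𝓡 n) x) :
    dirDeriv (fun y => Real.log (f y)) x v = dirDeriv f x v / f x := by
  have h1 := (Real.hasDerivAt_log h0).hasFDerivAt.hasMFDerivAt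
  have h2 := (h1.comp x hf.mdifferentiableAt'.hasMFDerivAt).mfderiv
  have h3 := congrArg (fun L => L v) h2
  refine h3.trans ?_
  change dirDeriv f x v * (f x)⁻¹ = _
  rw [div_eq_mul_inv]

theorem dirDeriv_vadd (f : M → ℝ) (x : M) (v w : TangentSpace (𝓡 n) x) :
    dirDeriv f x (v + w) = dirDeriv f x v + dirDeriv f x w :=
  map_add (mfderiv (𝓡 n) 𝓘(ℝ, ℝ) f x) v w

theorem dirDeriv_vsmul (f : M → ℝ) (x : M) (c : ℝ) (v : TangentSpace (𝓡 n) x) :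
    dirDeriv f x (c • v) = c * dirDeriv f x v :=
  map_smul (mfderiv (𝓡 n) 𝓘(ℝ, ℝ) f x) c v

theorem dirDeriv_vzero (f : M → ℝ) (x : M) :
    dirDeriv f x (0 : TangentSpace (𝓡 n) x) = 0 :=
  map_zero (mfderiv (𝓡 n) 𝓘(ℝ, ℝ) f x)

theorem dirDeriv_vsum {ι : Type*} (t : Finset ι) (f : M → ℝ) (x : M)
    (v : ι → TangentSpace (𝓡 n) x) :
    dirDeriv f x (∑ i ∈ t, v i) = ∑ i ∈ t, dirDeriv f x (v i) :=
  map_sum (mfderiv (𝓡 n) 𝓘(ℝ, ℝ) f x) v t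

theorem contMDiff_bump_mul {U : Set M} (g : C^∞⟮𝓡 n, M; ℝ⟯) (hg : tsupport g ⊆ U) {f : M → ℝ}
    (hf : ∀ y ∈ U, SmoothAt n f y) :
    ContMDiff (𝓡 n) 𝓘(ℝ, ℝ) ∞ (fun y => g y * f y) := by
  refine contMDiff_of_tsupport fun y hy => ?_
  exact (g.contMDiff y).mul (hf y (hg (tsupport_mul_subset_left hy)))

section Bump

variable [T2Space M] [IsManifold (𝓡 n) ∞ M]

/-- A bump function: a global smooth function equal to `1` near `x`, with topological support in a
given neighbourhood of `x`. -/
theorem exists_bump {U : Set M} (x : M) (hU : U ∈ 𝓝 x) :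
    ∃ f : C^∞⟮𝓡 n, M; ℝ⟯, (∀ᶠ y in 𝓝 x, f y = 1) ∧ tsupport f ⊆ U := by
  obtain ⟨f, -, hf⟩ := (SmoothBumpFunction.nhds_basis_tsupport (I := 𝓡 n) x).mem_iff.1 hU
  exact ⟨⟨f, f.contMDiff⟩, f.eventuallyEq_one, hf⟩

/-- A function which is smooth near `x` agrees near `x` with a global smooth function. -/
theorem exists_smooth_eventuallyEq {U : Set M} {x : M} (hU : U ∈ 𝓝 x) {f : M → ℝ}
    (hf : ∀ y ∈ U, SmoothAt n f y) : ∃ g : C^∞⟮𝓡 n, M; ℝ⟯, ∀ᶠ y in 𝓝 x, g y = f y := by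
  obtain ⟨g, hg1, hg⟩ := exists_bump (n := n) x hU
  refine ⟨⟨fun y => g y * f y, contMDiff_bump_mul g hg hf⟩, ?_⟩
  filter_upwards [hg1] with y hy
  change g y * f y = f y
  rw [hy, one_mul]

end Bump

section Along

variable [IsManifold (𝓡 n) ∞ M]

/-- The derivative of a smooth function along a smooth vector field is smooth. -/
theorem contMDiff_dirDeriv (f : C^∞⟮𝓡 n, M; ℝ⟯) (v : (SmoothFamily.tangent n M).sec) :
    ContMDiff (𝓡 n) 𝓘(ℝ, ℝ) ∞ (fun y => dirDeriv f y (v.1 y)) := by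
  have h1 : ContMDiff (𝓡 n).tangent 𝓘(ℝ, ℝ).tangent ∞ (tangentMap (𝓡 n) 𝓘(ℝ, ℝ) f) :=
    f.contMDiff.contMDiff_tangentMap le_rfl
  have h2 := h1.comp v.2
  intro x
  exact contMDiff_snd_tangentBundle_modelSpace ℝ 𝓘(ℝ, ℝ) _ |>.comp x (h2 x)

/-- The derivative of a smooth function along a smooth vector field, as a smooth function. -/
def derivAlong (v : (SmoothFamily.tangent n M).sec) (f : C^∞⟮𝓡 n, M; ℝ⟯) : C^∞⟮𝓡 n, M; ℝ⟯ :=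
  ⟨fun y => dirDeriv f y (v.1 y), contMDiff_dirDeriv f v⟩

end Along

end Calculus

/-! ### Local frames and generators -/

section LinearAlgebra

/-- The value of an alternating map on linear combinations of as many vectors as it has
arguments. -/
theorem AlternatingMap.map_sum_smul_eq_det {ι V N : Type*} [Fintype ι] [DecidableEq ι]
    [AddCommGroup V] [Module ℝ V] [AddCommGroup N] [Module ℝ N] (f : V [⋀^ι]→ₗ[ℝ] N)
    (c : Matrix ι ι ℝ) (e : ι → V) :
    f (fun i => ∑ j, c i j • e j) = c.det • f e := by
  let g : (ι → ℝ) [⋀^ι]→ₗ[ℝ] N := f.compLinearMap (Fintype.linearCombination ℝ e)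
  let h : (ι → ℝ) [⋀^ι]→ₗ[ℝ] N :=
    (LinearMap.toSpanSingleton ℝ N (f e)).compAlternatingMap Matrix.detRowAlternating
  have hgh : g = h := by
    refine Basis.ext_alternating (Pi.basisFun ℝ ι) fun v hv => ?_
    let σ : Equiv.Perm ι := Equiv.ofBijective v (Finite.injective_iff_bijective.1 hv)
    have h1 : g (fun i => Pi.basisFun ℝ ι (v i)) = Equiv.Perm.sign σ • f e := by
      have h3 : g (fun i => Pi.basisFun ℝ ι (v i)) = f (e ∘ σ) := by
        simp only [g, AlternatingMap.compLinearMap_apply]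
        congr 1
        funext i
        simp [σ]
      rw [h3, AlternatingMap.map_perm]
    have h2 : h (fun i => Pi.basisFun ℝ ι (v i)) = Equiv.Perm.sign σ • f e := by
      have h4 : (Matrix.detRowAlternating fun i => Pi.basisFun ℝ ι (v i)) =
          ((Equiv.Perm.sign σ : ℤ) : ℝ) := by
        have h5 := AlternatingMap.map_perm (Matrix.detRowAlternating (R := ℝ) (n := ι))
          (fun i => Pi.basisFun ℝ ι i) σ
        have h6 : (Matrix.detRowAlternating (R := ℝ) (n := ι))
            (fun i => Pi.basisFun ℝ ι i) = 1 := by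
          have h7 : (fun i => Pi.basisFun ℝ ι i) = (1 : Matrix ι ι ℝ) := by
            funext i j
            simp [Matrix.one_apply, Pi.single_apply, eq_comm]
          rw [h7]
          exact Matrix.det_one
        rw [h6] at h5
        refine h5.trans ?_
        rw [Units.smul_def]
        simp
      simp only [h, LinearMap.compAlternatingMap_apply, h4, LinearMap.toSpanSingleton_apply]
      rw [Units.smul_def, Int.cast_smul_eq_zsmul]
    rw [h1, h2]
  have h1 : f (fun i => Fintype.linearCombination ℝ e (c i)) = c.det • f e :=
    congrArg (fun k => k c) hgh
  simpa only [Fintype.linearCombination_apply] using h1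

/-- The sum of the values of an alternating map in which the arguments are replaced, one at a time,
by their images under a matrix, is the trace of the matrix times the value. -/
theorem AlternatingMap.sum_update_eq_trace {ι V N : Type*} [Fintype ι] [DecidableEq ι]
    [AddCommGroup V] [Module ℝ V] [AddCommGroup N] [Module ℝ N] (f : V [⋀^ι]→ₗ[ℝ] N)
    (γ : ι → ι → ℝ) (e d : ι → V) (hd : ∀ i, d i = ∑ j, γ i j • e j) :
    ∑ i, f (Function.update e i (d i)) = (∑ i, γ i i) • f e := by
  rw [Finset.sum_smul]
  refine Finset.sum_congr rfl fun i _ => ?_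
  rw [hd, f.map_update_sum, Finset.sum_eq_single i]
  · rw [f.map_update_smul, Function.update_eq_self]
  · intro j _ hj
    rw [f.map_update_smul, f.map_update_self _ hj.symm, smul_zero]
  · simp

theorem exteriorPower.ιMulti_ne_zero {V : Type*} [AddCommGroup V] [Module ℝ V]
    [Module.Finite ℝ V] {r : ℕ} (hr : finrank ℝ V = r) {e : Fin r → V}
    (he : LinearIndependent ℝ e) : exteriorPower.ιMulti ℝ r e ≠ 0 := by
  intro h
  let b : Basis (Fin r) ℝ V := Basis.mk he
    (he.span_eq_top_of_card_eq_finrank' (by simp [hr])).ge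
  have h1 := exteriorPower.alternatingMapLinearEquiv_apply_ιMulti b.det e
  rw [h, map_zero] at h1
  have h2 : b.det e = 1 := by
    have h3 : e = b := by simp [b]
    rw [h3, Basis.det_self]
  rw [h2] at h1
  exact zero_ne_one h1

theorem LinearIndependent.matrix_smul_iff {ι V : Type*} [Fintype ι] [DecidableEq ι]
    [AddCommGroup V] [Module ℝ V] {e : ι → V} (he : LinearIndependent ℝ e) (c : Matrix ι ι ℝ) :
    LinearIndependent ℝ (fun i => ∑ j, c i j • e j) ↔ c.det ≠ 0 := by
  have h1 : (fun i => ∑ j, c i j • e j) = Fintype.linearCombination ℝ e ∘ c.row := by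
    funext i
    simp [Fintype.linearCombination_apply, Matrix.row, Function.comp]
  have h2 : LinearMap.ker (Fintype.linearCombination ℝ e) = ⊥ :=
    LinearMap.ker_eq_bot.2 he.fintypeLinearCombination_injective
  rw [h1, LinearMap.linearIndependent_iff _ h2, Matrix.linearIndependent_rows_iff_isUnit,
    Matrix.isUnit_iff_isUnit_det, isUnit_iff_ne_zero]

theorem LinearIndependent.coeff_unique {ι V : Type*} [Fintype ι]
    [AddCommGroup V] [Module ℝ V] {e : ι → V} (he : LinearIndependent ℝ e) {c d : ι → ℝ}
    (h : ∑ i, c i • e i = ∑ i, d i • e i) : c = d :=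
  he.fintypeLinearCombination_injective (by simpa [Fintype.linearCombination_apply] using h)

theorem tmul_ne_zero_of_ne_zero {V W : Type*} [AddCommGroup V] [Module ℝ V] [AddCommGroup W]
    [Module ℝ W] {v : V} {w : W} (hv : v ≠ 0) (hw : w ≠ 0) : v ⊗ₜ[ℝ] w ≠ 0 := by
  obtain ⟨φ, hφ⟩ : ∃ φ : Dual ℝ V, φ v ≠ 0 := by
    by_contra! h
    exact hv ((Module.forall_dual_apply_eq_zero_iff ℝ v).1 h)
  obtain ⟨ψ, hψ⟩ : ∃ ψ : Dual ℝ W, ψ w ≠ 0 := by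
    by_contra! h
    exact hw ((Module.forall_dual_apply_eq_zero_iff ℝ w).1 h)
  intro h
  have h1 := congrArg (fun t => TensorProduct.lid ℝ ℝ (TensorProduct.map φ ψ t)) h
  simp [hφ, hψ] at h1

end LinearAlgebra

namespace SmoothFamily

variable {n : ℕ} {M : Type u} [TopologicalSpace M] [ChartedSpace (EuclideanSpace ℝ (Fin n)) M]

@[simp] theorem smul_apply {E : SmoothFamily.{u, v} n M} (f : C^∞⟮𝓡 n, M; ℝ⟯) (s : E.sec) (x : M) :
    (f • s).1 x = f x • s.1 x := rfl

@[simp] theorem sum_apply {E : SmoothFamily.{u, v} n M} {ι : Type*} (t : Finset ι) (s : ι → E.sec)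
    (x : M) : (∑ i ∈ t, s i).1 x = ∑ i ∈ t, (s i).1 x := by
  rw [Submodule.coe_sum, Finset.sum_apply]

/-- A finite family of smooth sections is a frame over `U`: it is linearly independent at the
points of `U`, and every smooth section has smooth coefficients with respect to it over `U`. -/
structure IsFrameOn (E : SmoothFamily.{u, v} n M) (U : Set M) {ι : Type*} [Fintype ι]
    (e : ι → E.sec) : Prop where
  linearIndependent : ∀ x ∈ U, LinearIndependent ℝ fun i => (e i).1 x
  exists_coeff : ∀ s : E.sec, ∃ c : ι → M → ℝ, (∀ i, ∀ x ∈ U, SmoothAt n (c i) x) ∧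
    ∀ x ∈ U, s.1 x = ∑ i, c i x • (e i).1 x

namespace IsFrameOn

variable {E : SmoothFamily.{u, v} n M} {U : Set M} {ι : Type*} [Fintype ι] {e : ι → E.sec}

theorem mono {U' : Set M} (h : E.IsFrameOn U e) (hU : U' ⊆ U) : E.IsFrameOn U' e where
  linearIndependent x hx := h.linearIndependent x (hU hx)
  exists_coeff s := by
    obtain ⟨c, hc, hs⟩ := h.exists_coeff s
    exact ⟨c, fun i x hx => hc i x (hU hx), fun x hx => hs x (hU hx)⟩

theorem reindex {κ : Type*} [Fintype κ] (h : E.IsFrameOn U e) (σ : κ ≃ ι) :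
    E.IsFrameOn U (fun k => e (σ k)) where
  linearIndependent x hx := (h.linearIndependent x hx).comp σ σ.injective
  exists_coeff s := by
    obtain ⟨c, hc, hs⟩ := h.exists_coeff s
    refine ⟨fun k => c (σ k), fun k => hc _, fun x hx => ?_⟩
    rw [hs x hx]
    exact (Equiv.sum_comp σ fun i => c i x • (e i).1 x).symm

/-- The coefficients of several sections at once. -/
theorem exists_coeff_family {κ : Type*} (h : E.IsFrameOn U e) (s : κ → E.sec) :
    ∃ c : κ → ι → M → ℝ, (∀ k i, ∀ x ∈ U, SmoothAt n (c k i) x) ∧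
      ∀ k, ∀ x ∈ U, (s k).1 x = ∑ i, c k i x • (e i).1 x := by
  choose c hc hs using fun k => h.exists_coeff (s k)
  exact ⟨c, hc, hs⟩

/-- Sections which form a basis at a point of the domain of a frame form a frame near the point. -/
theorem exists_isFrameOn (h : E.IsFrameOn U e) (hU : IsOpen U) {x₀ : M} (hx₀ : x₀ ∈ U)
    {t : ι → E.sec} (ht : LinearIndependent ℝ fun i => (t i).1 x₀) :
    ∃ U', IsOpen U' ∧ x₀ ∈ U' ∧ U' ⊆ U ∧ E.IsFrameOn U' t := by
  classical
  obtain ⟨c, hc, htc⟩ := h.exists_coeff_family t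
  let m : M → Matrix ι ι ℝ := fun x => Matrix.of fun i j => c i j x
  have hdet : ∀ x ∈ U, SmoothAt n (fun y => (m y).det) x := fun x hx =>
    smoothAt_det fun i j => hc i j x hx
  have hcont : ContinuousOn (fun y => (m y).det) U := fun x hx =>
    (hdet x hx).continuousAt.continuousWithinAt
  have hli : ∀ x ∈ U, LinearIndependent ℝ (fun i => (t i).1 x) ↔ (m x).det ≠ 0 := fun x hx => by
    rw [← (h.linearIndependent x hx).matrix_smul_iff (m x)]
    simp only [htc _ x hx, m, Matrix.of_apply]
  refine ⟨U ∩ (fun y => (m y).det) ⁻¹' {0}ᶜ, hcont.isOpen_inter_preimage hU isOpen_compl_singleton,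
    ⟨hx₀, (hli x₀ hx₀).1 ht⟩, Set.inter_subset_left, fun x hx => (hli x hx.1).2 hx.2, fun s => ?_⟩
  obtain ⟨d, hd, hs⟩ := h.exists_coeff s
  refine ⟨fun k x => ∑ j, d j x * ((m x).det⁻¹ * (m x).adjugate j k), fun k x hx => ?_,
    fun x hx => ?_⟩
  · refine contMDiffAt_finsetSum fun j _ => (hd j x hx.1).mul
      ((smoothAt_inv (hdet x hx.1) hx.2).mul ?_)
    simp only [Matrix.adjugate_apply]
    have h1 : ∀ y, (m y).updateRow k (Pi.single j 1) =
        Matrix.of fun i l => (if i = k then fun _ => (Pi.single j 1 : ι → ℝ) l else c i l) y := by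
      intro y
      ext i l
      by_cases hik : i = k
      · subst hik
        simp
      · simp [hik, m]
    simp only [h1]
    refine smoothAt_det fun i l => ?_
    split_ifs
    · exact contMDiffAt_const
    · exact hc i l x hx.1
  · have h1 : (m x).det⁻¹ • (m x).adjugate * m x = 1 := by
      rw [Matrix.smul_mul, Matrix.adjugate_mul, smul_smul, inv_mul_cancel₀ hx.2, one_smul]
    have h2 : ∀ j, ∑ k, ((m x).det⁻¹ * (m x).adjugate j k) • (t k).1 x = (e j).1 x := fun j => by
      have h3 : ∀ l, ∑ k, ((m x).det⁻¹ * (m x).adjugate j k) * c k l x =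
          (1 : Matrix ι ι ℝ) j l := fun l => by
        rw [← h1, Matrix.mul_apply]
        simp [m]
      simp only [htc _ x hx.1, Finset.smul_sum, smul_smul]
      rw [Finset.sum_comm]
      simp only [← Finset.sum_smul, h3, Matrix.one_apply]
      simp
    rw [hs x hx.1]
    simp only [← h2, Finset.smul_sum, smul_smul, Finset.sum_smul]
    rw [Finset.sum_comm]

end IsFrameOn

/-- A criterion for frames of families whose sections are locally generated by given ones. -/
theorem isFrameOn_of_generators {E : SmoothFamily.{u, v} n M} {U : Set M} {ι : Type*} [Fintype ι]
    {e : ι → E.sec} (hU : IsOpen U) (G : Set (∀ x, E.Fiber x))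
    (hE : ∀ s ∈ E.sec, s ∈ locallyGenerated (n := n) E.Fiber G)
    (hli : ∀ x ∈ U, LinearIndependent ℝ fun i => (e i).1 x)
    (hG : ∀ g ∈ G, ∃ c : ι → M → ℝ, (∀ i, ∀ x ∈ U, SmoothAt n (c i) x) ∧
      ∀ x ∈ U, g x = ∑ i, c i x • (e i).1 x) : E.IsFrameOn U e where
  linearIndependent := hli
  exists_coeff s := by
    have key : ∀ t ∈ Submodule.span ℝ
        {h : ∀ x, E.Fiber x | ∃ f : C^∞⟮𝓡 n, M; ℝ⟯, ∃ g ∈ G, h = fun x => f x • g x},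
        ∃ c : ι → M → ℝ, (∀ i, ∀ x ∈ U, SmoothAt n (c i) x) ∧
          ∀ x ∈ U, t x = ∑ i, c i x • (e i).1 x := by
      intro t ht
      induction ht using Submodule.span_induction with
      | mem t ht =>
        obtain ⟨f, g, hg, rfl⟩ := ht
        obtain ⟨c, hc, hgc⟩ := hG g hg
        refine ⟨fun i x => f x * c i x, fun i x hx => (smoothAt_coe f x).mul (hc i x hx),
          fun x hx => ?_⟩
        simp only [hgc x hx, Finset.smul_sum, smul_smul]
      | zero => exact ⟨fun _ _ => 0, fun _ _ _ => contMDiffAt_const, fun x _ => by simp⟩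
      | add a b _ _ ha hb =>
        obtain ⟨c, hc, hac⟩ := ha
        obtain ⟨d, hd, hbd⟩ := hb
        refine ⟨fun i x => c i x + d i x, fun i x hx => (hc i x hx).add (hd i x hx),
          fun x hx => ?_⟩
        simp only [Pi.add_apply, hac x hx, hbd x hx, add_smul, Finset.sum_add_distrib]
      | smul r a _ ha =>
        obtain ⟨c, hc, hac⟩ := ha
        refine ⟨fun i x => r * c i x, fun i x hx => contMDiffAt_const.mul (hc i x hx),
          fun x hx => ?_⟩
        simp only [Pi.smul_apply, hac x hx, Finset.smul_sum, smul_smul]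
    have key2 : ∀ x₀ ∈ U, ∃ c : ι → M → ℝ, (∀ i, ∀ x ∈ U, SmoothAt n (c i) x) ∧
          ∀ᶠ x in 𝓝 x₀, s.1 x = ∑ i, c i x • (e i).1 x := fun x₀ hx₀ => by
      obtain ⟨t, ht, hst⟩ := hE s.1 s.2 x₀
      obtain ⟨c, hc, htc⟩ := key t ht
      refine ⟨c, hc, ?_⟩
      filter_upwards [hst, hU.mem_nhds hx₀] with x h1 h2
      rw [h1, htc x h2]
    classical
    choose c hc hsc using key2
    refine ⟨fun i x => if hx : x ∈ U then c x hx i x else 0, fun i x₀ hx₀ => ?_, fun x hx => ?_⟩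
    · refine (hc x₀ hx₀ i x₀ hx₀).congr_of_eventuallyEq ?_
      filter_upwards [hsc x₀ hx₀, hU.mem_nhds hx₀] with x h1 h2
      have h3 := (hsc x h2).self_of_nhds
      rw [h1] at h3
      simp only [h2, dite_true]
      exact (congrFun ((hli x h2).coeff_unique h3) i).symm
    · simp only [hx, dite_true]
      exact (hsc x hx).self_of_nhds

/-- A smooth section generates the family, as a line bundle, over `U`. -/
def IsGen (T : SmoothFamily.{u, v} n M) (U : Set M) (g : T.sec) : Prop :=
  T.IsFrameOn U fun _ : Unit => g

namespace IsGen

variable {T : SmoothFamily.{u, v} n M} {U : Set M} {g : T.sec}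

theorem ne_zero (h : T.IsGen U g) {x : M} (hx : x ∈ U) : g.1 x ≠ 0 :=
  linearIndependent_unique_iff.1 (h.linearIndependent x hx)

theorem exists_coeff (h : T.IsGen U g) (s : T.sec) : ∃ c : M → ℝ, (∀ x ∈ U, SmoothAt n c x) ∧
    ∀ x ∈ U, s.1 x = c x • g.1 x := by
  obtain ⟨c, hc, hs⟩ := IsFrameOn.exists_coeff h s
  exact ⟨c (), hc (), fun x hx => by simpa using hs x hx⟩

theorem mono {U' : Set M} (h : T.IsGen U g) (hU : U' ⊆ U) : T.IsGen U' g :=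
  IsFrameOn.mono h hU

end IsGen

theorem isGen_of_generators {T : SmoothFamily.{u, v} n M} {U : Set M} {t : T.sec} (hU : IsOpen U)
    (G : Set (∀ x, T.Fiber x)) (hT : ∀ s ∈ T.sec, s ∈ locallyGenerated (n := n) T.Fiber G)
    (h0 : ∀ x ∈ U, t.1 x ≠ 0)
    (hG : ∀ g ∈ G, ∃ c : M → ℝ, (∀ x ∈ U, SmoothAt n c x) ∧ ∀ x ∈ U, g x = c x • t.1 x) :
    T.IsGen U t := by
  refine isFrameOn_of_generators hU G hT
    (fun x hx => linearIndependent_unique_iff.2 (h0 x hx)) fun g hg => ?_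
  obtain ⟨c, hc, hgc⟩ := hG g hg
  exact ⟨fun _ => c, fun _ => hc, fun x hx => by simpa using hgc x hx⟩

/-- The wedge product of a frame generates the top exterior power. -/
theorem IsFrameOn.isGen_wedge {E : SmoothFamily.{u, v} n M} {U : Set M} (hU : IsOpen U)
    {e : Fin E.rank → E.sec} (he : E.IsFrameOn U e) : E.top.IsGen U (wedge e) := by
  refine isGen_of_generators hU _ (fun s hs => hs) (fun x hx => ?_) ?_
  · exact exteriorPower.ιMulti_ne_zero (E.finrank_fiber x) (he.linearIndependent x hx)
  · rintro _ ⟨s, rfl⟩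
    obtain ⟨c, hc, hs⟩ := he.exists_coeff_family s
    refine ⟨fun x => (Matrix.of fun i j => c i j x).det, fun x hx => smoothAt_det fun i j =>
      hc i j x hx, fun x hx => ?_⟩
    simp only [hs _ x hx]
    exact AlternatingMap.map_sum_smul_eq_det _ (Matrix.of fun i j => c i j x) _

theorem IsGen.tmul {T : SmoothFamily.{u, v} n M} {T' : SmoothFamily.{u, w} n M} {U : Set M}
    (hU : IsOpen U) {g : T.sec} {g' : T'.sec} (hg : T.IsGen U g) (hg' : T'.IsGen U g') :
    (T.tensor T').IsGen U (SmoothFamily.tmul g g') := by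
  refine isGen_of_generators hU _ (fun s hs => hs) (fun x hx => ?_) ?_
  · exact tmul_ne_zero_of_ne_zero (hg.ne_zero hx) (hg'.ne_zero hx)
  · rintro _ ⟨s, s', rfl⟩
    obtain ⟨c, hc, hs⟩ := hg.exists_coeff s
    obtain ⟨c', hc', hs'⟩ := hg'.exists_coeff s'
    refine ⟨fun x => c x * c' x, fun x hx => (hc x hx).mul (hc' x hx), fun x hx => ?_⟩
    change s.1 x ⊗ₜ[ℝ] s'.1 x = _
    rw [hs x hx, hs' x hx]
    exact TensorProduct.smul_tmul_smul _ _ _ _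

/-- A family which has a smooth frame near each point. -/
def LocallyFree (E : SmoothFamily.{u, v} n M) : Prop :=
  ∀ x : M, ∃ U, IsOpen U ∧ x ∈ U ∧ ∃ e : Fin E.rank → E.sec, E.IsFrameOn U e

/-- A family which is generated by one nowhere-vanishing smooth section near each point. -/
def LocallyLine (T : SmoothFamily.{u, v} n M) : Prop :=
  ∀ x : M, ∃ U, IsOpen U ∧ x ∈ U ∧ ∃ g : T.sec, T.IsGen U g

theorem LocallyFree.top {E : SmoothFamily.{u, v} n M} (h : E.LocallyFree) : E.top.LocallyLine :=
  fun x => by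
    obtain ⟨U, hU, hx, e, he⟩ := h x
    exact ⟨U, hU, hx, _, he.isGen_wedge hU⟩

theorem LocallyLine.tensor {T : SmoothFamily.{u, v} n M} {T' : SmoothFamily.{u, w} n M}
    (h : T.LocallyLine) (h' : T'.LocallyLine) : (T.tensor T').LocallyLine := fun x => by
  obtain ⟨U, hU, hx, g, hg⟩ := h x
  obtain ⟨U', hU', hx', g', hg'⟩ := h' x
  exact ⟨U ∩ U', hU.inter hU', ⟨hx, hx'⟩, _,
    (hg.mono Set.inter_subset_left).tmul (hU.inter hU') (hg'.mono Set.inter_subset_right)⟩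

/-- A family in which smoothness of sections is a local property. -/
def IsLocal (E : SmoothFamily.{u, v} n M) : Prop :=
  ∀ s : ∀ x, E.Fiber x, (∀ x₀, ∃ t : E.sec, ∀ᶠ x in 𝓝 x₀, s x = t.1 x) → s ∈ E.sec

theorem isLocal_of_locallyGenerated {E : SmoothFamily.{u, v} n M} (G : Set (∀ x, E.Fiber x))
    (h : ∀ s, s ∈ E.sec ↔ s ∈ locallyGenerated (n := n) E.Fiber G) : E.IsLocal := by
  intro s hs
  rw [h]
  intro x₀
  obtain ⟨t, ht⟩ := hs x₀
  obtain ⟨r, hr, htr⟩ := (h t.1).1 t.2 x₀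
  refine ⟨r, hr, ?_⟩
  filter_upwards [ht, htr] with x h1 h2
  rw [h1, h2]

theorem isLocal_top (E : SmoothFamily.{u, v} n M) : E.top.IsLocal :=
  isLocal_of_locallyGenerated _ fun _ => Iff.rfl

theorem isLocal_tensor (E : SmoothFamily.{u, v} n M) (E' : SmoothFamily.{u, w} n M) :
    (E.tensor E').IsLocal :=
  isLocal_of_locallyGenerated _ fun _ => Iff.rfl

end SmoothFamily

/-! ### Derivations and their extensions to top powers and tensor products -/

namespace SmoothFamily

section Derivations

variable {n : ℕ} {M : Type u} [TopologicalSpace M] [ChartedSpace (EuclideanSpace ℝ (Fin n)) M]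
  [IsManifold (𝓡 n) ∞ M]

/-- An operator on sections is a derivation over the vector field `v` if it satisfies the Leibniz
rule `D (f s) = f D s + (v · f) s`. -/
def IsDer {E : SmoothFamily.{u, v} n M} (v : (tangent n M).sec) (D : E.sec →ₗ[ℝ] E.sec) : Prop :=
  ∀ (f : C^∞⟮𝓡 n, M; ℝ⟯) (s : E.sec) (x : M),
    (D (f • s)).1 x = f x • (D s).1 x + dirDeriv f x (v.1 x) • s.1 x

variable {E : SmoothFamily.{u, v} n M} {v : (tangent n M).sec} {D : E.sec →ₗ[ℝ] E.sec}

namespace IsDer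

variable [T2Space M]

/-- Derivations are local operators. -/
theorem eq_zero_of_eventually (hD : IsDer v D) {s : E.sec} {x : M} (h : ∀ᶠ y in 𝓝 x, s.1 y = 0) :
    (D s).1 x = 0 := by
  obtain ⟨f, hf1, hf⟩ := exists_bump (n := n) x h
  have h1 : f • s = 0 := by
    ext y
    rw [smul_apply]
    by_cases hy : y ∈ tsupport f
    · have h2 : s.1 y = 0 := hf hy
      rw [h2, smul_zero]
      rfl
    · rw [image_eq_zero_of_notMem_tsupport hy, zero_smul]
      rfl
  have h2 := hD f s x
  rw [h1, map_zero, hf1.self_of_nhds, one_smul, h.self_of_nhds, smul_zero, add_zero] at h2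
  exact h2.symm

theorem congr (hD : IsDer v D) {s t : E.sec} {x : M} (h : ∀ᶠ y in 𝓝 x, s.1 y = t.1 y) :
    (D s).1 x = (D t).1 x := by
  have h1 : (D (s - t)).1 x = 0 := hD.eq_zero_of_eventually (by
    filter_upwards [h] with y hy
    exact sub_eq_zero.2 hy)
  rw [map_sub] at h1
  exact sub_eq_zero.1 h1

theorem apply_sum (hD : IsDer v D) {ι : Type*} [Fintype ι] {U : Set M} {x : M} (hU : U ∈ 𝓝 x)
    {c : ι → M → ℝ} (hc : ∀ i, ∀ y ∈ U, SmoothAt n (c i) y) {e : ι → E.sec} {s : E.sec}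
    (hs : ∀ y ∈ U, s.1 y = ∑ i, c i y • (e i).1 y) :
    (D s).1 x = ∑ i, (c i x • (D (e i)).1 x + dirDeriv (c i) x (v.1 x) • (e i).1 x) := by
  choose g hg using fun i => exists_smooth_eventuallyEq hU (hc i)
  have h1 : (D s).1 x = (D (∑ i, g i • e i)).1 x := hD.congr (by
    filter_upwards [hU, Filter.eventually_all.2 hg] with y hy hgy
    rw [hs y hy, sum_apply]
    simp only [smul_apply, hgy])
  rw [h1, map_sum, sum_apply]
  refine Finset.sum_congr rfl fun i _ => ?_
  rw [hD, (hg i).self_of_nhds, dirDeriv_congr (hg i)]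

theorem apply_smul (hD : IsDer v D) {U : Set M} {x : M} (hU : U ∈ 𝓝 x)
    {c : M → ℝ} (hc : ∀ y ∈ U, SmoothAt n c y) {g s : E.sec}
    (hs : ∀ y ∈ U, s.1 y = c y • g.1 y) :
    (D s).1 x = c x • (D g).1 x + dirDeriv c x (v.1 x) • g.1 x := by
  have h := hD.apply_sum (ι := Unit) hU (c := fun _ => c) (fun _ => hc) (e := fun _ => g)
    (s := s) (fun y hy => by simpa using hs y hy)
  simpa using h

/-- Two derivations over the same vector field which agree on local generators are equal. -/
theorem ext_of_isGen {D' : E.sec →ₗ[ℝ] E.sec} (hD : IsDer v D) (hD' : IsDer v D')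
    (h : ∀ x, ∃ U, IsOpen U ∧ x ∈ U ∧ ∃ g : E.sec, E.IsGen U g ∧ (D g).1 x = (D' g).1 x) :
    D = D' := by
  ext s x
  obtain ⟨U, hU, hx, g, hg, hgx⟩ := h x
  obtain ⟨c, hc, hs⟩ := hg.exists_coeff s
  rw [hD.apply_smul (hU.mem_nhds hx) hc hs, hD'.apply_smul (hU.mem_nhds hx) hc hs, hgx]

end IsDer

theorem IsDer.add {v' : (tangent n M).sec} {D' : E.sec →ₗ[ℝ] E.sec} (hD : IsDer v D)
    (hD' : IsDer v' D') : IsDer (v + v') (D + D') := fun f s x => by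
  change (D (f • s)).1 x + (D' (f • s)).1 x =
    f x • ((D s).1 x + (D' s).1 x) + dirDeriv f x (v.1 x + v'.1 x) • s.1 x
  rw [hD, hD', dirDeriv_vadd]
  module

theorem IsDer.const_smul (hD : IsDer v D) (c : ℝ) : IsDer (c • v) (c • D) := fun f s x => by
  change c • (D (f • s)).1 x = f x • (c • (D s).1 x) + dirDeriv f x (c • v.1 x) • s.1 x
  rw [hD, dirDeriv_vsmul]
  module

/-- The product of an operator on sections with a smooth function. -/
def smulOp (f : C^∞⟮𝓡 n, M; ℝ⟯) (D : E.sec →ₗ[ℝ] E.sec) : E.sec →ₗ[ℝ] E.sec where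
  toFun s := f • D s
  map_add' s t := by
    ext x
    change f x • (D (s + t)).1 x = f x • (D s).1 x + f x • (D t).1 x
    rw [map_add, ← smul_add]
    rfl
  map_smul' c s := by
    ext x
    change f x • (D (c • s)).1 x = c • f x • (D s).1 x
    rw [map_smul, smul_comm]
    rfl

theorem IsDer.smulOp {v' : (tangent n M).sec} (hD : IsDer v D) (f : C^∞⟮𝓡 n, M; ℝ⟯)
    (hv : ∀ x, v'.1 x = f x • v.1 x) : IsDer v' (SmoothFamily.smulOp f D) := fun g s x => by
  change f x • (D (g • s)).1 x = g x • (f x • (D s).1 x) + dirDeriv g x (v'.1 x) • s.1 x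
  rw [hD, hv, dirDeriv_vsmul]
  module

theorem IsDer.comp_apply {v' : (tangent n M).sec} {D' : E.sec →ₗ[ℝ] E.sec} (hD : IsDer v D)
    (hD' : IsDer v' D') (f : C^∞⟮𝓡 n, M; ℝ⟯) (s : E.sec) (x : M) :
    (D (D' (f • s))).1 x = f x • (D (D' s)).1 x + dirDeriv f x (v.1 x) • (D' s).1 x +
      (dirDeriv f x (v'.1 x) • (D s).1 x + dirDeriv (derivAlong v' f) x (v.1 x) • s.1 x) := by
  have h2 : D' (f • s) = f • D' s + derivAlong v' f • s := by
    ext y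
    exact hD' f s y
  rw [h2, map_add]
  change (D (f • D' s)).1 x + (D (derivAlong v' f • s)).1 x = _
  rw [hD, hD]
  rfl

/-- The commutator of derivations is a derivation over the commutator of the vector fields. -/
theorem IsDer.commutator {v' v'' : (tangent n M).sec} {D' : E.sec →ₗ[ℝ] E.sec} (hD : IsDer v D)
    (hD' : IsDer v' D')
    (hv : ∀ (f : C^∞⟮𝓡 n, M; ℝ⟯) (x : M), dirDeriv f x (v''.1 x) =
      dirDeriv (derivAlong v' f) x (v.1 x) - dirDeriv (derivAlong v f) x (v'.1 x)) :
    IsDer v'' (D ∘ₗ D' - D' ∘ₗ D) := fun f s x => by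
  change (D (D' (f • s))).1 x - (D' (D (f • s))).1 x =
    f x • ((D (D' s)).1 x - (D' (D s)).1 x) + dirDeriv f x (v''.1 x) • s.1 x
  rw [hD.comp_apply hD', hD'.comp_apply hD, hv]
  module

/-- If the commutator of two derivations is a derivation, then it is one over the commutator of the
vector fields, at the points where some section does not vanish. -/
theorem IsDer.dirDeriv_eq_commutator {v' v'' : (tangent n M).sec} {D' D'' : E.sec →ₗ[ℝ] E.sec}
    (hD : IsDer v D) (hD' : IsDer v' D') (hD'' : IsDer v'' D'')
    (h : ∀ s, D'' s = D (D' s) - D' (D s)) (f : C^∞⟮𝓡 n, M; ℝ⟯) {s : E.sec} {x : M}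
    (hs : s.1 x ≠ 0) : dirDeriv f x (v''.1 x) =
      dirDeriv (derivAlong v' f) x (v.1 x) - dirDeriv (derivAlong v f) x (v'.1 x) := by
  have h1 := hD'' f s x
  rw [h, h] at h1
  change (D (D' (f • s))).1 x - (D' (D (f • s))).1 x =
    f x • ((D (D' s)).1 x - (D' (D s)).1 x) + dirDeriv f x (v''.1 x) • s.1 x at h1
  rw [hD.comp_apply hD', hD'.comp_apply hD] at h1
  refine smul_left_injective ℝ hs ?_
  beta_reduce
  rw [← sub_eq_zero] at h1 ⊢
  rw [← neg_eq_zero, ← h1]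
  module

variable [T2Space M]

/-- A derivation of a line bundle is determined by consistent values on a family of sections which
contains a generator near each point. -/
theorem exists_isDer_of_values {T : SmoothFamily.{u, v} n M} (hT : T.IsLocal)
    (v : (tangent n M).sec) {ι : Type*} (G d : ι → T.sec)
    (h : ∀ x₀, ∃ U, IsOpen U ∧ x₀ ∈ U ∧ ∃ j, T.IsGen U (G j) ∧
      ∀ (i : ι) (c : M → ℝ), (∀ x ∈ U, SmoothAt n c x) →
        (∀ x ∈ U, (G i).1 x = c x • (G j).1 x) →
        ∀ x ∈ U, (d i).1 x = c x • (d j).1 x + dirDeriv c x (v.1 x) • (G j).1 x) :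
    ∃ D : T.sec →ₗ[ℝ] T.sec, IsDer v D ∧ ∀ i, D (G i) = d i := by
  choose U hU hxU j hgen hd using h
  choose c hc hsc using fun (s : T.sec) (x : M) => (hgen x).exists_coeff s
  -- coefficients with respect to a generator are unique
  have huniq : ∀ (s : T.sec) (x : M) (f : M → ℝ), (∀ᶠ y in 𝓝 x, s.1 y = f y • (G (j x)).1 y) →
      c s x =ᶠ[𝓝 x] f := fun s x f hf => by
    filter_upwards [hf, (hU x).mem_nhds (hxU x)] with y h1 h2
    rw [hsc s x y h2] at h1
    exact smul_left_injective ℝ ((hgen x).ne_zero h2) h1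
  let val : T.sec → ∀ x, T.Fiber x := fun s x =>
    c s x x • (d (j x)).1 x + dirDeriv (c s x) x (v.1 x) • (G (j x)).1 x
  have hval : ∀ (s : T.sec) (x₀ : M), ∀ x ∈ U x₀, val s x =
      c s x₀ x • (d (j x₀)).1 x + dirDeriv (c s x₀) x (v.1 x) • (G (j x₀)).1 x := by
    intro s x₀ x hx
    have h1 := hd x (j x₀) _ (hc (G (j x₀)) x) (hsc _ x) x (hxU x)
    have h2 : c s x =ᶠ[𝓝 x] fun y => c s x₀ y * c (G (j x₀)) x y := by
      refine huniq s x _ ?_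
      filter_upwards [(hU x).mem_nhds (hxU x), (hU x₀).mem_nhds hx] with y h3 h4
      rw [hsc s x₀ y h4, hsc (G (j x₀)) x y h3, smul_smul]
    simp only [val]
    rw [h1, hsc (G (j x₀)) x x (hxU x), dirDeriv_congr h2, h2.self_of_nhds,
      dirDeriv_mul (hc s x₀ x hx) (hc _ x x (hxU x))]
    module
  have hmem : ∀ s, val s ∈ T.sec := fun s => by
    refine hT _ fun x₀ => ?_
    obtain ⟨f, hf⟩ := exists_smooth_eventuallyEq ((hU x₀).mem_nhds (hxU x₀)) (hc s x₀)
    refine ⟨f • d (j x₀) + derivAlong v f • G (j x₀), ?_⟩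
    filter_upwards [hf.eventually_nhds, (hU x₀).mem_nhds (hxU x₀)] with x h1 h2
    rw [hval s x₀ x h2]
    change _ = f x • (d (j x₀)).1 x + dirDeriv f x (v.1 x) • (G (j x₀)).1 x
    rw [h1.self_of_nhds, dirDeriv_congr h1]
  let D : T.sec →ₗ[ℝ] T.sec :=
    { toFun := fun s => ⟨val s, hmem s⟩
      map_add' := fun s t => by
        ext x
        change val (s + t) x = val s x + val t x
        have h1 : c (s + t) x =ᶠ[𝓝 x] fun y => c s x y + c t x y := by
          refine huniq _ x _ ?_
          filter_upwards [(hU x).mem_nhds (hxU x)] with y h3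
          rw [add_smul, ← hsc s x y h3, ← hsc t x y h3]
          rfl
        simp only [val]
        rw [dirDeriv_congr h1, h1.self_of_nhds,
          dirDeriv_add_at (hc s x x (hxU x)) (hc t x x (hxU x))]
        module
      map_smul' := fun r s => by
        ext x
        change val (r • s) x = r • val s x
        have h1 : c (r • s) x =ᶠ[𝓝 x] fun y => r * c s x y := by
          refine huniq _ x _ ?_
          filter_upwards [(hU x).mem_nhds (hxU x)] with y h3
          rw [mul_smul, ← hsc s x y h3]
          rfl
        simp only [val]
        rw [dirDeriv_congr h1, h1.self_of_nhds,
          dirDeriv_mul contMDiffAt_const (hc s x x (hxU x)), dirDeriv_const]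
        module }
  refine ⟨D, fun f s x => ?_, fun i => ?_⟩
  · change val (f • s) x = f x • val s x + _
    have h1 : c (f • s) x =ᶠ[𝓝 x] fun y => f y * c s x y := by
      refine huniq _ x _ ?_
      filter_upwards [(hU x).mem_nhds (hxU x)] with y h3
      rw [mul_smul, ← hsc s x y h3]
      rfl
    simp only [val]
    rw [dirDeriv_congr h1, h1.self_of_nhds, dirDeriv_mul (smoothAt_coe f x) (hc s x x (hxU x)),
      hsc s x x (hxU x)]
    module
  · ext x
    exact (hd x i _ (hc (G i) x) (hsc _ x) x (hxU x)).symm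

end Derivations

section Top

variable {n : ℕ} {M : Type u} [TopologicalSpace M] [ChartedSpace (EuclideanSpace ℝ (Fin n)) M]

theorem wedgeDeriv_apply {E : SmoothFamily.{u, v} n M} (D : E.sec → E.sec)
    (s : Fin E.rank → E.sec) (x : M) :
    (wedgeDeriv D s).1 x = ∑ i, exteriorPower.ιMulti ℝ E.rank
      (Function.update (fun j => (s j).1 x) i ((D (s i)).1 x)) := by
  rw [wedgeDeriv, sum_apply]
  refine Finset.sum_congr rfl fun i _ => ?_
  change exteriorPower.ιMulti ℝ E.rank (fun j => (Function.update s i (D (s i)) j).1 x) = _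
  congr 1
  funext j
  by_cases hj : j = i
  · subst hj
    simp
  · simp [hj]

/-- On a frame, the wedge derivative is multiplication by the trace of the coefficients. -/
theorem wedgeDeriv_eq_trace {E : SmoothFamily.{u, v} n M} (D : E.sec → E.sec)
    (s : Fin E.rank → E.sec) (x : M) (γ : Fin E.rank → Fin E.rank → ℝ)
    (hγ : ∀ i, (D (s i)).1 x = ∑ j, γ i j • (s j).1 x) :
    (wedgeDeriv D s).1 x = (∑ i, γ i i) • (wedge s).1 x := by
  rw [wedgeDeriv_apply]
  exact AlternatingMap.sum_update_eq_trace _ γ _ _ hγ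

variable [IsManifold (𝓡 n) ∞ M] [T2Space M]

/-- The extension of a derivation to the top exterior power. -/
theorem exists_isDer_top {E : SmoothFamily.{u, v} n M} (hE : E.LocallyFree)
    {v : (tangent n M).sec} {D : E.sec →ₗ[ℝ] E.sec} (hD : IsDer v D) :
    ∃ D' : E.top.sec →ₗ[ℝ] E.top.sec, IsDer v D' ∧ ∀ s, D' (wedge s) = wedgeDeriv D s := by
  refine exists_isDer_of_values (isLocal_top E) v wedge (wedgeDeriv D) fun x₀ => ?_
  obtain ⟨U, hU, hx₀, e, he⟩ := hE x₀
  refine ⟨U, hU, hx₀, e, he.isGen_wedge hU, fun s c hc hsc x hx => ?_⟩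
  obtain ⟨a, ha, hsa⟩ := he.exists_coeff_family s
  obtain ⟨γ, -, hγ⟩ := he.exists_coeff_family fun i => D (e i)
  let m : Matrix (Fin E.rank) (Fin E.rank) ℝ := Matrix.of fun i j => a i j x
  let g : Matrix (Fin E.rank) (Fin E.rank) ℝ := Matrix.of fun i j => γ i j x
  let m' : Matrix (Fin E.rank) (Fin E.rank) ℝ := Matrix.of fun i j => dirDeriv (a i j) x (v.1 x)
  have hdet : ∀ y ∈ U, (wedge s).1 y = (Matrix.of fun i j => a i j y).det • (wedge e).1 y :=
    fun y hy => by
      have h := AlternatingMap.map_sum_smul_eq_det (exteriorPower.ιMulti ℝ E.rank)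
        (Matrix.of fun i j => a i j y) (fun j => (e j).1 y)
      simp only [Matrix.of_apply, ← hsa _ y hy] at h
      exact h
  have hcdet : c =ᶠ[𝓝 x] fun y => (Matrix.of fun i j => a i j y).det := by
    filter_upwards [hU.mem_nhds hx] with y hy
    have h := hsc y hy
    rw [hdet y hy] at h
    exact (smul_left_injective ℝ ((he.isGen_wedge hU).ne_zero hy) h).symm
  rw [dirDeriv_congr hcdet, hcdet.self_of_nhds, dirDeriv_det fun i j => ha i j x hx,
    wedgeDeriv_eq_trace D e x (fun i j => γ i j x) fun i => hγ i x hx, wedgeDeriv_apply]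
  have hDs : ∀ i, (D (s i)).1 x = ∑ k, (m * g + m') i k • (e k).1 x := fun i => by
    rw [hD.apply_sum (hU.mem_nhds hx) (fun j => ha i j) (fun y hy => hsa i y hy)]
    simp only [Matrix.add_apply, Matrix.mul_apply, add_smul, Finset.sum_add_distrib]
    congr 1
    simp only [hγ _ x hx, Finset.smul_sum, smul_smul, Finset.sum_smul]
    rw [Finset.sum_comm]
    rfl
  have hrow : ∀ i, exteriorPower.ιMulti ℝ E.rank
      (Function.update (fun j => (s j).1 x) i ((D (s i)).1 x)) =
      (m.updateRow i ((m * g + m') i)).det • (wedge e).1 x := fun i => by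
    have h := AlternatingMap.map_sum_smul_eq_det (exteriorPower.ιMulti ℝ E.rank)
      (m.updateRow i ((m * g + m') i)) (fun j => (e j).1 x)
    rw [← show (exteriorPower.ιMulti ℝ E.rank fun j => (e j).1 x) = (wedge e).1 x from rfl, ← h]
    congr 1
    funext k
    by_cases hk : k = i
    · subst hk
      simp only [Function.update_self, Matrix.updateRow_self]
      exact hDs k
    · simp only [Function.update_of_ne hk, Matrix.updateRow_ne hk]
      exact hsa k x hx
  simp only [hrow]
  rw [← Finset.sum_smul, Matrix.sum_det_updateRow, Matrix.add_mul, Matrix.trace_add,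
    Matrix.mul_assoc, Matrix.trace_mul_comm, Matrix.mul_assoc, Matrix.adjugate_mul, Matrix.mul_smul, Matrix.mul_one,
    Matrix.trace_smul, add_smul, smul_eq_mul, mul_smul]
  rfl

/-- The tensor product of two derivations of line bundles over the same vector field. -/
theorem exists_isDer_tensor {T : SmoothFamily.{u, v} n M} {T' : SmoothFamily.{u, w} n M}
    (hT : T.LocallyLine) (hT' : T'.LocallyLine) {v : (tangent n M).sec} {D : T.sec →ₗ[ℝ] T.sec}
    {D' : T'.sec →ₗ[ℝ] T'.sec} (hD : IsDer v D) (hD' : IsDer v D') :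
    ∃ D'' : (T.tensor T').sec →ₗ[ℝ] (T.tensor T').sec, IsDer v D'' ∧
      ∀ s t, D'' (tmul s t) = tmul (D s) t + tmul s (D' t) := by
  obtain ⟨D'', h1, h2⟩ := exists_isDer_of_values (isLocal_tensor T T') v
    (fun p : T.sec × T'.sec => tmul p.1 p.2) (fun p => tmul (D p.1) p.2 + tmul p.1 (D' p.2))
    fun x₀ => by
      obtain ⟨U₁, hU₁, hx₁, g, hg⟩ := hT x₀
      obtain ⟨U₂, hU₂, hx₂, g', hg'⟩ := hT' x₀
      have hU := hU₁.inter hU₂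
      replace hg := hg.mono (Set.inter_subset_left (t := U₂))
      replace hg' := hg'.mono (Set.inter_subset_right (s := U₁))
      have hgen := hg.tmul hU hg'
      refine ⟨U₁ ∩ U₂, hU, ⟨hx₁, hx₂⟩, (g, g'), hgen, fun ⟨s, s'⟩ c hc hsc x hx => ?_⟩
      obtain ⟨a, ha, hs⟩ := hg.exists_coeff s
      obtain ⟨a', ha', hs'⟩ := hg'.exists_coeff s'
      have hc' : c =ᶠ[𝓝 x] fun y => a y * a' y := by
        filter_upwards [hU.mem_nhds hx] with y hy
        have h := hsc y hy
        have h3 : (tmul s s').1 y = (a y * a' y) • (tmul g g').1 y := by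
          change s.1 y ⊗ₜ[ℝ] s'.1 y = _
          rw [hs y hy, hs' y hy]
          exact TensorProduct.smul_tmul_smul _ _ _ _
        exact (smul_left_injective ℝ (hgen.ne_zero hy) (h3.symm.trans h)).symm
      rw [dirDeriv_congr hc', hc'.self_of_nhds, dirDeriv_mul (ha x hx) (ha' x hx)]
      change (D s).1 x ⊗ₜ[ℝ] s'.1 x + s.1 x ⊗ₜ[ℝ] (D' s').1 x =
        (a x * a' x) • ((D g).1 x ⊗ₜ[ℝ] g'.1 x + g.1 x ⊗ₜ[ℝ] (D' g').1 x) +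
          _ • (g.1 x ⊗ₜ[ℝ] g'.1 x)
      rw [hD.apply_smul (hU.mem_nhds hx) ha hs, hD'.apply_smul (hU.mem_nhds hx) ha' hs',
        hs x hx, hs' x hx]
      simp only [TensorProduct.add_tmul, TensorProduct.tmul_add, TensorProduct.tmul_smul,
        ← TensorProduct.smul_tmul']
      module
  exact ⟨D'', h1, fun s t => h2 (s, t)⟩

end Top

end SmoothFamily

/-! ### Duals, sections of vector bundles and of quotients -/

namespace SmoothFamily

section Pairing

variable {n : ℕ} {M : Type u} [TopologicalSpace M] [ChartedSpace (EuclideanSpace ℝ (Fin n)) M]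
  {E : SmoothFamily.{u, v} n M}

theorem pair_vadd (ξ : E.dual.sec) (x : M) (a b : E.Fiber x) :
    pair ξ x (a + b) = pair ξ x a + pair ξ x b :=
  map_add (show Dual ℝ (E.Fiber x) from ξ.1 x) a b

theorem pair_vsub (ξ : E.dual.sec) (x : M) (a b : E.Fiber x) :
    pair ξ x (a - b) = pair ξ x a - pair ξ x b :=
  map_sub (show Dual ℝ (E.Fiber x) from ξ.1 x) a b

theorem pair_vsmul (ξ : E.dual.sec) (x : M) (c : ℝ) (a : E.Fiber x) :
    pair ξ x (c • a) = c * pair ξ x a :=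
  map_smul (show Dual ℝ (E.Fiber x) from ξ.1 x) c a

theorem pair_vsum (ξ : E.dual.sec) (x : M) {ι : Type*} (t : Finset ι) (a : ι → E.Fiber x) :
    pair ξ x (∑ i ∈ t, a i) = ∑ i ∈ t, pair ξ x (a i) :=
  map_sum (show Dual ℝ (E.Fiber x) from ξ.1 x) a t

end Pairing

section LocallyFree

variable {n : ℕ} {M : Type u} [TopologicalSpace M] [ChartedSpace (EuclideanSpace ℝ (Fin n)) M]

theorem IsFrameOn.exists_basis {E : SmoothFamily.{u, v} n M} {U : Set M} {ι : Type*} [Fintype ι]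
    {e : ι → E.sec} (he : E.IsFrameOn U e) (hι : Fintype.card ι = E.rank) {x : M} (hx : x ∈ U) :
    ∃ B : Basis ι ℝ (E.Fiber x), ∀ i, B i = (e i).1 x :=
  ⟨Basis.mk (he.linearIndependent x hx) ((he.linearIndependent x hx).span_eq_top_of_card_eq_finrank'
    (by rw [hι, E.finrank_fiber])).ge, fun i => by simp⟩

/-- Every vector is the value of a smooth section. -/
theorem LocallyFree.exists_sec_eq {E : SmoothFamily.{u, v} n M} (hE : E.LocallyFree) (x : M)
    (w : E.Fiber x) : ∃ s : E.sec, s.1 x = w := by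
  obtain ⟨U, -, hx, e, he⟩ := hE x
  obtain ⟨B, hB⟩ := he.exists_basis (by simp) hx
  refine ⟨∑ i, B.repr w i • e i, ?_⟩
  rw [sum_apply]
  conv_rhs => rw [← B.sum_repr w]
  exact Finset.sum_congr rfl fun i _ => by rw [hB]; rfl

variable [IsManifold (𝓡 n) ∞ M] [T2Space M]

/-- The dual of a locally free family is locally free. -/
theorem LocallyFree.dual {E : SmoothFamily.{u, v} n M} (hE : E.LocallyFree) :
    E.dual.LocallyFree := by
  classical
  intro x₀
  obtain ⟨U, hU, hx₀, e, he⟩ := hE x₀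
  choose B hB using fun (x : M) (hx : x ∈ U) => he.exists_basis (by simp) hx
  obtain ⟨f, hf1, hf⟩ := exists_bump (n := n) x₀ (hU.mem_nhds hx₀)
  let p : Fin E.rank → ∀ x, Dual ℝ (E.Fiber x) := fun i x =>
    if hx : x ∈ U then f x • (B x hx).coord i else 0
  have hp : ∀ i x (hx : x ∈ U) (w : E.Fiber x), p i x w = f x * (B x hx).repr w i :=
    fun i x hx w => by simp [p, hx]
  have hpe : ∀ i x (hx : x ∈ U) j, p i x ((e j).1 x) = f x * if j = i then 1 else 0 :=
    fun i x hx j => by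
      rw [hp i x hx, ← hB x hx j]
      simp [Finsupp.single_apply]
  have hmem : ∀ i, ∀ s ∈ E.sec, ContMDiff (𝓡 n) 𝓘(ℝ, ℝ) ∞ (fun x => p i x (s x)) := by
    intro i s hs
    obtain ⟨c, hc, hsc⟩ := he.exists_coeff ⟨s, hs⟩
    have h1 : (fun x => p i x (s x)) = fun x => f x * c i x := by
      funext x
      by_cases hx : x ∈ U
      · have h2 : s x = ∑ j, c j x • (e j).1 x := hsc x hx
        rw [h2, map_sum]
        simp [hpe i x hx, mul_comm]
      · have h3 : f x = 0 := image_eq_zero_of_notMem_tsupport fun h => hx (hf h)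
        simp [p, hx, h3]
    rw [h1]
    exact contMDiff_bump_mul f hf (hc i)
  obtain ⟨U', hU'1, hU', hx₀'⟩ := mem_nhds_iff.1 (Filter.inter_mem hf1 (hU.mem_nhds hx₀))
  refine ⟨U', hU', hx₀', fun i => ⟨p i, hmem i⟩, fun x hx => ?_, fun s => ?_⟩
  · have hxU := (hU'1 hx).2
    have hfx : f x = 1 := (hU'1 hx).1
    have h1 : ∀ i, p i x = (B x hxU).coord i := fun i => by
      simp [p, hxU, hfx]
    change LinearIndependent ℝ fun i => p i x
    simp only [h1]
    rw [← (B x hxU).coe_dualBasis]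
    exact (B x hxU).dualBasis.linearIndependent
  · refine ⟨fun i x => pair s x ((e i).1 x), fun i x _ => contMDiff_pair s (e i) x, fun x hx => ?_⟩
    have hxU := (hU'1 hx).2
    have hfx : f x = 1 := (hU'1 hx).1
    refine (B x hxU).ext fun j => ?_
    rw [hB x hxU]
    change pair s x ((e j).1 x) = (∑ i, pair s x ((e i).1 x) • p i x) ((e j).1 x)
    rw [LinearMap.sum_apply]
    simp [hpe _ x hxU, hfx]

/-- The dual of a derivation: `⟨D^* ξ, s⟩ = v · ⟨ξ, s⟩ - ⟨ξ, D s⟩`. -/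
theorem exists_isDer_dual {E : SmoothFamily.{u, v} n M} (hE : E.LocallyFree)
    {v : (tangent n M).sec} {D : E.sec →ₗ[ℝ] E.sec} (hD : IsDer v D) :
    ∃ D' : E.dual.sec →ₗ[ℝ] E.dual.sec, IsDer v D' ∧ ∀ (ξ : E.dual.sec) (s : E.sec) (x : M),
      pair (D' ξ) x (s.1 x) = dirDeriv (fun y => pair ξ y (s.1 y)) x (v.1 x) -
        pair ξ x ((D s).1 x) := by
  have hex : ∀ (ξ : E.dual.sec) (x : M), ∃ p : Dual ℝ (E.Fiber x), ∀ s : E.sec,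
      p (s.1 x) = dirDeriv (fun y => pair ξ y (s.1 y)) x (v.1 x) - pair ξ x ((D s).1 x) := by
    intro ξ x
    obtain ⟨U, hU, hx, e, he⟩ := hE x
    obtain ⟨B, hB⟩ := he.exists_basis (by simp) hx
    refine ⟨B.constr ℝ fun i => dirDeriv (fun y => pair ξ y ((e i).1 y)) x (v.1 x) -
      pair ξ x ((D (e i)).1 x), fun s => ?_⟩
    obtain ⟨c, hc, hs⟩ := he.exists_coeff s
    have h1 : (fun y => pair ξ y (s.1 y)) =ᶠ[𝓝 x] fun y => ∑ i, c i y * pair ξ y ((e i).1 y) := by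
      filter_upwards [hU.mem_nhds hx] with y hy
      rw [hs y hy]
      simp only [pair_vsum, pair_vsmul]
    have hsm : ∀ i, SmoothAt n (fun y => pair ξ y ((e i).1 y)) x := fun i =>
      contMDiff_pair ξ (e i) x
    rw [hD.apply_sum (hU.mem_nhds hx) hc hs, dirDeriv_congr h1,
      dirDeriv_sum _ (f := fun i y => c i y * pair ξ y ((e i).1 y))
        fun i _ => (hc i x hx).mul (hsm i), hs x hx]
    rw [map_sum, pair_vsum, ← Finset.sum_sub_distrib]
    refine Finset.sum_congr rfl fun i _ => ?_
    rw [map_smul, pair_vadd, pair_vsmul, pair_vsmul, ← hB i, B.constr_basis, hB i,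
      dirDeriv_mul (hc i x hx) (hsm i), smul_eq_mul]
    ring
  choose p hp using hex
  have hext : ∀ (x : M) (q r : Dual ℝ (E.Fiber x)), (∀ s : E.sec, q (s.1 x) = r (s.1 x)) → q = r :=
    fun x q r h => by
      ext w
      obtain ⟨s, hs⟩ := hE.exists_sec_eq x w
      rw [← hs, h]
  have hmem : ∀ ξ, (fun x => p ξ x) ∈ E.dual.sec := fun ξ s hs => by
    have h1 : (fun x => p ξ x (s x)) = fun x =>
        dirDeriv (fun y => pair ξ y (s y)) x (v.1 x) - pair ξ x ((D ⟨s, hs⟩).1 x) :=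
      funext fun x => hp ξ x ⟨s, hs⟩
    change ContMDiff (𝓡 n) 𝓘(ℝ, ℝ) ∞ (fun x => p ξ x (s x))
    rw [h1]
    exact (contMDiff_dirDeriv ⟨_, contMDiff_pair ξ ⟨s, hs⟩⟩ v).sub (contMDiff_pair ξ _)
  refine ⟨{ toFun := fun ξ => ⟨fun x => p ξ x, hmem ξ⟩
            map_add' := fun ξ η => ?_
            map_smul' := fun r ξ => ?_ }, fun f ξ x => ?_, fun ξ s x => hp ξ x s⟩
  · ext x : 2
    refine hext x _ (p ξ x + p η x) fun s => ?_
    rw [LinearMap.add_apply, hp, hp, hp]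
    simp only [pair_add]
    rw [dirDeriv_add (contMDiff_pair ξ s) (contMDiff_pair η s)]
    ring
  · ext x : 2
    refine hext x _ (r • p ξ x) fun s => ?_
    rw [LinearMap.smul_apply, hp, hp]
    simp only [pair_smul]
    rw [dirDeriv_const_mul (contMDiff_pair ξ s), smul_eq_mul]
    ring
  · refine hext x _ (f x • p ξ x + dirDeriv f x (v.1 x) • (show Dual ℝ (E.Fiber x) from ξ.1 x))
      fun s => ?_
    rw [LinearMap.add_apply, LinearMap.smul_apply, LinearMap.smul_apply]
    change p (f • ξ) x (s.1 x) = _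
    rw [hp, hp]
    have h1 : ∀ y w, pair (f • ξ) y w = f y * pair ξ y w := fun _ _ => rfl
    simp only [h1]
    rw [dirDeriv_mul (smoothAt_coe f x) (contMDiff_pair ξ s x)]
    simp only [smul_eq_mul, pair]
    ring

end LocallyFree

section Bundles

variable {n : ℕ} {M : Type u} [TopologicalSpace M] [ChartedSpace (EuclideanSpace ℝ (Fin n)) M]
  [IsManifold (𝓡 n) ∞ M] [T2Space M]
  {F : Type*} [NormedAddCommGroup F] [NormedSpace ℝ F] [FiniteDimensional ℝ F]
  {V : M → Type v} [∀ x, AddCommGroup (V x)] [∀ x, Module ℝ (V x)] [∀ x, TopologicalSpace (V x)]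
  [TopologicalSpace (TotalSpace F V)] [FiberBundle F V] [VectorBundle ℝ F V]

/-- Smooth vector bundles are locally free. -/
theorem locallyFree_ofBundle [ContMDiffVectorBundle ∞ F V (𝓡 n)] :
    (ofBundle n F V).LocallyFree := by
  intro x₀
  let e := trivializationAt F V x₀
  have hx₀ : x₀ ∈ e.baseSet := FiberBundle.mem_baseSet_trivializationAt' x₀
  let β := finBasis ℝ F
  obtain ⟨f, hf1, hf⟩ := exists_bump (n := n) x₀ (e.open_baseSet.mem_nhds hx₀)
  obtain ⟨U, hU1, hU, hxU⟩ := mem_nhds_iff.1 (Filter.inter_mem hf1 (e.open_baseSet.mem_nhds hx₀))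
  refine ⟨U, hU, hxU, fun i => ⟨fun x => f x • e.localFrame β i x,
    ContMDiffOn.smul_section_of_tsupport (u := e.baseSet) f.contMDiff.contMDiffOn e.open_baseSet hf
      (e.contMDiffOn_localFrame_baseSet (I := 𝓡 n) ∞ β i)⟩, fun x hx => ?_, fun s => ?_⟩
  · have h1 : f x = 1 := (hU1 hx).1
    simp only [h1, one_smul]
    exact (e.isLocalFrameOn_localFrame_baseSet (𝓡 n) ∞ β).linearIndependent (hU1 hx).2
  · refine ⟨fun i x => e.localFrameCoeff (𝓡 n) β i x (s.1 x), fun i x hx =>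
      contMDiffAt_localFrameCoeff β (hU1 hx).2 (s.2 x) i, fun x hx => ?_⟩
    have h1 : f x = 1 := (hU1 hx).1
    simp only [h1, one_smul]
    exact e.eq_sum_localFrameCoeff_smul (I := 𝓡 n) (b := β) (hU1 hx).2

variable [SecondCountableTopology M]

/-- Smooth sections with values in convex sets can be constructed locally. -/
theorem exists_sec_forall_mem_of_local (t : ∀ x, Set (V x)) (ht : ∀ x, Convex ℝ (t x))
    (h : ∀ x₀, ∃ s : (ofBundle n F V).sec, ∀ᶠ x in 𝓝 x₀, s.1 x ∈ t x) :
    ∃ s : (ofBundle n F V).sec, ∀ x, s.1 x ∈ t x := by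
  have : LocallyCompactSpace M := Manifold.locallyCompact_of_finiteDimensional (𝓡 n)
  obtain ⟨s, hs⟩ := exists_contMDiffSection_forall_mem_convex_of_local (𝓡 n) (n := ⊤)
    (F_fiber := F) V t ht fun x₀ => by
      obtain ⟨s, hs⟩ := h x₀
      exact ⟨_, hs, s.1, s.2.contMDiffOn, fun y hy => hy⟩
  exact ⟨⟨s, s.contMDiff⟩, hs⟩

/-- Sections of a quotient bundle lift to global sections. -/
theorem quotMk_surjective (W : ∀ x, Submodule ℝ (V x)) (r : ℕ) (hr : ∀ x, finrank ℝ (W x) = r) :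
    Function.Surjective ((ofBundle n F V).quotMk W r hr) := by
  intro q
  obtain ⟨s, hs⟩ := exists_sec_forall_mem_of_local (n := n) (F := F)
    (fun x => {v : V x | (W x).mkQ v = q.1 x})
    (fun x a ha b hb α β _ _ hαβ => by
      have ha' : (W x).mkQ a = q.1 x := ha
      have hb' : (W x).mkQ b = q.1 x := hb
      change (W x).mkQ (α • a + β • b) = q.1 x
      rw [map_add, map_smul, map_smul, ha', hb', ← add_smul, hαβ, one_smul]) fun x₀ => by
    obtain ⟨t, ht, hqt⟩ := q.2 x₀
    have key : ∃ s : (ofBundle n F V).sec, ∀ x, (W x).mkQ (s.1 x) = t x := by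
      clear hqt
      induction ht using Submodule.span_induction with
      | mem t ht =>
        obtain ⟨f, _, ⟨s, rfl⟩, rfl⟩ := ht
        exact ⟨⟨fun x => f x • s.1 x, (ofBundle n F V).smul_mem f s.1 s.2⟩, fun x => map_smul _ _ _⟩
      | zero => exact ⟨0, fun x => map_zero _⟩
      | add a b _ _ ha hb =>
        obtain ⟨s, hs⟩ := ha
        obtain ⟨s', hs'⟩ := hb
        exact ⟨s + s', fun x => (map_add _ _ _).trans (by rw [hs, hs']; rfl)⟩
      | smul c a _ ha =>
        obtain ⟨s, hs⟩ := ha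
        exact ⟨c • s, fun x => (map_smul _ _ _).trans (by rw [hs]; rfl)⟩
    obtain ⟨s, hs⟩ := key
    refine ⟨s, ?_⟩
    filter_upwards [hqt] with x hx
    exact (hs x).trans hx.symm
  refine ⟨s, ?_⟩
  ext x
  exact hs x

end Bundles

end SmoothFamily

/-! ### Frames adapted to a morphism of constant rank -/

namespace LieAlgebroid

open SmoothFamily

namespace Hom

section Adapted

variable {n : ℕ} {M : Type u} [TopologicalSpace M] [ChartedSpace (EuclideanSpace ℝ (Fin n)) M]
  [IsManifold (𝓡 n) ∞ M]
  {A : SmoothFamily.{u, v} n M} {A' : SmoothFamily.{u, w} n M} {L : LieAlgebroid A}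
  {L' : LieAlgebroid A'} (Φ : L.Hom L') (b : ℕ)
  (hb : ∀ x, finrank ℝ (LinearMap.range (Φ.map x)) = b)

/-- Sections `k` of the kernel, `a` of the source and `z` of the target which over `U` form frames
`(k, a)` of the source, `(Φ a, z)` of the target, `k` of the kernel and `z` modulo the image of the
cokernel. -/
structure IsAdaptedFrame (U : Set M) (k : Fin (A.rank - b) → (Φ.kerBundle b hb).sec)
    (a : Fin b → A.sec) (z : Fin (A'.rank - b) → A'.sec) : Prop where
  source : A.IsFrameOn U (Sum.elim (fun i => A.subIncl (k i)) a)
  target : A'.IsFrameOn U (Sum.elim (fun j => Φ.onSec (a j)) z)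
  kernel : (Φ.kerBundle b hb).IsFrameOn U k
  coker : (Φ.cokerBundle b hb).IsFrameOn U fun l => A'.quotMk _ b hb (z l)

/-- Sections whose images form a basis of the range at `x` span the range. -/
theorem exists_sum_of_mem_range {a : Fin b → A.sec} {x : M}
    (ha : LinearIndependent ℝ fun j => Φ.map x ((a j).1 x))
    (hb : finrank ℝ (LinearMap.range (Φ.map x)) = b) {y : A'.Fiber x}
    (hy : y ∈ LinearMap.range (Φ.map x)) : ∃ d : Fin b → ℝ, y = ∑ j, d j • Φ.map x ((a j).1 x) := by
  have hspan : Submodule.span ℝ (Set.range fun j => Φ.map x ((a j).1 x)) =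
      LinearMap.range (Φ.map x) := by
    refine Submodule.eq_of_le_of_finrank_eq ?_ ?_
    · rw [Submodule.span_le]
      rintro _ ⟨j, rfl⟩
      exact ⟨(a j).1 x, rfl⟩
    · rw [finrank_span_eq_card ha, hb, Fintype.card_fin]
  rw [← hspan, Submodule.mem_span_range_iff_exists_fun] at hy
  obtain ⟨d, hd⟩ := hy
  exact ⟨d, hd.symm⟩

/-- In a frame `(Φ a, z)`, vectors in the range have no component along `z`. -/
theorem coeff_eq_zero_of_mem_range {κ : Type*} [Fintype κ] {a : Fin b → A.sec} {z : κ → A'.sec}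
    {x : M} (h : LinearIndependent ℝ
      fun i => (Sum.elim (fun j => Φ.onSec (a j)) z i).1 x)
    (hb : finrank ℝ (LinearMap.range (Φ.map x)) = b) {c : Fin b → ℝ} {d : κ → ℝ}
    (hy : ∑ j, c j • Φ.map x ((a j).1 x) + ∑ l, d l • (z l).1 x ∈ LinearMap.range (Φ.map x)) :
    d = 0 := by
  have ha : LinearIndependent ℝ fun j => Φ.map x ((a j).1 x) := h.comp Sum.inl Sum.inl_injective
  obtain ⟨c', hc'⟩ := Φ.exists_sum_of_mem_range b ha hb hy
  have h1 := h.coeff_unique (c := Sum.elim c d) (d := Sum.elim c' 0) (by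
    simp only [Fintype.sum_sum_type, Sum.elim_inl, Sum.elim_inr, Pi.zero_apply, zero_smul,
      Finset.sum_const_zero, add_zero]
    exact hc')
  funext l
  exact congrFun h1 (Sum.inr l)

theorem le_rank_source (b : ℕ) (hb : ∀ x, finrank ℝ (LinearMap.range (Φ.map x)) = b) (x : M) :
    b ≤ A.rank := by
  have h := LinearMap.finrank_range_le (Φ.map x)
  rwa [hb, A.finrank_fiber] at h

theorem le_rank_target (b : ℕ) (hb : ∀ x, finrank ℝ (LinearMap.range (Φ.map x)) = b) (x : M) :
    b ≤ A'.rank := by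
  have h := Submodule.finrank_le (LinearMap.range (Φ.map x))
  rwa [hb, A'.finrank_fiber] at h

/-- Adapted frames exist near each point: lift a basis of the range at the point to `a`, complete
its image to a frame by `z`, and subtract combinations of `a` from sections whose values at the point
form a basis of the kernel. -/
theorem exists_adaptedFrame [T2Space M] (hA : A.LocallyFree) (hA' : A'.LocallyFree) (x₀ : M) :
    ∃ U, IsOpen U ∧ x₀ ∈ U ∧ ∃ k a z, Φ.IsAdaptedFrame b hb U k a z := by
  have hbA : b ≤ A.rank := Φ.le_rank_source b hb x₀
  have hbA' : b ≤ A'.rank := Φ.le_rank_target b hb x₀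
  -- sections of the source whose images form a basis of the range at `x₀`
  let B : Basis (Fin b) ℝ (LinearMap.range (Φ.map x₀)) := finBasisOfFinrankEq ℝ _ (hb x₀)
  choose v hv using fun i => LinearMap.mem_range.1 (B i).2
  choose a ha using fun i => hA.exists_sec_eq x₀ (v i)
  have haB : ∀ j, Φ.map x₀ ((a j).1 x₀) = (B j : A'.Fiber x₀) := fun j => by rw [ha, hv]
  -- sections of the target which form a basis of the cokernel at `x₀`
  let Q : Basis (Fin (A'.rank - b)) ℝ (A'.Fiber x₀ ⧸ LinearMap.range (Φ.map x₀)) :=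
    finBasisOfFinrankEq ℝ _ (by rw [Submodule.finrank_quotient, A'.finrank_fiber, hb])
  choose w hw using fun l => Submodule.Quotient.mk_surjective _ (Q l)
  choose z hz using fun l => hA'.exists_sec_eq x₀ (w l)
  have hli' : LinearIndependent ℝ
      fun i => (Sum.elim (fun j => Φ.onSec (a j)) z i).1 x₀ := by
    have h := B.linearIndependent.sumElim_of_quotient w (by
      have h2 : Submodule.Quotient.mk ∘ w = Q := funext hw
      rw [h2]
      exact Q.linearIndependent)
    have h3 : (fun i => (Sum.elim (fun j => Φ.onSec (a j)) z i).1 x₀) =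
        Sum.elim (fun j => (B j : A'.Fiber x₀)) w := by
      funext i
      rcases i with j | l
      · exact haB j
      · exact hz l
    rw [h3]
    exact h
  obtain ⟨U₀, hU₀, hx₀, e', he'⟩ := hA' x₀
  obtain ⟨U₁, hU₁, hx₁, -, hframe'⟩ := (he'.reindex (finSumFinEquiv.trans
    (finCongr (by omega : b + (A'.rank - b) = A'.rank)))).exists_isFrameOn hU₀ hx₀ hli'
  -- sections of the source with values at `x₀` in a basis of the kernel
  let K : Basis (Fin (A.rank - b)) ℝ (LinearMap.ker (Φ.map x₀)) :=
    finBasisOfFinrankEq ℝ _ ((Φ.kerBundle b hb).finrank_fiber x₀)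
  choose κ hκ using fun i => hA.exists_sec_eq x₀ (K i : A.Fiber x₀)
  obtain ⟨c, hc, hκc⟩ := hframe'.exists_coeff_family fun i => Φ.onSec (κ i)
  have hκc' : ∀ i, ∀ x ∈ U₁, Φ.map x ((κ i).1 x) =
      ∑ j, c i (Sum.inl j) x • Φ.map x ((a j).1 x) := fun i x hx => by
    have h1 := hκc i x hx
    rw [Fintype.sum_sum_type] at h1
    have h2 : (fun l => c i (Sum.inr l) x) = 0 :=
      Φ.coeff_eq_zero_of_mem_range b (hframe'.linearIndependent x hx) (hb x)
        (c := fun j => c i (Sum.inl j) x) (z := z)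
        ((show ∀ w, w = Φ.map x ((κ i).1 x) → w ∈ LinearMap.range (Φ.map x) by
          rintro _ rfl
          exact LinearMap.mem_range_self _ _) _ h1.symm)
    have h3 : ∀ l, c i (Sum.inr l) x = 0 := fun l => congrFun h2 l
    simp only [h3, zero_smul, Finset.sum_const_zero, add_zero, Sum.elim_inl] at h1
    exact h1
  -- correct them, near `x₀`, to sections of the kernel
  obtain ⟨f, hf1, hf⟩ := exists_bump (n := n) x₀ (hU₁.mem_nhds hx₁)
  let fc : Fin (A.rank - b) → Fin b → C^∞⟮𝓡 n, M; ℝ⟯ := fun i j =>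
    ⟨fun x => f x * c i (Sum.inl j) x, contMDiff_bump_mul f hf (hc i (Sum.inl j))⟩
  let k₀ : Fin (A.rank - b) → A.sec := fun i => f • κ i - ∑ j, fc i j • a j
  have hk₀ : ∀ i x, (k₀ i).1 x = f x • ((κ i).1 x - ∑ j, c i (Sum.inl j) x • (a j).1 x) :=
    fun i x => by
      change f x • (κ i).1 x - (∑ j, fc i j • a j).1 x = _
      rw [SmoothFamily.sum_apply, smul_sub, Finset.smul_sum]
      simp only [smul_smul]
      rfl
  have hk₀mem : ∀ i x, (k₀ i).1 x ∈ LinearMap.ker (Φ.map x) := fun i x => by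
    rw [hk₀, LinearMap.mem_ker, map_smul]
    by_cases hx : x ∈ U₁
    · rw [map_sub, map_sum, hκc' i x hx]
      simp
    · have h1 : f x = 0 := image_eq_zero_of_notMem_tsupport fun h => hx (hf h)
      rw [h1, zero_smul]
  have hk₀x : ∀ i, (k₀ i).1 x₀ = (K i : A.Fiber x₀) := fun i => by
    have h1 := hκc' i x₀ hx₁
    have h2 : (fun j => c i (Sum.inl j) x₀) = 0 := by
      refine LinearIndependent.coeff_unique (e := fun j => Φ.map x₀ ((a j).1 x₀))
        ((hframe'.linearIndependent x₀ hx₁).comp Sum.inl Sum.inl_injective) ?_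
      rw [← h1, hκ]
      simp only [Pi.zero_apply, zero_smul, Finset.sum_const_zero]
      exact LinearMap.mem_ker.1 (K i).2
    have h3 : ∀ j, c i (Sum.inl j) x₀ = 0 := fun j => congrFun h2 j
    rw [hk₀, hf1.self_of_nhds, hκ]
    simp [h3]
  let k : Fin (A.rank - b) → (Φ.kerBundle b hb).sec := fun i =>
    ⟨fun x => ⟨(k₀ i).1 x, hk₀mem i x⟩, (k₀ i).2⟩
  have hli : LinearIndependent ℝ fun i => (Sum.elim (fun i => A.subIncl (k i)) a i).1 x₀ := by
    have h := K.linearIndependent.sumElim_of_quotient (fun j => (a j).1 x₀) (by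
      refine LinearIndependent.of_comp
        ((LinearMap.ker (Φ.map x₀)).liftQ (Φ.map x₀) le_rfl) ?_
      exact (hframe'.linearIndependent x₀ hx₁).comp Sum.inl Sum.inl_injective)
    have h3 : (fun i => (Sum.elim (fun i => A.subIncl (k i)) a i).1 x₀) =
        Sum.elim (fun i => (K i : A.Fiber x₀)) fun j => (a j).1 x₀ := by
      funext i
      rcases i with i | j
      · exact hk₀x i
      · rfl
    rw [h3]
    exact h
  obtain ⟨U₂, hU₂, hx₂, e, he⟩ := hA x₀
  obtain ⟨U₃, hU₃, hx₃, -, hframe⟩ := (he.reindex (finSumFinEquiv.trans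
    (finCongr (by omega : A.rank - b + b = A.rank)))).exists_isFrameOn hU₂ hx₂ hli
  replace hframe := hframe.mono (Set.inter_subset_left (t := U₁))
  replace hframe' := hframe'.mono (Set.inter_subset_right (s := U₃))
  refine ⟨U₃ ∩ U₁, hU₃.inter hU₁, ⟨hx₃, hx₁⟩, k, a, z, hframe, hframe', ⟨fun x hx => ?_,
    fun s => ?_⟩, ?_⟩
  · exact LinearIndependent.of_comp (LinearMap.ker (Φ.map x)).subtype
      ((hframe.linearIndependent x hx).comp Sum.inl Sum.inl_injective)
  · obtain ⟨d, hd, hs⟩ := hframe.exists_coeff (A.subIncl s)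
    refine ⟨fun i => d (Sum.inl i), fun i => hd _, fun x hx => ?_⟩
    have h1 := hs x hx
    rw [Fintype.sum_sum_type] at h1
    have h2 : ∑ j, d (Sum.inr j) x • Φ.map x ((a j).1 x) = 0 := by
      have h3 := congrArg (Φ.map x) h1
      rw [map_add, map_sum, map_sum] at h3
      have h4 : Φ.map x ((A.subIncl s).1 x) = 0 := LinearMap.mem_ker.1 (s.1 x).2
      have h5 : ∀ i, Φ.map x (d (Sum.inl i) x • (A.subIncl (k i)).1 x) = 0 := fun i => by
        rw [map_smul]
        have h6 : Φ.map x ((A.subIncl (k i)).1 x) = 0 := LinearMap.mem_ker.1 ((k i).1 x).2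
        rw [h6, smul_zero]
      simp only [Sum.elim_inl, Sum.elim_inr] at h3
      rw [h4, Finset.sum_eq_zero fun i _ => h5 i, zero_add] at h3
      simpa only [map_smul] using h3.symm
    have h3 : (fun j => d (Sum.inr j) x) = 0 :=
      LinearIndependent.coeff_unique (e := fun j => Φ.map x ((a j).1 x))
        ((hframe'.linearIndependent x hx).comp Sum.inl Sum.inl_injective) (by simpa using h2)
    have h4 : ∀ j, d (Sum.inr j) x = 0 := fun j => congrFun h3 j
    simp only [h4, zero_smul, Finset.sum_const_zero, add_zero, Sum.elim_inl] at h1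
    ext
    rw [Submodule.coe_sum]
    exact h1
  · refine isFrameOn_of_generators (hU₃.inter hU₁) _ (fun s hs => hs) (fun x hx => ?_) ?_
    · rw [Fintype.linearIndependent_iff]
      intro d hd l
      have h1 : (LinearMap.range (Φ.map x)).mkQ (∑ l, d l • (z l).1 x) = 0 := by
        rw [map_sum, ← hd]
        exact Finset.sum_congr rfl fun l _ => map_smul _ _ _
      rw [Submodule.mkQ_apply, Submodule.Quotient.mk_eq_zero] at h1
      exact congrFun (Φ.coeff_eq_zero_of_mem_range b (hframe'.linearIndependent x hx) (hb x)
        (c := 0) (by simpa using h1)) l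
    · rintro _ ⟨s, rfl⟩
      obtain ⟨d, hd, hs⟩ := hframe'.exists_coeff s
      refine ⟨fun l => d (Sum.inr l), fun l => hd _, fun x hx => ?_⟩
      beta_reduce
      rw [hs x hx, Fintype.sum_sum_type, map_add, map_sum, map_sum]
      have h1 : ∀ j, (LinearMap.range (Φ.map x)).mkQ
          (d (Sum.inl j) x • (Sum.elim (fun j => Φ.onSec (a j)) z (Sum.inl j)).1 x) = 0 :=
          fun j => by
        rw [Submodule.mkQ_apply, Submodule.Quotient.mk_eq_zero]
        exact Submodule.smul_mem _ _ ⟨(a j).1 x, rfl⟩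
      rw [Finset.sum_eq_zero fun j _ => h1 j, zero_add]
      exact Finset.sum_congr rfl fun l _ => map_smul _ _ _

end Adapted

section Lift

variable {n : ℕ} {M : Type u} [TopologicalSpace M] [ChartedSpace (EuclideanSpace ℝ (Fin n)) M]
  [IsManifold (𝓡 n) ∞ M] [T2Space M] [SecondCountableTopology M]
  {F : Type*} [NormedAddCommGroup F] [NormedSpace ℝ F] [FiniteDimensional ℝ F]
  {V : M → Type v} [∀ x, AddCommGroup (V x)] [∀ x, Module ℝ (V x)] [∀ x, TopologicalSpace (V x)]
  [TopologicalSpace (TotalSpace F V)] [FiberBundle F V] [VectorBundle ℝ F V]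
  [ContMDiffVectorBundle ∞ F V (𝓡 n)]
  {F' : Type*} [NormedAddCommGroup F'] [NormedSpace ℝ F'] [FiniteDimensional ℝ F']
  {V' : M → Type w} [∀ x, AddCommGroup (V' x)] [∀ x, Module ℝ (V' x)] [∀ x, TopologicalSpace (V' x)]
  [TopologicalSpace (TotalSpace F' V')] [FiberBundle F' V'] [VectorBundle ℝ F' V']
  [ContMDiffVectorBundle ∞ F' V' (𝓡 n)]
  {L : LieAlgebroid (ofBundle n F V)} {L' : LieAlgebroid (ofBundle n F' V')} (Φ : L.Hom L') (b : ℕ)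
  (hb : ∀ x, finrank ℝ (LinearMap.range (Φ.map x)) = b)

/-- Sections of the image lift to global sections of the source. -/
theorem toImage_onSec_surjective : Function.Surjective (Φ.toImage b hb).onSec := by
  intro y
  obtain ⟨s, hs⟩ := exists_sec_forall_mem_of_local (n := n) (F := F)
    (fun x => {v : V x | Φ.map x v = (y.1 x : V' x)})
    (fun x p hp q hq α β _ _ hαβ => by
      have hp' : Φ.map x p = (y.1 x : V' x) := hp
      have hq' : Φ.map x q = (y.1 x : V' x) := hq
      change Φ.map x (α • p + β • q) = (y.1 x : V' x)
      rw [map_add, map_smul, map_smul, hp', hq', ← add_smul, hαβ, one_smul])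
    fun x₀ => Φ.exists_local_lift b hb (subIncl _ y) (fun x => (y.1 x).2) x₀
  refine ⟨s, ?_⟩
  ext x
  exact hs x

end Lift

end Hom

end LieAlgebroid

/-! ### Vector fields -/

namespace SmoothFamily

section VectorFields

variable {n : ℕ} {M : Type u} [TopologicalSpace M] [ChartedSpace (EuclideanSpace ℝ (Fin n)) M]
  [IsManifold (𝓡 n) ∞ M]

theorem mdifferentiableAt_sec (X : (tangent n M).sec) (x : M) :
    MDifferentiableAt (𝓡 n) (𝓡 n).tangent
      (fun y => (TotalSpace.mk' (EuclideanSpace ℝ (Fin n)) y (X.1 y) : TangentBundle (𝓡 n) M)) x :=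
  (X.2 x).mdifferentiableAt (by simp)

theorem minSmoothness_two_le : minSmoothness ℝ 2 ≤ (∞ : WithTop ℕ∞) := by
  rw [minSmoothness_of_isRCLikeNormedField]
  exact WithTop.coe_le_coe.2 (le_top : (2 : ℕ∞) ≤ ⊤)

/-- The Lie bracket of vector fields, as a bilinear operator on smooth sections of the tangent
bundle. -/
def lieBracketVF : (tangent n M).sec →ₗ[ℝ] (tangent n M).sec →ₗ[ℝ] (tangent n M).sec :=
  LinearMap.mk₂ ℝ
    (fun X Y => ⟨fun x => VectorField.mlieBracket (𝓡 n) (fun y => X.1 y) (fun y => Y.1 y) x, by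
      have h0 : IsManifold (𝓡 n) ((⊤ : ℕ∞) + 1) M := ‹IsManifold (𝓡 n) ∞ M›
      have h2 : IsManifold (𝓡 n) (minSmoothness ℝ 2) M := .of_le (n := ∞) minSmoothness_two_le
      intro x
      exact ContMDiffAt.mlieBracket_vectorField (m := ⊤) (n := ⊤) (X.2 x) (Y.2 x) (by
        rw [minSmoothness_of_isRCLikeNormedField]
        exact le_rfl)⟩)
    (fun X X' Y => by
      have h2 : IsManifold (𝓡 n) (minSmoothness ℝ 2) M := .of_le (n := ∞) minSmoothness_two_le
      ext x : 2
      exact VectorField.mlieBracket_add_left (mdifferentiableAt_sec X x)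
        (mdifferentiableAt_sec X' x))
    (fun c X Y => by
      have h2 : IsManifold (𝓡 n) (minSmoothness ℝ 2) M := .of_le (n := ∞) minSmoothness_two_le
      ext x : 2
      exact VectorField.mlieBracket_const_smul_left (mdifferentiableAt_sec X x))
    (fun X Y Y' => by
      have h2 : IsManifold (𝓡 n) (minSmoothness ℝ 2) M := .of_le (n := ∞) minSmoothness_two_le
      ext x : 2
      exact VectorField.mlieBracket_add_right (mdifferentiableAt_sec Y x)
        (mdifferentiableAt_sec Y' x))
    (fun c X Y => by
      have h2 : IsManifold (𝓡 n) (minSmoothness ℝ 2) M := .of_le (n := ∞) minSmoothness_two_le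
      ext x : 2
      exact VectorField.mlieBracket_const_smul_right (mdifferentiableAt_sec Y x))

theorem lieBracketVF_swap (X Y : (tangent n M).sec) : lieBracketVF X Y = -lieBracketVF Y X := by
  ext x : 2
  exact VectorField.mlieBracket_swap_apply

theorem isDer_lieBracketVF (X : (tangent n M).sec) : IsDer X (lieBracketVF X) := by
  intro f Y x
  have h := VectorField.mlieBracket_smul_right (I := 𝓡 n) (V := fun y => X.1 y)
    (W := fun y => Y.1 y) (x := x) (f := f) (f.contMDiff.mdifferentiableAt (by simp))
    (mdifferentiableAt_sec Y x)
  rw [add_comm] at h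
  exact h

theorem lieBracketVF_jacobi (X Y Z : (tangent n M).sec) : lieBracketVF X (lieBracketVF Y Z) =
    lieBracketVF (lieBracketVF X Y) Z + lieBracketVF Y (lieBracketVF X Z) := by
  have h3 : IsManifold (𝓡 n) (minSmoothness ℝ 3) M := IsManifold.of_le (n := ∞) (by
    rw [minSmoothness_of_isRCLikeNormedField]
    exact WithTop.coe_le_coe.2 (le_top : (3 : ℕ∞) ≤ ⊤))
  ext x : 2
  exact VectorField.leibniz_identity_mlieBracket_apply ((X.2 x).of_le minSmoothness_two_le)
    ((Y.2 x).of_le minSmoothness_two_le) ((Z.2 x).of_le minSmoothness_two_le)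

/-- The bracket of vector fields acts on functions as the commutator. It is deduced from the Jacobi
identity for `X`, `Y` and `f Z`, with `Z` nonzero at the point. -/
theorem dirDeriv_lieBracketVF (X Y : (tangent n M).sec) (f : C^∞⟮𝓡 n, M; ℝ⟯) (x : M) :
    dirDeriv f x ((lieBracketVF X Y).1 x) =
      dirDeriv (derivAlong Y f) x (X.1 x) - dirDeriv (derivAlong X f) x (Y.1 x) := by
  by_cases h0 : ∃ Z : (tangent n M).sec, Z.1 x ≠ 0
  · obtain ⟨Z, hZ⟩ := h0
    exact (isDer_lieBracketVF X).dirDeriv_eq_commutator (isDer_lieBracketVF Y)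
      (isDer_lieBracketVF (lieBracketVF X Y))
      (fun Z => eq_sub_of_add_eq (lieBracketVF_jacobi X Y Z).symm) f hZ
  · push Not at h0
    rw [h0, h0, h0, dirDeriv_vzero, dirDeriv_vzero, dirDeriv_vzero, sub_zero]

end VectorFields

end SmoothFamily

/-! ### Representations on line bundles and characteristic classes -/

namespace SmoothFamily

section Lines

variable {n : ℕ} {M : Type u} [TopologicalSpace M] [ChartedSpace (EuclideanSpace ℝ (Fin n)) M]

/-- A nowhere-vanishing section of a line bundle generates it globally. -/
theorem LocallyLine.isGen_univ {T : SmoothFamily.{u, v} n M} (hT : T.LocallyLine) {lam : T.sec}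
    (h0 : ∀ x, lam.1 x ≠ 0) : T.IsGen Set.univ lam := by
  refine ⟨fun x _ => linearIndependent_unique_iff.2 (h0 x), fun s => ?_⟩
  have key : ∀ x₀ : M, ∃ c : M → ℝ, SmoothAt n c x₀ ∧ ∀ᶠ x in 𝓝 x₀, s.1 x = c x • lam.1 x := by
    intro x₀
    obtain ⟨U, hU, hx₀, g, hg⟩ := hT x₀
    obtain ⟨c, hc, hs⟩ := hg.exists_coeff s
    obtain ⟨d, hd, hl⟩ := hg.exists_coeff lam
    have hd0 : ∀ x ∈ U, d x ≠ 0 := fun x hx h => h0 x (by rw [hl x hx, h, zero_smul])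
    refine ⟨fun x => c x * (d x)⁻¹, (hc x₀ hx₀).mul (smoothAt_inv (hd x₀ hx₀) (hd0 x₀ hx₀)), ?_⟩
    filter_upwards [hU.mem_nhds hx₀] with x hx
    rw [hs x hx, hl x hx, smul_smul, inv_mul_cancel_right₀ (hd0 x hx)]
  choose c hc hsc using key
  refine ⟨fun _ x => c x x, fun _ x₀ _ => ?_, fun x _ => ?_⟩
  · refine (hc x₀).congr_of_eventuallyEq ?_
    filter_upwards [hsc x₀] with x hx
    have h1 := (hsc x).self_of_nhds
    rw [hx] at h1
    exact (smul_left_injective ℝ (h0 x) h1).symm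
  · simpa using (hsc x).self_of_nhds

theorem tmul_add {T : SmoothFamily.{u, v} n M} {T' : SmoothFamily.{u, w} n M} (s : T.sec)
    (t t' : T'.sec) : tmul s (t + t') = tmul s t + tmul s t' := by
  ext x
  exact TensorProduct.tmul_add _ _ _

theorem add_tmul {T : SmoothFamily.{u, v} n M} {T' : SmoothFamily.{u, w} n M} (s s' : T.sec)
    (t : T'.sec) : tmul (s + s') t = tmul s t + tmul s' t := by
  ext x
  exact TensorProduct.add_tmul _ _ _

theorem tmul_sub {T : SmoothFamily.{u, v} n M} {T' : SmoothFamily.{u, w} n M} (s : T.sec)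
    (t t' : T'.sec) : tmul s (t - t') = tmul s t - tmul s t' := by
  ext x
  exact TensorProduct.tmul_sub _ _ _

theorem sub_tmul {T : SmoothFamily.{u, v} n M} {T' : SmoothFamily.{u, w} n M} (s s' : T.sec)
    (t : T'.sec) : tmul (s - s') t = tmul s t - tmul s' t := by
  ext x
  exact TensorProduct.sub_tmul _ _ _

theorem smul_tmul {T : SmoothFamily.{u, v} n M} {T' : SmoothFamily.{u, w} n M} (c : ℝ) (s : T.sec)
    (t : T'.sec) : tmul (c • s) t = c • tmul s t := by
  ext x
  exact TensorProduct.smul_tmul' _ _ _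

theorem tmul_smul {T : SmoothFamily.{u, v} n M} {T' : SmoothFamily.{u, w} n M} (c : ℝ) (s : T.sec)
    (t : T'.sec) : tmul s (c • t) = c • tmul s t := by
  ext x
  exact TensorProduct.tmul_smul _ _ _

variable [IsManifold (𝓡 n) ∞ M] [T2Space M] [SecondCountableTopology M]

/-- The square of a line bundle has a nowhere-vanishing section, obtained by gluing the squares of
local generators with a partition of unity: they are positive multiples of each other. -/
theorem LocallyLine.exists_sec_tensor_ne_zero {T : SmoothFamily.{u, v} n M} (hT : T.LocallyLine) :
    ∃ mu : (T.tensor T).sec, ∀ x, mu.1 x ≠ 0 := by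
  have : LocallyCompactSpace M := Manifold.locallyCompact_of_finiteDimensional (𝓡 n)
  choose U hU hxU g hg using hT
  obtain ⟨ρ, hρ⟩ := SmoothPartitionOfUnity.exists_isSubordinate (𝓡 n) isClosed_univ U hU
    (fun x _ => Set.mem_iUnion.2 ⟨x, hxU x⟩)
  let val : ∀ x, (T.tensor T).Fiber x := fun x => ∑ᶠ i, ρ i x • (tmul (g i) (g i)).1 x
  have key : ∀ x₀, ∃ h : M → ℝ, (∀ x ∈ U x₀, SmoothAt n h x) ∧ ∀ x ∈ U x₀, h x ≠ 0 ∧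
      val x = h x • (tmul (g x₀) (g x₀)).1 x := by
    intro x₀
    choose c hc hgc using fun i => (hg x₀).exists_coeff (g i)
    refine ⟨fun x => ∑ᶠ i, ρ i x • (c i x * c i x), fun x hx => ρ.contMDiffAt_finsum fun i _ =>
      (hc i x hx).mul (hc i x hx), fun x hx => ⟨?_, ?_⟩⟩
    · have h2 := ρ.sum_finsupport_smul_eq_finsum (x₀ := x) (fun i x => c i x * c i x)
      beta_reduce
      rw [← h2]
      obtain ⟨i, hi⟩ := ρ.exists_pos_of_mem (Set.mem_univ x)
      refine (Finset.sum_pos' (fun j _ => mul_nonneg (ρ.nonneg j x) (mul_self_nonneg _))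
        ⟨i, (ρ.mem_finsupport x).2 hi.ne', mul_pos hi (mul_self_pos.2 fun h => ?_)⟩).ne'
      have hxi : x ∈ U i := hρ i (subset_closure hi.ne')
      have h1 := hgc i x hx
      rw [h, zero_smul] at h1
      exact (hg i).ne_zero hxi h1
    · have h1 := ρ.sum_finsupport_smul_eq_finsum (x₀ := x)
        (fun i _ => (tmul (g i) (g i)).1 x)
      have h2 := ρ.sum_finsupport_smul_eq_finsum (x₀ := x) (fun i x => c i x * c i x)
      simp only [val]
      rw [← h1, ← h2, Finset.sum_smul]
      refine Finset.sum_congr rfl fun i _ => ?_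
      rw [smul_assoc]
      congr 1
      change (g i).1 x ⊗ₜ[ℝ] (g i).1 x = _
      rw [hgc i x hx]
      exact TensorProduct.smul_tmul_smul _ _ _ _
  have hmem : val ∈ (T.tensor T).sec := by
    refine isLocal_tensor T T _ fun x₀ => ?_
    obtain ⟨h, hh, hval⟩ := key x₀
    obtain ⟨f, hf⟩ := exists_smooth_eventuallyEq ((hU x₀).mem_nhds (hxU x₀)) hh
    refine ⟨⟨fun x => f x • (tmul (g x₀) (g x₀)).1 x,
      (T.tensor T).smul_mem f _ (Subtype.mem _)⟩, ?_⟩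
    filter_upwards [hf, (hU x₀).mem_nhds (hxU x₀)] with x h1 h2
    rw [(hval x h2).2, h1]
  refine ⟨⟨val, hmem⟩, fun x => ?_⟩
  obtain ⟨h, -, hval⟩ := key x
  change val x ≠ 0
  rw [(hval x (hxU x)).2]
  exact smul_ne_zero (hval x (hxU x)).1 (((hg x).tmul (hU x) (hg x)).ne_zero (hxU x))

end Lines

end SmoothFamily

namespace LieAlgebroid

open SmoothFamily

section LineReps

variable {n : ℕ} {M : Type u} [TopologicalSpace M] [ChartedSpace (EuclideanSpace ℝ (Fin n)) M]
  [IsManifold (𝓡 n) ∞ M]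
  {A : SmoothFamily.{u, v} n M} {L : LieAlgebroid A} {T : SmoothFamily.{u, w} n M}

theorem dirDeriv_anchor_bracket (L : LieAlgebroid A) (a b : A.sec) (f : C^∞⟮𝓡 n, M; ℝ⟯) (x : M) :
    dirDeriv f x ((L.anchorSec (L.bracket a b)).1 x) =
      dirDeriv (derivAlong (L.anchorSec b) f) x ((L.anchorSec a).1 x) -
        dirDeriv (derivAlong (L.anchorSec a) f) x ((L.anchorSec b).1 x) := by
  rw [← dirDeriv_lieBracketVF]
  exact congrArg (dirDeriv f x) (L.anchor_bracket a b x)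

theorem Rep.isDer (R : L.Rep T) (a : A.sec) : IsDer (L.anchorSec a) (R.D a) := R.leibniz a

theorem isDer_bracket (L : LieAlgebroid A) (a : A.sec) : IsDer (L.anchorSec a) (L.bracket a) :=
  L.leibniz a

theorem Rep.IsCharCocycle.tensor {R : L.Rep T} {R' : L.Rep (T.tensor T)} (hR : R.IsTensor R R')
    {α : L.Cocycle} (hα : R.IsCharCocycle α) : R'.IsCharCocycle ((2 : ℝ) • α) := by
  obtain ⟨lam, h0, hlam⟩ := hα
  refine ⟨SmoothFamily.tmul lam lam, fun x => tmul_ne_zero_of_ne_zero (h0 x) (h0 x), fun a x => ?_⟩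
  rw [hR]
  change (R.D a lam).1 x ⊗ₜ[ℝ] lam.1 x + lam.1 x ⊗ₜ[ℝ] (R.D a lam).1 x =
    (2 * pair α.1 x (a.1 x)) • (lam.1 x ⊗ₜ[ℝ] lam.1 x)
  rw [hlam, TensorProduct.tmul_smul, ← TensorProduct.smul_tmul']
  module

variable [T2Space M]

/-- A family of derivations of a line bundle over the anchors is a representation if it is linear
and flat on local generators. -/
theorem exists_rep (D : A.sec → T.sec →ₗ[ℝ] T.sec) (hD : ∀ a, IsDer (L.anchorSec a) (D a))
    (h : ∀ x, ∃ U, IsOpen U ∧ x ∈ U ∧ ∃ g : T.sec, T.IsGen U g ∧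
      (∀ a b, (D (a + b) g).1 x = (D a g).1 x + (D b g).1 x) ∧
      (∀ (c : ℝ) a, (D (c • a) g).1 x = c • (D a g).1 x) ∧
      (∀ (f : C^∞⟮𝓡 n, M; ℝ⟯) a, (D (f • a) g).1 x = f x • (D a g).1 x) ∧
      (∀ a b, (D a (D b g)).1 x - (D b (D a g)).1 x = (D (L.bracket a b) g).1 x)) :
    ∃ R : L.Rep T, ∀ a s, R.D a s = D a s := by
  choose U hU hxU g hg hadd hsmul hfsmul hflat using h
  have hadd' : ∀ a b, D (a + b) = D a + D b := fun a b => by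
    have h1 : IsDer (L.anchorSec (a + b)) (D a + D b) := by
      have h2 : L.anchorSec (a + b) = L.anchorSec a + L.anchorSec b := by
        ext x : 2
        exact map_add (L.anchor x) _ _
      rw [h2]
      exact (hD a).add (hD b)
    exact (hD (a + b)).ext_of_isGen h1 fun x => ⟨U x, hU x, hxU x, g x, hg x, hadd x a b⟩
  have hsmul' : ∀ (c : ℝ) a, D (c • a) = c • D a := fun c a => by
    have h1 : IsDer (L.anchorSec (c • a)) (c • D a) := by
      have h2 : L.anchorSec (c • a) = c • L.anchorSec a := by
        ext x : 2
        exact map_smul (L.anchor x) _ _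
      rw [h2]
      exact (hD a).const_smul c
    exact (hD (c • a)).ext_of_isGen h1 fun x => ⟨U x, hU x, hxU x, g x, hg x, hsmul x c a⟩
  have hfsmul' : ∀ (f : C^∞⟮𝓡 n, M; ℝ⟯) a, D (f • a) = smulOp f (D a) := fun f a => by
    have h1 : IsDer (L.anchorSec (f • a)) (smulOp f (D a)) :=
      (hD a).smulOp f fun x => map_smul (L.anchor x) _ _
    exact (hD (f • a)).ext_of_isGen h1 fun x => ⟨U x, hU x, hxU x, g x, hg x, hfsmul x f a⟩
  have hflat' : ∀ a b, D a ∘ₗ D b - D b ∘ₗ D a = D (L.bracket a b) := fun a b => by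
    have h1 : IsDer (L.anchorSec (L.bracket a b)) (D a ∘ₗ D b - D b ∘ₗ D a) :=
      (hD a).commutator (hD b) (L.dirDeriv_anchor_bracket a b)
    exact h1.ext_of_isGen (hD _) fun x => ⟨U x, hU x, hxU x, g x, hg x, hflat x a b⟩
  exact ⟨{ D := LinearMap.mk₂ ℝ (fun a s => D a s)
             (fun a b s => by rw [hadd']; rfl) (fun c a s => by rw [hsmul']; rfl)
             (fun a s t => map_add _ _ _) (fun c a s => map_smul _ _ _)
           smul_left := fun f a s => by
             change D (f • a) s = _
             rw [hfsmul']
             rfl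
           leibniz := hD
           flat := fun a b s => congrArg (fun l => l s) (hflat' a b) }, fun _ _ => rfl⟩

/-- Two representations on a line bundle which agree on local generators are equal. -/
theorem Rep.ext_of_isGen {R R' : L.Rep T}
    (h : ∀ a x, ∃ U, IsOpen U ∧ x ∈ U ∧ ∃ g : T.sec, T.IsGen U g ∧
      (R.D a g).1 x = (R'.D a g).1 x) : R = R' := by
  ext a : 2
  exact (R.isDer a).ext_of_isGen (R'.isDer a) (h a)

theorem Rep.exists_isTensor {T' : SmoothFamily.{u, w} n M} (hT : T.LocallyLine)
    (hT' : T'.LocallyLine) (R : L.Rep T) (R' : L.Rep T') : ∃ R'', R.IsTensor R' R'' := by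
  choose D hD hDt using fun a => exists_isDer_tensor hT hT' (R.isDer a) (R'.isDer a)
  obtain ⟨R'', hR''⟩ := exists_rep D hD fun x => by
    obtain ⟨U₁, hU₁, hx₁, g, hg⟩ := hT x
    obtain ⟨U₂, hU₂, hx₂, g', hg'⟩ := hT' x
    refine ⟨U₁ ∩ U₂, hU₁.inter hU₂, ⟨hx₁, hx₂⟩, tmul g g',
      (hg.mono Set.inter_subset_left).tmul (hU₁.inter hU₂) (hg'.mono Set.inter_subset_right),
      fun a b => ?_, fun c a => ?_, fun f a => ?_, fun a b => ?_⟩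
    · have h1 : D (a + b) (tmul g g') = D a (tmul g g') + D b (tmul g g') := by
        rw [hDt, hDt, hDt, map_add, map_add, LinearMap.add_apply, LinearMap.add_apply, add_tmul,
          tmul_add]
        abel
      rw [h1]
      rfl
    · have h1 : D (c • a) (tmul g g') = c • D a (tmul g g') := by
        rw [hDt, hDt, map_smul, map_smul, LinearMap.smul_apply, LinearMap.smul_apply, smul_tmul,
          tmul_smul, smul_add]
      rw [h1]
      rfl
    · rw [hDt, hDt, R.smul_left, R'.smul_left]
      change (f x • (R.D a g).1 x) ⊗ₜ[ℝ] g'.1 x + g.1 x ⊗ₜ[ℝ] (f x • (R'.D a g').1 x) =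
        f x • ((R.D a g).1 x ⊗ₜ[ℝ] g'.1 x + g.1 x ⊗ₜ[ℝ] (R'.D a g').1 x)
      simp only [smul_add, TensorProduct.tmul_smul, TensorProduct.smul_tmul']
    · have h1 : D a (D b (tmul g g')) - D b (D a (tmul g g')) = D (L.bracket a b) (tmul g g') := by
        rw [hDt, hDt, hDt, map_add, map_add, hDt, hDt, hDt, hDt, ← R.flat, ← R'.flat, tmul_sub,
          sub_tmul]
        abel
      rw [← h1]
      rfl
  exact ⟨R'', fun a s t => by rw [hR'', hDt]⟩

theorem Rep.isTensor_unique {T' : SmoothFamily.{u, w} n M} (hT : T.LocallyLine)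
    (hT' : T'.LocallyLine) {R : L.Rep T} {R' : L.Rep T'} {R₁ R₂ : L.Rep (T.tensor T')}
    (h₁ : R.IsTensor R' R₁) (h₂ : R.IsTensor R' R₂) : R₁ = R₂ :=
  Rep.ext_of_isGen fun a x => by
    obtain ⟨U₁, hU₁, hx₁, g, hg⟩ := hT x
    obtain ⟨U₂, hU₂, hx₂, g', hg'⟩ := hT' x
    exact ⟨U₁ ∩ U₂, hU₁.inter hU₂, ⟨hx₁, hx₂⟩, tmul g g',
      (hg.mono Set.inter_subset_left).tmul (hU₁.inter hU₂) (hg'.mono Set.inter_subset_right),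
      by rw [h₁, h₂]⟩

/-- The operator `R.D a` is tensorial in `a`. -/
theorem Rep.apply_sum (R : L.Rep T) {ι : Type*} [Fintype ι] {U : Set M} {x : M} (hU : U ∈ 𝓝 x)
    {c : ι → M → ℝ} (hc : ∀ i, ∀ y ∈ U, SmoothAt n (c i) y) {e : ι → A.sec} {a : A.sec}
    (ha : ∀ y ∈ U, a.1 y = ∑ i, c i y • (e i).1 y) (s : T.sec) :
    (R.D a s).1 x = ∑ i, c i x • (R.D (e i) s).1 x := by
  choose g hg using fun i => exists_smooth_eventuallyEq hU (hc i)
  obtain ⟨f, hf1, hf⟩ := exists_bump (n := n) x (Filter.inter_mem hU (Filter.eventually_all.2 hg))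
  have h1 : f • a = ∑ i, (f * g i) • e i := by
    ext y
    rw [SmoothFamily.sum_apply]
    change f y • a.1 y = ∑ i, (f y * g i y) • (e i).1 y
    by_cases hy : y ∈ tsupport f
    · rw [ha y (hf hy).1, Finset.smul_sum]
      have h2 : ∀ i, g i y = c i y := (hf hy).2
      simp only [h2, smul_smul]
    · simp [image_eq_zero_of_notMem_tsupport hy]
  have h2 : (R.D (f • a) s).1 x = (R.D a s).1 x := by
    rw [R.smul_left]
    change f x • _ = _
    rw [hf1.self_of_nhds, one_smul]
  rw [← h2, h1, map_sum, LinearMap.sum_apply, SmoothFamily.sum_apply]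
  refine Finset.sum_congr rfl fun i _ => ?_
  rw [R.smul_left]
  change (f x * g i x) • _ = _
  rw [hf1.self_of_nhds, one_mul, (hg i).self_of_nhds]

/-- A nowhere-vanishing section `lam` of a line bundle with a representation has a characteristic
cocycle. -/
theorem Rep.exists_cocycle (hA : A.LocallyFree) (hT : T.LocallyLine) (R : L.Rep T) {lam : T.sec}
    (h0 : ∀ x, lam.1 x ≠ 0) :
    ∃ α : L.Cocycle, ∀ (a : A.sec) (x : M), (R.D a lam).1 x = pair α.1 x (a.1 x) • lam.1 x := by
  choose κ hκ hRκ using fun a => (hT.isGen_univ h0).exists_coeff (R.D a lam)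
  have hex : ∀ x : M, ∃ p : Dual ℝ (A.Fiber x), ∀ a : A.sec, p (a.1 x) = κ a x := by
    intro x
    obtain ⟨U, hU, hx, e, he⟩ := hA x
    obtain ⟨B, hB⟩ := he.exists_basis (by simp) hx
    refine ⟨B.constr ℝ fun i => κ (e i) x, fun a => ?_⟩
    obtain ⟨c, hc, hac⟩ := he.exists_coeff a
    have h1 := R.apply_sum (hU.mem_nhds hx) hc hac lam
    rw [hRκ a x (Set.mem_univ x)] at h1
    simp only [hRκ _ x (Set.mem_univ x), smul_smul] at h1
    rw [← Finset.sum_smul] at h1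
    rw [smul_left_injective ℝ (h0 x) h1, hac x hx, map_sum]
    refine Finset.sum_congr rfl fun i _ => ?_
    rw [map_smul, ← hB i, B.constr_basis, smul_eq_mul]
  choose p hp using hex
  have hmem : (fun x => p x) ∈ A.dual.sec := fun a ha => by
    have h1 : (fun x => p x (a x)) = κ ⟨a, ha⟩ := funext fun x => hp x ⟨a, ha⟩
    change ContMDiff (𝓡 n) 𝓘(ℝ, ℝ) ∞ (fun x => p x (a x))
    rw [h1]
    exact fun x => hκ _ x (Set.mem_univ x)
  have hpair : ∀ (a : A.sec) (x : M), pair (E := A) ⟨fun x => p x, hmem⟩ x (a.1 x) = κ a x :=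
    fun a x => hp x a
  refine ⟨⟨⟨fun x => p x, hmem⟩, fun a b x => ?_⟩, fun a x => ?_⟩
  · rw [hpair, funext fun y => hpair a y, funext fun y => hpair b y]
    have h1 : ∀ a b, (R.D a (R.D b lam)).1 x =
        (κ b x * κ a x + dirDeriv (κ b) x (L.anchor x (a.1 x))) • lam.1 x := fun a b => by
      rw [(R.isDer a).apply_smul Filter.univ_mem (hκ b) (hRκ b), hRκ a x (Set.mem_univ x), add_smul,
        smul_smul]
      rfl
    have h2 := congrFun (congrArg Subtype.val (R.flat a b lam)) x
    change (R.D a (R.D b lam)).1 x - (R.D b (R.D a lam)).1 x = _ at h2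
    rw [h1, h1, hRκ _ x (Set.mem_univ x), ← sub_smul] at h2
    have h3 := smul_left_injective ℝ (h0 x) h2
    linarith
  · rw [hRκ a x (Set.mem_univ x)]
    congr 1
    exact (hp x a).symm

/-- Characteristic cocycles for two nowhere-vanishing sections `lam` and `h lam` differ by the
differential of `log |h|`. -/
theorem Rep.cls_eq_of_isCharCocycle (hA : A.LocallyFree) (hT : T.LocallyLine) {R : L.Rep T}
    {α β : L.Cocycle} (hα : R.IsCharCocycle α) (hβ : R.IsCharCocycle β) : L.cls α = L.cls β := by
  obtain ⟨lam, h0, hlam⟩ := hα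
  obtain ⟨mu, h0', hmu⟩ := hβ
  obtain ⟨h, hh, hmul⟩ := (hT.isGen_univ h0).exists_coeff mu
  have hh0 : ∀ x, h x ≠ 0 := fun x hx => h0' x (by rw [hmul x (Set.mem_univ x), hx, zero_smul])
  have key : β - α ∈ L.coboundaries := by
    refine ⟨⟨fun x => Real.log (h x), fun x => smoothAt_log (hh x (Set.mem_univ x)) (hh0 x)⟩,
      fun x w => ?_⟩
    obtain ⟨a, rfl⟩ := hA.exists_sec_eq x w
    have h1 := (R.isDer a).apply_smul Filter.univ_mem hh hmul (x := x)
    rw [hmu, hmul x (Set.mem_univ x), hlam, smul_smul, smul_smul, ← add_smul] at h1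
    have h2 := smul_left_injective ℝ (h0 x) h1
    change pair β.1 x (a.1 x) - pair α.1 x (a.1 x) = dirDeriv (fun x => Real.log (h x)) x _
    rw [dirDeriv_log (hh x (Set.mem_univ x)) (hh0 x), eq_div_iff (hh0 x)]
    have h3 : dirDeriv h x ((L.anchorSec a).1 x) = dirDeriv h x (L.anchor x (a.1 x)) := rfl
    rw [← h3]
    linarith
  exact ((Submodule.Quotient.eq _).2 key).symm

/-- Orientable or not, the characteristic class is half the class of any characteristic cocycle of
the square of the representation. -/
theorem Rep.isCharClass_iff (hA : A.LocallyFree) (hT : T.LocallyLine) {R : L.Rep T}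
    {R' : L.Rep (T.tensor T)} (hR : R.IsTensor R R') {α' : L.Cocycle} (hα' : R'.IsCharCocycle α')
    (c : L.H1) : R.IsCharClass c ↔ c = (1 / 2 : ℝ) • L.cls α' := by
  have hTT : (T.tensor T).LocallyLine := hT.tensor hT
  have h1 : ∀ α, R.IsCharCocycle α → L.cls α = (1 / 2 : ℝ) • L.cls α' := fun α hα => by
    rw [← Rep.cls_eq_of_isCharCocycle hA hTT (hα.tensor hR) hα']
    have h2 : L.cls ((2 : ℝ) • α) = (2 : ℝ) • L.cls α := map_smul L.coboundaries.mkQ _ _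
    rw [h2, smul_smul]
    norm_num
  constructor
  · rintro (⟨α, hα, rfl⟩ | ⟨-, R'', hR'', α, hα, rfl⟩)
    · exact h1 α hα
    · rw [Rep.isTensor_unique hT hT hR'' hR] at hα
      rw [Rep.cls_eq_of_isCharCocycle hA hTT hα hα']
  · rintro rfl
    by_cases hor : ∃ lam : T.sec, ∀ x, lam.1 x ≠ 0
    · obtain ⟨lam, h0⟩ := hor
      obtain ⟨α, hα⟩ := R.exists_cocycle hA hT h0
      exact Or.inl ⟨α, ⟨lam, h0, hα⟩, (h1 α ⟨lam, h0, hα⟩).symm⟩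
    · exact Or.inr ⟨hor, R', hR, α', hα', rfl⟩

variable [SecondCountableTopology M]

theorem Rep.existsUnique_isCharClass (hA : A.LocallyFree) (hT : T.LocallyLine) (R : L.Rep T) :
    ∃! c, R.IsCharClass c := by
  obtain ⟨R', hR⟩ := R.exists_isTensor hT hT R
  obtain ⟨mu, h0⟩ := hT.exists_sec_tensor_ne_zero
  obtain ⟨α, hα⟩ := R'.exists_cocycle hA (hT.tensor hT) h0
  have h1 := R.isCharClass_iff hA hT hR ⟨mu, h0, hα⟩
  exact ⟨_, (h1 _).2 rfl, fun c hc => (h1 c).1 hc⟩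

theorem Rep.isCharClass_char (hA : A.LocallyFree) (hT : T.LocallyLine) (R : L.Rep T) :
    R.IsCharClass R.char :=
  Classical.epsilon_spec (R.existsUnique_isCharClass hA hT).exists

end LineReps

end LieAlgebroid

/-! ### The canonical representation and the modular class -/

namespace SmoothFamily

section WedgeDeriv

variable {n : ℕ} {M : Type u} [TopologicalSpace M] [ChartedSpace (EuclideanSpace ℝ (Fin n)) M]
  {E : SmoothFamily.{u, v} n M}

theorem wedge_update_apply (s : Fin E.rank → E.sec) (i : Fin E.rank) (t : E.sec) (x : M) :
    (wedge (Function.update s i t)).1 x = exteriorPower.ιMulti ℝ E.rank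
      (Function.update (fun j => (s j).1 x) i (t.1 x)) := by
  change exteriorPower.ιMulti ℝ E.rank (fun j => (Function.update s i t j).1 x) = _
  congr 1
  funext j
  by_cases hj : j = i
  · subst hj
    simp
  · simp [hj]

theorem wedge_update_sub (s : Fin E.rank → E.sec) (i : Fin E.rank) (t t' : E.sec) :
    wedge (Function.update s i (t - t')) =
      wedge (Function.update s i t) - wedge (Function.update s i t') := by
  ext x : 2
  change _ = (wedge (Function.update s i t)).1 x - (wedge (Function.update s i t')).1 x
  simp only [wedge_update_apply]
  exact (exteriorPower.ιMulti ℝ E.rank).map_update_sub _ _ _ _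

theorem wedge_update_add (s : Fin E.rank → E.sec) (i : Fin E.rank) (t t' : E.sec) :
    wedge (Function.update s i (t + t')) =
      wedge (Function.update s i t) + wedge (Function.update s i t') := by
  ext x : 2
  change _ = (wedge (Function.update s i t)).1 x + (wedge (Function.update s i t')).1 x
  simp only [wedge_update_apply]
  exact (exteriorPower.ιMulti ℝ E.rank).map_update_add _ _ _ _

theorem wedge_update_smul (s : Fin E.rank → E.sec) (i : Fin E.rank) (c : ℝ) (t : E.sec) :
    wedge (Function.update s i (c • t)) = c • wedge (Function.update s i t) := by
  ext x : 2
  change _ = c • (wedge (Function.update s i t)).1 x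
  simp only [wedge_update_apply]
  exact (exteriorPower.ιMulti ℝ E.rank).map_update_smul _ _ _ _

theorem wedgeDeriv_add (D D' : E.sec →ₗ[ℝ] E.sec) (s : Fin E.rank → E.sec) :
    wedgeDeriv (D + D') s = wedgeDeriv D s + wedgeDeriv D' s := by
  simp only [wedgeDeriv, LinearMap.add_apply, wedge_update_add, Finset.sum_add_distrib]

theorem wedgeDeriv_const_smul (c : ℝ) (D : E.sec →ₗ[ℝ] E.sec) (s : Fin E.rank → E.sec) :
    wedgeDeriv (c • D) s = c • wedgeDeriv D s := by
  simp only [wedgeDeriv, LinearMap.smul_apply, wedge_update_smul, Finset.smul_sum]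

/-- The wedge derivative of the sum of a multiple of an operator and of an operator of rank one:
the latter contributes its trace. -/
theorem wedgeDeriv_apply_rankOne {D D₁ : E.sec → E.sec} {e : Fin E.rank → E.sec} {x : M} (r : ℝ)
    (φ c : Fin E.rank → ℝ) (w : E.Fiber x) (hw : w = ∑ i, c i • (e i).1 x)
    (h : ∀ i, (D (e i)).1 x = r • (D₁ (e i)).1 x + φ i • w) :
    (wedgeDeriv D e).1 x = r • (wedgeDeriv D₁ e).1 x + (∑ i, φ i * c i) • (wedge e).1 x := by
  have h1 := AlternatingMap.sum_update_eq_trace (exteriorPower.ιMulti ℝ E.rank)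
    (fun i j => φ i * c j) (fun i => (e i).1 x) (fun i => φ i • w)
    (fun i => by rw [hw, Finset.smul_sum]; simp only [smul_smul])
  change _ = _ + _ • exteriorPower.ιMulti ℝ E.rank fun i => (e i).1 x
  rw [← h1, wedgeDeriv_apply, wedgeDeriv_apply, Finset.smul_sum, ← Finset.sum_add_distrib]
  refine Finset.sum_congr rfl fun i _ => ?_
  rw [h, AlternatingMap.map_update_add, AlternatingMap.map_update_smul]

/-- The extensions of `D` and `D'` to the top exterior power have as commutator the extension of the
commutator of `D` and `D'`: the terms in which `D` and `D'` hit different factors cancel. -/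
theorem wedgeDeriv_commutator {D D' D'' : E.sec →ₗ[ℝ] E.sec} {T T' : E.top.sec →ₗ[ℝ] E.top.sec}
    (hT : ∀ s, T (wedge s) = wedgeDeriv D s) (hT' : ∀ s, T' (wedge s) = wedgeDeriv D' s)
    (h : ∀ s, D (D' s) - D' (D s) = D'' s) (s : Fin E.rank → E.sec) :
    T (T' (wedge s)) - T' (T (wedge s)) = wedgeDeriv D'' s := by
  have key : ∀ {D D' : E.sec →ₗ[ℝ] E.sec} {T T' : E.top.sec →ₗ[ℝ] E.top.sec},
      (∀ s, T (wedge s) = wedgeDeriv D s) → (∀ s, T' (wedge s) = wedgeDeriv D' s) →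
      T (T' (wedge s)) = ∑ i, (wedge (Function.update s i (D (D' (s i)))) +
        ∑ j ∈ Finset.univ.erase i,
          wedge (Function.update (Function.update s i (D' (s i))) j (D (s j)))) := by
    intro D D' T T' hT hT'
    rw [hT', wedgeDeriv, map_sum]
    refine Finset.sum_congr rfl fun i _ => ?_
    rw [hT, wedgeDeriv, ← Finset.add_sum_erase _ _ (Finset.mem_univ i)]
    simp only [Function.update_self, Function.update_idem]
    congr 1
    refine Finset.sum_congr rfl fun j hj => ?_
    rw [Function.update_of_ne (Finset.ne_of_mem_erase hj)]
  have hcomm : ∀ i j, ∀ a b : E.sec, i ≠ j → Function.update (Function.update s i a) j b =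
      Function.update (Function.update s j b) i a := fun i j a b hij =>
    (Function.update_comm hij _ _ _)
  have hswap : ∑ i, ∑ j ∈ Finset.univ.erase i,
        wedge (Function.update (Function.update s i (D' (s i))) j (D (s j))) =
      ∑ i, ∑ j ∈ Finset.univ.erase i,
        wedge (Function.update (Function.update s i (D (s i))) j (D' (s j))) := by
    rw [Finset.sum_comm' (t' := Finset.univ) (s' := fun i => Finset.univ.erase i) (by
      intro i j
      simp [eq_comm])]
    refine Finset.sum_congr rfl fun i _ => Finset.sum_congr rfl fun j hj => ?_
    rw [hcomm _ _ _ _ (Finset.ne_of_mem_erase hj)]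
  rw [key hT hT', key hT' hT, Finset.sum_add_distrib, Finset.sum_add_distrib, hswap]
  refine (add_sub_add_right_eq_sub (G := E.top.sec) _ _ _).trans ?_
  refine (Finset.sum_sub_distrib
    (fun i => wedge (Function.update s i (D (D' (s i))))) _).symm.trans ?_
  rw [wedgeDeriv]
  refine Finset.sum_congr rfl fun i _ => ?_
  rw [← wedge_update_sub, h]

end WedgeDeriv

section LieDerivative

variable {n : ℕ} {M : Type u} [TopologicalSpace M] [ChartedSpace (EuclideanSpace ℝ (Fin n)) M]

theorem dirDeriv_sub_at {f g : M → ℝ} {x : M} (hf : SmoothAt n f x) (hg : SmoothAt n g x)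
    (v : TangentSpace (𝓡 n) x) :
    dirDeriv (fun y => f y - g y) x v = dirDeriv f x v - dirDeriv g x v :=
  congrArg (fun L => L v) (mfderiv_sub hf.mdifferentiableAt' hg.mdifferentiableAt')

/-- A section of the dual is determined by its pairings with sections. -/
theorem dual_ext {E : SmoothFamily.{u, v} n M} (hE : E.LocallyFree) {ξ η : E.dual.sec}
    (h : ∀ (s : E.sec) (x : M), pair ξ x (s.1 x) = pair η x (s.1 x)) : ξ = η := by
  ext x
  refine LinearMap.ext (f := (show Dual ℝ (E.Fiber x) from ξ.1 x)) (g := η.1 x) fun w => ?_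
  obtain ⟨s, rfl⟩ := hE.exists_sec_eq x w
  exact h s x

variable [IsManifold (𝓡 n) ∞ M]

/-- The differential of a function. -/
def differential (f : C^∞⟮𝓡 n, M; ℝ⟯) : (tangent n M).dual.sec :=
  ⟨fun x => (mfderiv (𝓡 n) 𝓘(ℝ, ℝ) f x).toLinearMap, fun X hX => contMDiff_dirDeriv f ⟨X, hX⟩⟩

variable [T2Space M]

theorem locallyFree_tangent : (tangent n M).LocallyFree := by
  have h1 : IsManifold (𝓡 n) ((⊤ : ℕ∞) + 1) M := ‹IsManifold (𝓡 n) ∞ M›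
  have h2 : IsManifold (𝓡 n) 1 M := IsManifold.of_le (n := ∞) (by simp)
  have h3 : ContMDiffVectorBundle ∞ (EuclideanSpace ℝ (Fin n))
    (fun x : M => TangentSpace (𝓡 n) x) (𝓡 n) := TangentBundle.contMDiffVectorBundle
  exact locallyFree_ofBundle

/-- The Lie derivative of `1`-forms along a vector field. -/
def lieForm (X : (tangent n M).sec) : (tangent n M).dual.sec →ₗ[ℝ] (tangent n M).dual.sec :=
  (exists_isDer_dual locallyFree_tangent (isDer_lieBracketVF X)).choose

theorem isDer_lieForm (X : (tangent n M).sec) : IsDer X (lieForm X) :=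
  (exists_isDer_dual locallyFree_tangent (isDer_lieBracketVF X)).choose_spec.1

theorem pair_lieForm (X : (tangent n M).sec) (ξ : (tangent n M).dual.sec) (Y : (tangent n M).sec)
    (x : M) : pair (lieForm X ξ) x (Y.1 x) = dirDeriv (fun y => pair ξ y (Y.1 y)) x (X.1 x) -
      pair ξ x ((lieBracketVF X Y).1 x) :=
  (exists_isDer_dual locallyFree_tangent (isDer_lieBracketVF X)).choose_spec.2 ξ Y x

theorem isLieDerivative_iff {X : (tangent n M).sec} {ξ η : (tangent n M).dual.sec} :
    LieAlgebroid.IsLieDerivative X ξ η ↔ η = lieForm X ξ := by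
  constructor
  · intro h
    refine dual_ext locallyFree_tangent fun Y x => ?_
    rw [pair_lieForm, h Y x]
    rfl
  · rintro rfl Y x
    exact pair_lieForm X ξ Y x

theorem lieForm_add (X Y : (tangent n M).sec) : lieForm (X + Y) = lieForm X + lieForm Y := by
  ext1 ξ
  refine dual_ext locallyFree_tangent fun Z x => ?_
  rw [LinearMap.add_apply, pair_add, pair_lieForm, pair_lieForm, pair_lieForm, map_add]
  change dirDeriv _ x (X.1 x + Y.1 x) -
    pair ξ x ((lieBracketVF X Z).1 x + (lieBracketVF Y Z).1 x) = _
  rw [dirDeriv_vadd, pair_vadd]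
  ring

theorem lieForm_smul (c : ℝ) (X : (tangent n M).sec) : lieForm (c • X) = c • lieForm X := by
  ext1 ξ
  refine dual_ext locallyFree_tangent fun Z x => ?_
  rw [LinearMap.smul_apply, pair_smul, pair_lieForm, pair_lieForm, map_smul]
  change dirDeriv _ x (c • X.1 x) - pair ξ x (c • (lieBracketVF X Z).1 x) = _
  rw [dirDeriv_vsmul, pair_vsmul]
  ring

theorem lieForm_commutator (X Y : (tangent n M).sec) (ξ : (tangent n M).dual.sec) :
    lieForm X (lieForm Y ξ) - lieForm Y (lieForm X ξ) = lieForm (lieBracketVF X Y) ξ := by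
  refine dual_ext locallyFree_tangent fun Z x => ?_
  let f : C^∞⟮𝓡 n, M; ℝ⟯ := ⟨fun y => pair ξ y (Z.1 y), contMDiff_pair ξ Z⟩
  have hd : ∀ X Y : (tangent n M).sec, pair (lieForm X (lieForm Y ξ)) x (Z.1 x) =
      dirDeriv (derivAlong Y f) x (X.1 x) -
        dirDeriv (fun y => pair ξ y ((lieBracketVF Y Z).1 y)) x (X.1 x) -
        (dirDeriv (fun y => pair ξ y ((lieBracketVF X Z).1 y)) x (Y.1 x) -
          pair ξ x ((lieBracketVF Y (lieBracketVF X Z)).1 x)) := fun X Y => by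
    rw [pair_lieForm, pair_lieForm, funext fun y => pair_lieForm Y ξ Z y]
    congr 1
    exact dirDeriv_sub_at (contMDiff_dirDeriv f Y x) (contMDiff_pair ξ (lieBracketVF Y Z) x) _
  have h1 : pair (lieForm X (lieForm Y ξ) - lieForm Y (lieForm X ξ)) x (Z.1 x) =
      pair (lieForm X (lieForm Y ξ)) x (Z.1 x) - pair (lieForm Y (lieForm X ξ)) x (Z.1 x) := rfl
  have h2 : (lieBracketVF (lieBracketVF X Y) Z).1 x =
      (lieBracketVF X (lieBracketVF Y Z)).1 x - (lieBracketVF Y (lieBracketVF X Z)).1 x := by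
    rw [lieBracketVF_jacobi X Y Z]
    exact (add_sub_cancel_right _ _).symm
  rw [h1, hd, hd, pair_lieForm, h2, pair_vsub]
  change _ = dirDeriv f x _ - _
  rw [dirDeriv_lieBracketVF]
  ring

theorem lieForm_smul_apply (f : C^∞⟮𝓡 n, M; ℝ⟯) {X X' : (tangent n M).sec}
    (h : ∀ x, X'.1 x = f x • X.1 x) (ξ : (tangent n M).dual.sec) (x : M) :
    (lieForm X' ξ).1 x = f x • (lieForm X ξ).1 x + pair ξ x (X.1 x) • (differential f).1 x := by
  have hX : X' = ⟨fun x => f x • X.1 x, (tangent n M).smul_mem f X.1 X.2⟩ :=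
    Subtype.ext (funext h)
  refine LinearMap.ext (f := (show Dual ℝ (TangentSpace (𝓡 n) x) from (lieForm X' ξ).1 x))
    fun w => ?_
  obtain ⟨Z, rfl⟩ := locallyFree_tangent.exists_sec_eq x w
  change pair (lieForm X' ξ) x (Z.1 x) = f x * pair (lieForm X ξ) x (Z.1 x) +
    pair ξ x (X.1 x) * dirDeriv f x (Z.1 x)
  have h1 : (lieBracketVF X' Z).1 x =
      f x • (lieBracketVF X Z).1 x - dirDeriv f x (Z.1 x) • X.1 x := by
    have h2 := isDer_lieBracketVF Z f X x
    rw [lieBracketVF_swap X' Z, lieBracketVF_swap X Z, hX]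
    change -_ = f x • -(lieBracketVF Z X).1 x - _
    refine (congrArg Neg.neg h2).trans ?_
    module
  rw [pair_lieForm, pair_lieForm, h1, h x, pair_vsub, pair_vsmul, pair_vsmul, dirDeriv_vsmul]
  ring

end LieDerivative

end SmoothFamily

namespace LieAlgebroid

open SmoothFamily

section Canonical

variable {n : ℕ} {M : Type u} [TopologicalSpace M] [ChartedSpace (EuclideanSpace ℝ (Fin n)) M]
  [IsManifold (𝓡 n) ∞ M]
  {A : SmoothFamily.{u, v} n M} {L : LieAlgebroid A} {E : SmoothFamily.{u, w} n M}

theorem bracket_smul_left_apply (L : LieAlgebroid A) (f : C^∞⟮𝓡 n, M; ℝ⟯) (a s : A.sec) (x : M) :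
    (L.bracket (f • a) s).1 x =
      f x • (L.bracket a s).1 x + (-dirDeriv f x (L.anchor x (s.1 x))) • a.1 x := by
  rw [L.bracket_skew (f • a), L.bracket_skew a]
  change -(L.bracket s (f • a)).1 x = f x • -(L.bracket s a).1 x + _
  rw [L.leibniz]
  module

variable [T2Space M]

/-- A representation extends as a derivation to the top exterior power. -/
theorem Rep.exists_isTop (hE : E.LocallyFree) (R : L.Rep E) : ∃ R', R.IsTop R' := by
  choose T hT hTw using fun a => exists_isDer_top hE (R.isDer a)
  obtain ⟨R', hR'⟩ := exists_rep T hT fun x => by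
    obtain ⟨U, hU, hx, e, he⟩ := hE x
    refine ⟨U, hU, hx, wedge e, he.isGen_wedge hU, fun a b => ?_, fun c a => ?_, fun f a => ?_,
      fun a b => ?_⟩
    · rw [hTw, hTw, hTw, map_add, wedgeDeriv_add]
      rfl
    · rw [hTw, hTw, map_smul, wedgeDeriv_const_smul]
      rfl
    · rw [hTw, hTw]
      have h := wedgeDeriv_apply_rankOne (D := R.D (f • a)) (D₁ := R.D a) (e := e) (x := x) (f x)
        0 0 0 (by simp) fun i => by
          rw [R.smul_left, smul_zero, add_zero]
          rfl
      simpa using h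
    · rw [hTw (L.bracket a b), ← wedgeDeriv_commutator (hTw a) (hTw b) (R.flat a b)]
      rfl
  exact ⟨R', fun a s => by rw [hR', hTw]⟩

theorem Rep.isTop_unique (hE : E.LocallyFree) {R : L.Rep E} {R₁ R₂ : L.Rep E.top}
    (h₁ : R.IsTop R₁) (h₂ : R.IsTop R₂) : R₁ = R₂ :=
  Rep.ext_of_isGen fun a x => by
    obtain ⟨U, hU, hx, e, he⟩ := hE x
    exact ⟨U, hU, hx, wedge e, he.isGen_wedge hU, by rw [h₁, h₂]⟩

/-- The canonical representation on `⋀^top A ⊗ ⋀^top T^*M` exists. The failure of `[a, ·]` and of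
the Lie derivative to be linear over the functions in `a` has opposite traces on the two factors. -/
theorem exists_isCanonicalRep (hA : A.LocallyFree) (L : LieAlgebroid A) :
    ∃ R, L.IsCanonicalRep R := by
  have hTM : (tangent n M).dual.LocallyFree := locallyFree_tangent.dual
  choose T hT hTw using fun a => exists_isDer_top hA (L.isDer_bracket a)
  choose S hS hSw using fun a => exists_isDer_top hTM (isDer_lieForm (L.anchorSec a))
  choose D hD hDt using fun a => exists_isDer_tensor hA.top hTM.top (hT a) (hS a)
  obtain ⟨R, hR⟩ := exists_rep D hD fun x => by
    obtain ⟨U₁, hU₁, hx₁, e, he⟩ := hA x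
    obtain ⟨U₂, hU₂, hx₂, ξ, hξ⟩ := hTM x
    refine ⟨U₁ ∩ U₂, hU₁.inter hU₂, ⟨hx₁, hx₂⟩, tmul (wedge e) (wedge ξ),
      ((he.isGen_wedge hU₁).mono Set.inter_subset_left).tmul (hU₁.inter hU₂)
        ((hξ.isGen_wedge hU₂).mono Set.inter_subset_right),
      fun a b => ?_, fun c a => ?_, fun f a => ?_, fun a b => ?_⟩
    · have h1 : L.anchorSec (a + b) = L.anchorSec a + L.anchorSec b := by
        ext x : 2
        exact map_add (L.anchor x) _ _
      have h2 : D (a + b) (tmul (wedge e) (wedge ξ)) =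
          D a (tmul (wedge e) (wedge ξ)) + D b (tmul (wedge e) (wedge ξ)) := by
        rw [hDt, hDt, hDt, hTw, hTw, hTw, hSw, hSw, hSw, h1, lieForm_add, map_add, wedgeDeriv_add,
          wedgeDeriv_add, add_tmul, tmul_add]
        abel
      rw [h2]
      rfl
    · have h1 : L.anchorSec (c • a) = c • L.anchorSec a := by
        ext x : 2
        exact map_smul (L.anchor x) _ _
      have h2 : D (c • a) (tmul (wedge e) (wedge ξ)) = c • D a (tmul (wedge e) (wedge ξ)) := by
        rw [hDt, hDt, hTw, hTw, hSw, hSw, h1, lieForm_smul, map_smul, wedgeDeriv_const_smul,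
          wedgeDeriv_const_smul, smul_tmul, tmul_smul, smul_add]
      rw [h2]
      rfl
    · obtain ⟨c, -, hc⟩ := he.exists_coeff a
      obtain ⟨d, -, hd⟩ := hξ.exists_coeff (differential f)
      have h1 : (T (f • a) (wedge e)).1 x = f x • (T a (wedge e)).1 x +
          (-dirDeriv f x (L.anchor x (a.1 x))) • (wedge e).1 x := by
        rw [hTw, hTw, wedgeDeriv_apply_rankOne (f x) _ _ _ (hc x hx₁)
          fun i => L.bracket_smul_left_apply f a (e i) x]
        congr 2
        conv_rhs => rw [hc x hx₁, map_sum, dirDeriv_vsum]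
        rw [← Finset.sum_neg_distrib]
        refine Finset.sum_congr rfl fun i _ => ?_
        rw [map_smul, dirDeriv_vsmul]
        ring
      have h2 : (S (f • a) (wedge ξ)).1 x = f x • (S a (wedge ξ)).1 x +
          dirDeriv f x (L.anchor x (a.1 x)) • (wedge ξ).1 x := by
        rw [hSw, hSw, wedgeDeriv_apply_rankOne (f x) _ _ _ (hd x hx₂)
          fun i => lieForm_smul_apply f (X := L.anchorSec a) (X' := L.anchorSec (f • a))
            (fun y => map_smul (L.anchor y) (f y) (a.1 y)) (ξ i) x]
        congr 2
        change _ = pair (differential f) x ((L.anchorSec a).1 x)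
        have h3 : pair (differential f) x ((L.anchorSec a).1 x) =
            ∑ i, d i x * pair (ξ i) x ((L.anchorSec a).1 x) := by
          have h4 := congrArg (fun l : Dual ℝ (TangentSpace (𝓡 n) x) => l ((L.anchorSec a).1 x))
            (hd x hx₂)
          refine h4.trans ?_
          refine (LinearMap.sum_apply _ _ _).trans ?_
          rfl
        rw [h3]
        exact Finset.sum_congr rfl fun i _ => mul_comm _ _
      rw [hDt, hDt]
      change (T (f • a) (wedge e)).1 x ⊗ₜ[ℝ] (wedge ξ).1 x +
          (wedge e).1 x ⊗ₜ[ℝ] (S (f • a) (wedge ξ)).1 x =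
        f x • ((T a (wedge e)).1 x ⊗ₜ[ℝ] (wedge ξ).1 x + (wedge e).1 x ⊗ₜ[ℝ] (S a (wedge ξ)).1 x)
      rw [h1, h2]
      simp only [TensorProduct.add_tmul, TensorProduct.tmul_add, TensorProduct.tmul_smul,
        ← TensorProduct.smul_tmul']
      module
    · have h1 := wedgeDeriv_commutator (hTw a) (hTw b) (fun s =>
        sub_eq_of_eq_add (L.jacobi a b s)) e
      have h3 : L.anchorSec (L.bracket a b) = lieBracketVF (L.anchorSec a) (L.anchorSec b) := by
        ext x : 2
        exact L.anchor_bracket a b x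
      have h2 := wedgeDeriv_commutator (hSw a) (hSw b) (fun ξ => lieForm_commutator _ _ ξ) ξ
      have h4 : D a (D b (tmul (wedge e) (wedge ξ))) - D b (D a (tmul (wedge e) (wedge ξ))) =
          D (L.bracket a b) (tmul (wedge e) (wedge ξ)) := by
        rw [hDt (L.bracket a b), hTw, hSw, h3, ← h1, ← h2, tmul_sub, sub_tmul]
        rw [hDt, hDt, map_add, map_add, hDt, hDt, hDt, hDt]
        abel
      rw [← h4]
      rfl
  refine ⟨R, fun a => ⟨lieForm (L.anchorSec a), fun ξ => isLieDerivative_iff.2 rfl, fun s ξ => ?_⟩⟩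
  rw [hR, hDt, hTw, hSw]

theorem IsCanonicalRep.apply {L : LieAlgebroid A} {R : L.Rep (modularLine A)}
    (h : L.IsCanonicalRep R) (a : A.sec) (s : Fin A.rank → A.sec)
    (ξ : Fin (tangent n M).dual.rank → (tangent n M).dual.sec) :
    R.D a (tmul (wedge s) (wedge ξ)) = tmul (wedgeDeriv (L.bracket a) s) (wedge ξ) +
      tmul (wedge s) (wedgeDeriv (lieForm (L.anchorSec a)) ξ) := by
  obtain ⟨lie, hlie, hR⟩ := h a
  rw [hR, funext fun ξ => isLieDerivative_iff.1 (hlie ξ)]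

theorem IsCanonicalRep.unique (hA : A.LocallyFree) {L : LieAlgebroid A}
    {R R' : L.Rep (modularLine A)} (h : L.IsCanonicalRep R) (h' : L.IsCanonicalRep R') : R = R' :=
  Rep.ext_of_isGen fun a x => by
    obtain ⟨U₁, hU₁, hx₁, e, he⟩ := hA x
    obtain ⟨U₂, hU₂, hx₂, ξ, hξ⟩ := (locallyFree_tangent (n := n)).dual x
    exact ⟨U₁ ∩ U₂, hU₁.inter hU₂, ⟨hx₁, hx₂⟩, tmul (wedge e) (wedge ξ),
      ((he.isGen_wedge hU₁).mono Set.inter_subset_left).tmul (hU₁.inter hU₂)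
        ((hξ.isGen_wedge hU₂).mono Set.inter_subset_right), by rw [h.apply, h'.apply]⟩

theorem locallyLine_modularLine (hA : A.LocallyFree) : (modularLine A).LocallyLine :=
  hA.top.tensor locallyFree_tangent.dual.top

theorem isModularClass_iff (hA : A.LocallyFree) {L : LieAlgebroid A} {R : L.Rep (modularLine A)}
    (hR : L.IsCanonicalRep R) (c : L.H1) : L.IsModularClass c ↔ R.IsCharClass c := by
  constructor
  · rintro ⟨R', hR', hc⟩
    rwa [hR.unique hA hR']
  · exact fun hc => ⟨R, hR, hc⟩

variable [SecondCountableTopology M]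

theorem existsUnique_isModularClass (hA : A.LocallyFree) (L : LieAlgebroid A) :
    ∃! c, L.IsModularClass c := by
  obtain ⟨R, hR⟩ := L.exists_isCanonicalRep hA
  simp only [isModularClass_iff hA hR]
  exact R.existsUnique_isCharClass hA (locallyLine_modularLine hA)

theorem isModularClass_modularClass (hA : A.LocallyFree) (L : LieAlgebroid A) :
    L.IsModularClass L.modularClass :=
  Classical.epsilon_spec (L.existsUnique_isModularClass hA).exists

end Canonical

end LieAlgebroid

/-! ### The induced representations of the image -/

namespace LieAlgebroid

open SmoothFamily

section Unimodular

variable {n : ℕ} {M : Type u} [TopologicalSpace M] [ChartedSpace (EuclideanSpace ℝ (Fin n)) M]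
  [IsManifold (𝓡 n) ∞ M] [T2Space M]
  {A : SmoothFamily.{u, v} n M} {L : LieAlgebroid A} {T : SmoothFamily.{u, w} n M}

/-- If the square of a representation annihilates a nowhere-vanishing section, the representation
annihilates local generators on which the anchor acts trivially. -/
theorem Rep.apply_eq_zero_of_isTensor {R : L.Rep T} {R' : L.Rep (T.tensor T)}
    (hR : R.IsTensor R R') (hT : T.LocallyLine) {mu : (T.tensor T).sec} (h0 : ∀ x, mu.1 x ≠ 0)
    {a : A.sec} (ha : ∀ x, L.anchor x (a.1 x) = 0) (hmu : R'.D a mu = 0) {U : Set M}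
    {g : T.sec} (hg : T.IsGen U g) {x : M} (hx : x ∈ U) : (R.D a g).1 x = 0 := by
  obtain ⟨c, hc, hgc⟩ := ((hT.tensor hT).isGen_univ h0).exists_coeff (tmul g g)
  obtain ⟨κ, -, hκ⟩ := hg.exists_coeff (R.D a g)
  have h1 := (R'.isDer a).apply_smul Filter.univ_mem hc hgc (x := x)
  have h2 : (L.anchorSec a).1 x = 0 := ha x
  rw [hmu, h2, dirDeriv_vzero, hR] at h1
  have h3 : (2 * κ x) • (g.1 x ⊗ₜ[ℝ] g.1 x) = 0 := by
    have h4 : (R.D a g).1 x ⊗ₜ[ℝ] g.1 x + g.1 x ⊗ₜ[ℝ] (R.D a g).1 x = 0 := by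
      refine Eq.trans h1 ?_
      rw [zero_smul, add_zero]
      exact smul_zero _
    rw [← h4, hκ x hx, TensorProduct.tmul_smul, ← TensorProduct.smul_tmul']
    module
  rcases smul_eq_zero.1 h3 with h4 | h4
  · rw [hκ x hx, (mul_eq_zero.1 h4).resolve_left two_ne_zero, zero_smul]
  · exact absurd h4 (tmul_ne_zero_of_ne_zero (hg.ne_zero hx) (hg.ne_zero hx))

variable [SecondCountableTopology M]

/-- In a unimodular Lie algebroid with zero anchor, the operators `[a, ·]` are trace-free: the
`1`-coboundaries vanish, so the canonical representation is trivial. -/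
theorem IsUnimodular.wedgeDeriv_bracket_eq_zero (hA : A.LocallyFree) (hL : L.IsUnimodular)
    (h0 : ∀ x, L.anchor x = 0) (a : A.sec) {U : Set M} (hU : IsOpen U) {e : Fin A.rank → A.sec}
    (he : A.IsFrameOn U e) {x : M} (hx : x ∈ U) : (wedgeDeriv (L.bracket a) e).1 x = 0 := by
  obtain ⟨R, hR, hc⟩ := hL
  have hline := locallyLine_modularLine (n := n) hA
  obtain ⟨R', hR'⟩ := R.exists_isTensor hline hline R
  obtain ⟨mu, hmu0⟩ := hline.exists_sec_tensor_ne_zero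
  obtain ⟨α, hα⟩ := R'.exists_cocycle hA (hline.tensor hline) hmu0
  rw [R.isCharClass_iff hA hline hR' ⟨mu, hmu0, hα⟩, eq_comm, smul_eq_zero,
    or_iff_right (by norm_num)] at hc
  obtain ⟨f, hf⟩ := (Submodule.Quotient.mk_eq_zero _).1 hc
  have ha : ∀ x, L.anchor x (a.1 x) = 0 := fun x => by rw [h0, LinearMap.zero_apply]
  have hmu : R'.D a mu = 0 := by
    ext x
    refine (hα a x).trans ?_
    rw [hf, ha, dirDeriv_vzero, zero_smul]
    rfl
  obtain ⟨U', hU', hx', ξ, hξ⟩ := (locallyFree_tangent (n := n)).dual x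
  have h1 := R.apply_eq_zero_of_isTensor hR' hline hmu0 ha hmu
    (((he.isGen_wedge hU).mono Set.inter_subset_left).tmul (hU.inter hU')
        ((hξ.isGen_wedge hU').mono Set.inter_subset_right)) ⟨hx, hx'⟩
  have h2 : lieForm (L.anchorSec a) = 0 := by
    have h3 : L.anchorSec a = (0 : ℝ) • L.anchorSec a := by
      rw [zero_smul]
      ext x : 2
      exact ha x
    rw [h3, lieForm_smul, zero_smul]
  have h3 : (wedgeDeriv (lieForm (L.anchorSec a)) ξ).1 x = 0 := by
    rw [h2, wedgeDeriv_eq_trace _ ξ x 0 fun i => by simp]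
    simp
  rw [hR.apply] at h1
  change (wedgeDeriv (L.bracket a) e).1 x ⊗ₜ[ℝ] (wedge ξ).1 x +
    (wedge e).1 x ⊗ₜ[ℝ] (wedgeDeriv (lieForm (L.anchorSec a)) ξ).1 x = 0 at h1
  rw [h3, TensorProduct.tmul_zero, add_zero] at h1
  by_contra h4
  exact tmul_ne_zero_of_ne_zero h4 ((hξ.isGen_wedge hU').ne_zero hx') h1

end Unimodular

section Descent

universe w'

variable {n : ℕ} {M : Type u} [TopologicalSpace M] [ChartedSpace (EuclideanSpace ℝ (Fin n)) M]
  [IsManifold (𝓡 n) ∞ M]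
  {A : SmoothFamily.{u, v} n M} {A' : SmoothFamily.{u, w} n M} {L : LieAlgebroid A}
  {L' : LieAlgebroid A'} {T : SmoothFamily.{u, w'} n M}

/-- A representation descends along a morphism which is surjective on sections if it is trivial on
the sections of the kernel. -/
theorem Hom.exists_rep_of_surjective (Φ : L.Hom L') (hΦ : Function.Surjective Φ.onSec)
    (R : L.Rep T) (h : ∀ X, Φ.onSec X = 0 → R.D X = 0) :
    ∃ R' : L'.Rep T, ∀ X s, R'.D (Φ.onSec X) s = R.D X s := by
  have key : ∀ X X', Φ.onSec X = Φ.onSec X' → R.D X = R.D X' := fun X X' hX => by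
    exact sub_eq_zero.1 ((map_sub R.D X X').symm.trans (h _ (by rw [map_sub, hX, sub_self])))
  choose l hl using hΦ
  have hfsmul : ∀ (f : C^∞⟮𝓡 n, M; ℝ⟯) X, Φ.onSec (f • X) = f • Φ.onSec X := fun f X => by
    ext x
    exact map_smul (Φ.map x) _ _
  refine ⟨{ D := LinearMap.mk₂ ℝ (fun Y s => R.D (l Y) s)
              (fun Y Y' s => by
                rw [key (l (Y + Y')) (l Y + l Y') (by rw [hl, map_add, hl, hl]), map_add]
                rfl)
              (fun c Y s => by
                rw [key (l (c • Y)) (c • l Y) (by rw [hl, map_smul, hl]), map_smul]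
                rfl)
              (fun Y s t => map_add _ _ _) (fun c Y s => map_smul _ _ _)
            smul_left := fun f Y s => ?_
            leibniz := fun Y f s x => ?_
            flat := fun Y Y' s => ?_ }, fun X s => ?_⟩
  · change R.D (l (f • Y)) s = f • R.D (l Y) s
    rw [key (l (f • Y)) (f • l Y) (by rw [hl, hfsmul, hl]), R.smul_left]
  · have h1 : L'.anchor x (Y.1 x) = L.anchor x ((l Y).1 x) := by
      rw [← Φ.anchor_map, ← show (Φ.onSec (l Y)).1 x = Φ.map x ((l Y).1 x) from rfl, hl]
    rw [h1]
    exact R.leibniz (l Y) f s x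
  · change R.D (l Y) (R.D (l Y') s) - R.D (l Y') (R.D (l Y) s) = R.D (l (L'.bracket Y Y')) s
    rw [key (l (L'.bracket Y Y')) (L.bracket (l Y) (l Y'))
      (by rw [hl, Φ.onSec_bracket, hl, hl]), R.flat]
  · exact congrArg (fun l => l s) (key _ _ (hl _))

/-- The bracket induces a representation of a Lie subalgebroid on the quotient, if all sections of
the quotient lift. -/
theorem exists_rep_quot (L : LieAlgebroid A) (W : ∀ x, Submodule ℝ (A.Fiber x)) (r : ℕ)
    (hr : ∀ x, finrank ℝ (W x) = r)
    (hW : ∀ s t : A.sec, (∀ x, s.1 x ∈ W x) → (∀ x, t.1 x ∈ W x) →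
      ∀ x, (L.bracket s t).1 x ∈ W x)
    (hq : Function.Surjective (A.quotMk W r hr)) :
    ∃ R : (L.sub W r hr hW).Rep (A.quot W r hr), ∀ (Y : (A.sub W r hr).sec) (s : A.sec),
      R.D Y (A.quotMk W r hr s) = A.quotMk W r hr (L.bracket (A.subIncl Y) s) := by
  have hmk : ∀ s t : A.sec, (∀ x, s.1 x - t.1 x ∈ W x) → A.quotMk W r hr s = A.quotMk W r hr t :=
    fun s t h => by
      ext x
      exact (Submodule.Quotient.eq _).2 (h x)
  have key : ∀ (Y : (A.sub W r hr).sec) (s t : A.sec), A.quotMk W r hr s = A.quotMk W r hr t →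
      A.quotMk W r hr (L.bracket (A.subIncl Y) s) = A.quotMk W r hr (L.bracket (A.subIncl Y) t) :=
    fun Y s t h => hmk _ _ fun x => by
      have h1 := hW (A.subIncl Y) (s - t) (fun y => (Y.1 y).2) (fun y =>
        (Submodule.Quotient.eq _).1 (congrFun (congrArg Subtype.val h) y)) x
      rw [map_sub] at h1
      exact h1
  choose l hl using hq
  let op : (A.sub W r hr).sec → (A.quot W r hr).sec → (A.quot W r hr).sec :=
    fun Y q => A.quotMk W r hr (L.bracket (A.subIncl Y) (l q))
  have hop : ∀ Y s, op Y (A.quotMk W r hr s) = A.quotMk W r hr (L.bracket (A.subIncl Y) s) :=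
    fun Y s => key Y _ _ (hl _)
  refine ⟨{ D := LinearMap.mk₂ ℝ op
              (fun Y Y' q => ?_) (fun c Y q => ?_) (fun Y q q' => ?_) (fun c Y q => ?_)
            smul_left := fun f Y q => ?_
            leibniz := fun Y f q x => ?_
            flat := fun Y Y' q => ?_ }, hop⟩
  · simp only [op, map_add, LinearMap.add_apply]
    rfl
  · simp only [op, map_smul, LinearMap.smul_apply]
    rfl
  · have h1 : A.quotMk W r hr (l q + l q') = q + q' := by
      conv_rhs => rw [← hl q, ← hl q']
      rfl
    rw [← h1, hop, map_add]
    rfl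
  · have h1 : A.quotMk W r hr (c • l q) = c • q := by
      conv_rhs => rw [← hl q]
      rfl
    rw [← h1, hop, map_smul]
    rfl
  · refine (hmk (L.bracket (f • A.subIncl Y) (l q)) (f • L.bracket (A.subIncl Y) (l q))
      fun x => ?_).trans rfl
    rw [bracket_smul_left_apply]
    change _ + _ - f x • (L.bracket (A.subIncl Y) (l q)).1 x ∈ W x
    rw [add_sub_cancel_left]
    exact (W x).smul_mem _ (Y.1 x).2
  · have h1 : A.quotMk W r hr (f • l q) =
        ⟨fun x => f x • q.1 x, (A.quot W r hr).smul_mem f _ q.2⟩ := by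
      conv_rhs => rw [← hl q]
      rfl
    have h2 := hop Y (f • l q)
    rw [h1] at h2
    refine (congrFun (congrArg Subtype.val h2) x).trans ?_
    refine (congrArg (W x).mkQ (L.leibniz (A.subIncl Y) f (l q) x)).trans ?_
    rw [map_add, map_smul, map_smul]
    congr 2
    exact congrFun (congrArg Subtype.val (hl q)) x
  · change op Y (op Y' q) - op Y' (op Y q) = op ((L.sub W r hr hW).bracket Y Y') q
    have h1 : op Y (op Y' q) = _ := hop Y (L.bracket (A.subIncl Y') (l q))
    have h2 : op Y' (op Y q) = _ := hop Y' (L.bracket (A.subIncl Y) (l q))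
    rw [h1, h2, L.jacobi]
    refine Eq.trans ?_ (rfl :
      A.quotMk W r hr (L.bracket (L.bracket (A.subIncl Y) (A.subIncl Y')) (l q)) = _)
    ext x
    change (W x).mkQ _ - (W x).mkQ _ = (W x).mkQ _
    rw [← map_sub]
    congr 1
    exact add_sub_cancel_right _ _

end Descent

namespace Hom

section Frames

variable {n : ℕ} {M : Type u} [TopologicalSpace M] [ChartedSpace (EuclideanSpace ℝ (Fin n)) M]
  [IsManifold (𝓡 n) ∞ M]
  {A : SmoothFamily.{u, v} n M} {A' : SmoothFamily.{u, w} n M} {L : LieAlgebroid A}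
  {L' : LieAlgebroid A'} (Φ : L.Hom L') (b : ℕ)
  (hb : ∀ x, finrank ℝ (LinearMap.range (Φ.map x)) = b)

theorem IsAdaptedFrame.image {Φ : L.Hom L'} {b : ℕ}
    {hb : ∀ x, finrank ℝ (LinearMap.range (Φ.map x)) = b} {U : Set M}
    {k : Fin (A.rank - b) → (Φ.kerBundle b hb).sec} {a : Fin b → A.sec}
    {z : Fin (A'.rank - b) → A'.sec} (h : Φ.IsAdaptedFrame b hb U k a z) :
    (Φ.imBundle b hb).IsFrameOn U fun j =>
      ⟨fun x => ⟨Φ.map x ((a j).1 x), LinearMap.mem_range_self _ _⟩, Φ.map_mem (a j)⟩ where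
  linearIndependent x hx := LinearIndependent.of_comp (LinearMap.range (Φ.map x)).subtype
    ((h.target.linearIndependent x hx).comp Sum.inl Sum.inl_injective)
  exists_coeff s := by
    obtain ⟨d, hd, hs⟩ := h.target.exists_coeff (A'.subIncl s)
    refine ⟨fun j => d (Sum.inl j), fun j => hd _, fun x hx => ?_⟩
    have h1 := hs x hx
    rw [Fintype.sum_sum_type] at h1
    have h2 : (fun l => d (Sum.inr l) x) = 0 :=
      Φ.coeff_eq_zero_of_mem_range b (h.target.linearIndependent x hx) (hb x)
        (c := fun j => d (Sum.inl j) x) (z := z)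
        ((show ∀ w, w = (A'.subIncl s).1 x → w ∈ LinearMap.range (Φ.map x) by
          rintro _ rfl
          exact (s.1 x).2) _ h1.symm)
    have h3 : ∀ l, d (Sum.inr l) x = 0 := fun l => congrFun h2 l
    simp only [h3, zero_smul, Finset.sum_const_zero, add_zero, Sum.elim_inl] at h1
    ext
    rw [Submodule.coe_sum]
    exact h1

variable [T2Space M]

theorem locallyFree_kerBundle (hA : A.LocallyFree) (hA' : A'.LocallyFree) :
    (Φ.kerBundle b hb).LocallyFree := fun x => by
  obtain ⟨U, hU, hx, k, a, z, h⟩ := Φ.exists_adaptedFrame b hb hA hA' x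
  exact ⟨U, hU, hx, k, h.kernel⟩

theorem locallyFree_imBundle (hA : A.LocallyFree) (hA' : A'.LocallyFree) :
    (Φ.imBundle b hb).LocallyFree := fun x => by
  obtain ⟨U, hU, hx, k, a, z, h⟩ := Φ.exists_adaptedFrame b hb hA hA' x
  exact ⟨U, hU, hx, _, h.image⟩

theorem locallyFree_cokerBundle (hA : A.LocallyFree) (hA' : A'.LocallyFree) :
    (Φ.cokerBundle b hb).LocallyFree := fun x => by
  obtain ⟨U, hU, hx, k, a, z, h⟩ := Φ.exists_adaptedFrame b hb hA hA' x
  exact ⟨U, hU, hx, _, h.coker⟩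

variable [SecondCountableTopology M]

/-- If the kernel is unimodular, its sections act trivially on its top exterior power. -/
theorem top_adjointRep_subIncl_eq_zero (hA : A.LocallyFree) (hA' : A'.LocallyFree)
    (hu : (Φ.kernel b hb).IsUnimodular) {R : L.Rep (Φ.kerBundle b hb).top}
    (hR : (Φ.adjointRep b hb).IsTop R) (k : (Φ.kerBundle b hb).sec) :
    R.D (A.subIncl k) = 0 := by
  have hanchor : ∀ x, (Φ.kernel b hb).anchor x = 0 := fun x => by
    ext w
    change L.anchor x w.1 = 0
    rw [← Φ.anchor_map, LinearMap.mem_ker.1 w.2, map_zero]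
  refine (R.isDer (A.subIncl k)).ext_of_isGen (fun f s x => ?_) fun x => ?_
  · have h1 : (L.anchorSec (A.subIncl k)).1 x = 0 := congrArg (fun l => l (k.1 x)) (hanchor x)
    rw [h1, dirDeriv_vzero, zero_smul, add_zero]
    exact (smul_zero _).symm
  · have hK := Φ.locallyFree_kerBundle b hb hA hA'
    obtain ⟨U, hU, hx, e, he⟩ := hK x
    refine ⟨U, hU, hx, wedge e, he.isGen_wedge hU, ?_⟩
    rw [hR]
    exact hu.wedgeDeriv_bracket_eq_zero hK hanchor k hU he hx

end Frames

section InducedReps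

variable {n : ℕ} {M : Type u} [TopologicalSpace M] [ChartedSpace (EuclideanSpace ℝ (Fin n)) M]
  [IsManifold (𝓡 n) ∞ M] [T2Space M] [SecondCountableTopology M]
  {F : Type*} [NormedAddCommGroup F] [NormedSpace ℝ F] [FiniteDimensional ℝ F]
  {V : M → Type v} [∀ x, AddCommGroup (V x)] [∀ x, Module ℝ (V x)] [∀ x, TopologicalSpace (V x)]
  [TopologicalSpace (TotalSpace F V)] [FiberBundle F V] [VectorBundle ℝ F V]
  [ContMDiffVectorBundle ∞ F V (𝓡 n)]
  {F' : Type*} [NormedAddCommGroup F'] [NormedSpace ℝ F'] [FiniteDimensional ℝ F']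
  {V' : M → Type w} [∀ x, AddCommGroup (V' x)] [∀ x, Module ℝ (V' x)] [∀ x, TopologicalSpace (V' x)]
  [TopologicalSpace (TotalSpace F' V')] [FiberBundle F' V'] [VectorBundle ℝ F' V']
  [ContMDiffVectorBundle ∞ F' V' (𝓡 n)]
  {L : LieAlgebroid (ofBundle n F V)} {L' : LieAlgebroid (ofBundle n F' V')} (Φ : L.Hom L') (b : ℕ)
  (hb : ∀ x, finrank ℝ (LinearMap.range (Φ.map x)) = b)

/-- The representation of `A` on `⋀^top C` descends to a unique representation of the image. -/
theorem exists_isKernelRep (hu : (Φ.kernel b hb).IsUnimodular) :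
    ∃ D, Φ.IsKernelRep b hb D ∧ ∀ D', Φ.IsKernelRep b hb D' → D' = D := by
  have hA := locallyFree_ofBundle (n := n) (F := F) (V := V)
  have hA' := locallyFree_ofBundle (n := n) (F := F') (V := V')
  have hK := Φ.locallyFree_kerBundle b hb hA hA'
  obtain ⟨R, hR⟩ := (Φ.adjointRep b hb).exists_isTop hK
  have hsurj := Φ.toImage_onSec_surjective b hb
  obtain ⟨D, hD⟩ := (Φ.toImage b hb).exists_rep_of_surjective hsurj R fun X hX => by
    refine Φ.top_adjointRep_subIncl_eq_zero b hb hA hA' hu hR ⟨fun x => ⟨X.1 x, ?_⟩, X.2⟩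
    exact LinearMap.mem_ker.2
      (congrArg Subtype.val (congrFun (congrArg Subtype.val hX) x))
  refine ⟨D, ⟨R, hR, hD⟩, ?_⟩
  rintro D' ⟨R', hR', hD'⟩
  rw [Rep.isTop_unique hK hR' hR] at hD'
  ext Y : 2
  obtain ⟨X, rfl⟩ := hsurj Y
  ext1 s
  rw [hD, hD']

/-- The representation of the image on `A'/B` given by the bracket, hence its extension to
`⋀^top (A'/B)`, exists and is unique, since all sections of `A'/B` lift. -/
theorem exists_isCokernelRep :
    ∃ D, Φ.IsCokernelRep b hb D ∧ ∀ D', Φ.IsCokernelRep b hb D' → D' = D := by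
  have hA := locallyFree_ofBundle (n := n) (F := F) (V := V)
  have hA' := locallyFree_ofBundle (n := n) (F := F') (V := V')
  have hQ := Φ.locallyFree_cokerBundle b hb hA hA'
  have hsurj := quotMk_surjective (n := n) (F := F') (fun x => LinearMap.range (Φ.map x)) b hb
  obtain ⟨R, hR⟩ := L'.exists_rep_quot _ b hb (Φ.bracket_mem_range b hb) hsurj
  obtain ⟨D, hD⟩ := Rep.exists_isTop hQ R
  refine ⟨D, ⟨R, hR, hD⟩, ?_⟩
  rintro D' ⟨R', hR', hD'⟩
  have h1 : R' = R := by
    ext Y : 2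
    ext1 q
    obtain ⟨s, rfl⟩ := hsurj q
    exact (hR' Y s).trans (hR Y s).symm
  rw [h1] at hD'
  exact Rep.isTop_unique hQ hD' hD

end InducedReps

end Hom

end LieAlgebroid

/-! ### Adapted frames and the squares of the line bundles -/

namespace SmoothFamily

section Blocks

variable {n : ℕ} {M : Type u} [TopologicalSpace M] [ChartedSpace (EuclideanSpace ℝ (Fin n)) M]
  {E : SmoothFamily.{u, v} n M} {p q : ℕ}

theorem wedge_eq_det_smul {s s' : Fin E.rank → E.sec} {x : M}
    (c : Matrix (Fin E.rank) (Fin E.rank) ℝ) (h : ∀ i, (s' i).1 x = ∑ j, c i j • (s j).1 x) : (wedge s').1 x = c.det • (wedge s).1 x := by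
  have h1 := AlternatingMap.map_sum_smul_eq_det (exteriorPower.ιMulti ℝ E.rank) c
    (fun j => (s j).1 x)
  rw [← funext h] at h1
  exact h1

/-- A block-triangular change of frame changes the wedge product by the product of the determinants
of the diagonal blocks. -/
theorem wedge_sumElim_eq_det_smul (σ : Fin E.rank ≃ Fin p ⊕ Fin q) {s s' : Fin p → E.sec}
    {t t' : Fin q → E.sec} {x : M} (P : Matrix (Fin p) (Fin p) ℝ) (Q : Matrix (Fin q) (Fin p) ℝ)
    (N : Matrix (Fin q) (Fin q) ℝ) (hs : ∀ i, (s' i).1 x = ∑ j, P i j • (s j).1 x)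
    (ht : ∀ i, (t' i).1 x = ∑ j, Q i j • (s j).1 x + ∑ j, N i j • (t j).1 x) :
    (wedge fun i => Sum.elim s' t' (σ i)).1 x =
      (P.det * N.det) • (wedge fun i => Sum.elim s t (σ i)).1 x := by
  rw [wedge_eq_det_smul ((Matrix.fromBlocks P 0 Q N).submatrix σ σ)
      (s := fun i => Sum.elim s t (σ i)),
    Matrix.det_submatrix_equiv_self, Matrix.det_fromBlocks_zero₁₂]
  intro i
  rw [← σ.symm.sum_comp]
  simp only [Matrix.submatrix_apply, Equiv.apply_symm_apply]
  rcases σ i with j | j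
  · simp [hs]
  · simp [ht]

/-- On a frame in which an operator is block-triangular, the wedge derivative is multiplication by
the sum of the traces of the diagonal blocks. -/
theorem wedgeDeriv_sumElim_eq_trace (σ : Fin E.rank ≃ Fin p ⊕ Fin q) (D : E.sec → E.sec)
    {s : Fin p → E.sec} {t : Fin q → E.sec} {x : M} (P : Fin p → Fin p → ℝ) (Q : Fin q → Fin p → ℝ)
    (N : Fin q → Fin q → ℝ) (hs : ∀ i, (D (s i)).1 x = ∑ j, P i j • (s j).1 x)
    (ht : ∀ i, (D (t i)).1 x = ∑ j, Q i j • (s j).1 x + ∑ j, N i j • (t j).1 x) :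
    (wedgeDeriv D fun i => Sum.elim s t (σ i)).1 x =
      (∑ i, P i i + ∑ i, N i i) • (wedge fun i => Sum.elim s t (σ i)).1 x := by
  rw [wedgeDeriv_eq_trace D _ x fun i j => Matrix.fromBlocks (Matrix.of P) 0 (Matrix.of Q)
    (Matrix.of N) (σ i) (σ j)]
  · congr 1
    rw [← σ.symm.sum_comp]
    simp
  · intro i
    rw [← σ.symm.sum_comp]
    simp only [Equiv.apply_symm_apply]
    rcases σ i with j | j
    · simp [hs]
    · simp [ht]

theorem tmul_smul_smul_apply {T : SmoothFamily.{u, v} n M} {T' : SmoothFamily.{u, w} n M}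
    {s g : T.sec} {s' g' : T'.sec} {x : M} {c c' : ℝ} (h : s.1 x = c • g.1 x)
    (h' : s'.1 x = c' • g'.1 x) : (tmul s s').1 x = (c * c') • (tmul g g').1 x := by
  change s.1 x ⊗ₜ[ℝ] s'.1 x = _
  rw [h, h']
  exact TensorProduct.smul_tmul_smul _ _ _ _

/-- The coefficients of an element of the square of a line with respect to the squares of two
generators. -/
theorem coeff_tmul_self {T : SmoothFamily.{u, v} n M} {mu : (T.tensor T).sec} {g g' : T.sec} {x : M}
    (h0 : mu.1 x ≠ 0) {h h' c : ℝ} (hg : mu.1 x = h • (tmul g g).1 x)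
    (hg' : mu.1 x = h' • (tmul g' g').1 x) (hc : g'.1 x = c • g.1 x) :
    h = h' * c ^ 2 ∧ c ≠ 0 ∧ h' ≠ 0 := by
  have h1 : (tmul g g).1 x ≠ 0 := fun h1 => h0 (by rw [hg, h1, smul_zero])
  rw [tmul_smul_smul_apply hc hc, smul_smul] at hg'
  have h2 : h = h' * c ^ 2 := by
    rw [sq]
    exact smul_left_injective ℝ h1 (hg.symm.trans hg')
  have h3 : h' * c ^ 2 ≠ 0 := fun h3 => h0 (by rw [hg, h2, h3, zero_smul])
  exact ⟨h2, fun h4 => h3 (by simp [h4]), left_ne_zero_of_mul h3⟩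

end Blocks

end SmoothFamily

namespace LieAlgebroid

open SmoothFamily

section Cocycles

variable {n : ℕ} {M : Type u} [TopologicalSpace M] [ChartedSpace (EuclideanSpace ℝ (Fin n)) M]
  [IsManifold (𝓡 n) ∞ M] [T2Space M]
  {A : SmoothFamily.{u, v} n M} {L : LieAlgebroid A} {T : SmoothFamily.{u, w} n M}

/-- The characteristic cocycle of the square of a representation, with respect to the section
`h g ⊗ g`, where `a` acts on `g` as multiplication by `t`. -/
theorem Rep.pair_cocycle_eq {R : L.Rep T} {R' : L.Rep (T.tensor T)} (hR : R.IsTensor R R')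
    {mu : (T.tensor T).sec} {α : L.Cocycle}
    (hα : ∀ (a : A.sec) (x : M), (R'.D a mu).1 x = pair α.1 x (a.1 x) • mu.1 x) {U : Set M} {x : M}
    (hU : U ∈ 𝓝 x) {g : T.sec} {h : M → ℝ} (hh : ∀ y ∈ U, SmoothAt n h y)
    (hmu : ∀ y ∈ U, mu.1 y = h y • (tmul g g).1 y) (h0 : mu.1 x ≠ 0) {a : A.sec} {t : ℝ}
    (ht : (R.D a g).1 x = t • g.1 x) :
    pair α.1 x (a.1 x) = 2 * t + dirDeriv h x (L.anchor x (a.1 x)) / h x := by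
  have h1 := hmu x (mem_of_mem_nhds hU)
  have h2 : h x ≠ 0 := fun h2 => h0 (by rw [h1, h2, zero_smul])
  have h3 : (tmul g g).1 x ≠ 0 := fun h3 => h0 (by rw [h1, h3, smul_zero])
  have h4 := (R'.isDer a).apply_smul hU hh hmu
  rw [hα, h1, hR] at h4
  have h5 : (tmul (R.D a g) g + tmul g (R.D a g)).1 x = (2 * t) • (tmul g g).1 x := by
    change (R.D a g).1 x ⊗ₜ[ℝ] g.1 x + g.1 x ⊗ₜ[ℝ] (R.D a g).1 x =
      (2 * t) • (g.1 x ⊗ₜ[ℝ] g.1 x)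
    rw [ht, TensorProduct.tmul_smul, ← TensorProduct.smul_tmul']
    module
  rw [h5, smul_smul, smul_smul, ← add_smul] at h4
  have h6 := smul_left_injective ℝ h3 h4
  have h7 : dirDeriv h x ((L.anchorSec a).1 x) = dirDeriv h x (L.anchor x (a.1 x)) := rfl
  rw [h7] at h6
  field_simp
  linarith

theorem IsCanonicalRep.apply_eq_smul {R : L.Rep (modularLine A)} (h : L.IsCanonicalRep R)
    {a : A.sec} {s : Fin A.rank → A.sec} {ξ : Fin (tangent n M).dual.rank → (tangent n M).dual.sec}
    {x : M} {t t' : ℝ} (hs : (wedgeDeriv (L.bracket a) s).1 x = t • (wedge s).1 x)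
    (hξ : (wedgeDeriv (lieForm (L.anchorSec a)) ξ).1 x = t' • (wedge ξ).1 x) :
    (R.D a (tmul (wedge s) (wedge ξ))).1 x = (t + t') • (tmul (wedge s) (wedge ξ)).1 x := by
  rw [h.apply]
  change (wedgeDeriv (L.bracket a) s).1 x ⊗ₜ[ℝ] (wedge ξ).1 x +
    (wedge s).1 x ⊗ₜ[ℝ] (wedgeDeriv (lieForm (L.anchorSec a)) ξ).1 x =
      (t + t') • ((wedge s).1 x ⊗ₜ[ℝ] (wedge ξ).1 x)
  rw [hs, hξ, TensorProduct.tmul_smul, ← TensorProduct.smul_tmul']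
  module

end Cocycles

namespace Hom

section Ratio

variable {n : ℕ} {M : Type u} [TopologicalSpace M] [ChartedSpace (EuclideanSpace ℝ (Fin n)) M]
  [IsManifold (𝓡 n) ∞ M]
  {A : SmoothFamily.{u, v} n M} {A' : SmoothFamily.{u, w} n M} {L : LieAlgebroid A}
  {L' : LieAlgebroid A'} (Φ : L.Hom L') (b : ℕ)
  (hb : ∀ x, finrank ℝ (LinearMap.range (Φ.map x)) = b)
  (σ : Fin A.rank ≃ Fin (A.rank - b) ⊕ Fin b) (σ' : Fin A'.rank ≃ Fin b ⊕ Fin (A'.rank - b))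
  (mA : ((modularLine A).tensor (modularLine A)).sec)
  (mA' : ((modularLine A').tensor (modularLine A')).sec)
  (mK : ((Φ.kerBundle b hb).top.tensor (Φ.kerBundle b hb).top).sec)
  (mQ : ((Φ.cokerBundle b hb).top.tensor (Φ.cokerBundle b hb).top).sec)

/-- An adapted frame `(k, a, z)` and a frame `ξ` of `1`-forms over `U`, together with the
coefficients `hA`, `hA'`, `hK`, `hQ` of given sections of the squares of the four line bundles with
respect to the squares of the generators `k ∧ a ⊗ ξ`, `Φ a ∧ z ⊗ ξ`, `k` and `z` (wedge products
being understood). The bijections `σ` and `σ'` fix the order of the factors. -/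
structure IsAdaptedData (U : Set M) (k : Fin (A.rank - b) → (Φ.kerBundle b hb).sec)
    (a : Fin b → A.sec) (z : Fin (A'.rank - b) → A'.sec)
    (ξ : Fin (tangent n M).dual.rank → (tangent n M).dual.sec) (hA hA' hK hQ : M → ℝ) : Prop where
  frame : Φ.IsAdaptedFrame b hb U k a z
  form : (tangent n M).dual.IsFrameOn U ξ
  smooth_source : ∀ x ∈ U, SmoothAt n hA x
  smooth_target : ∀ x ∈ U, SmoothAt n hA' x
  smooth_ker : ∀ x ∈ U, SmoothAt n hK x
  smooth_coker : ∀ x ∈ U, SmoothAt n hQ x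
  source : ∀ x ∈ U, mA.1 x = hA x • (tmul
    (tmul (wedge fun i => Sum.elim (fun i => A.subIncl (k i)) a (σ i)) (wedge ξ))
    (tmul (wedge fun i => Sum.elim (fun i => A.subIncl (k i)) a (σ i)) (wedge ξ))).1 x
  target : ∀ x ∈ U, mA'.1 x = hA' x • (tmul
    (tmul (wedge fun i => Sum.elim (fun j => Φ.onSec (a j)) z (σ' i)) (wedge ξ))
    (tmul (wedge fun i => Sum.elim (fun j => Φ.onSec (a j)) z (σ' i)) (wedge ξ))).1 x
  ker : ∀ x ∈ U, mK.1 x = hK x • (tmul (wedge k) (wedge k)).1 x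
  coker : ∀ x ∈ U, mQ.1 x = hQ x • (tmul (wedge fun l => A'.quotMk _ b hb (z l))
    (wedge fun l => A'.quotMk _ b hb (z l))).1 x

theorem exists_adaptedData [T2Space M] (hA : A.LocallyFree) (hA' : A'.LocallyFree) (x₀ : M) :
    ∃ U, IsOpen U ∧ x₀ ∈ U ∧ ∃ k a z ξ fA fA' fK fQ,
      Φ.IsAdaptedData b hb σ σ' mA mA' mK mQ U k a z ξ fA fA' fK fQ := by
  obtain ⟨U₁, hU₁, hx₁, k, a, z, h⟩ := Φ.exists_adaptedFrame b hb hA hA' x₀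
  obtain ⟨U₂, hU₂, hx₂, ξ, hξ⟩ := (locallyFree_tangent (n := n)).dual x₀
  have hU := hU₁.inter hU₂
  replace hξ := hξ.mono (Set.inter_subset_right (s := U₁))
  replace h : Φ.IsAdaptedFrame b hb (U₁ ∩ U₂) k a z :=
    ⟨h.source.mono Set.inter_subset_left, h.target.mono Set.inter_subset_left,
      h.kernel.mono Set.inter_subset_left, h.coker.mono Set.inter_subset_left⟩
  have g1 := ((h.source.reindex σ).isGen_wedge hU).tmul hU (hξ.isGen_wedge hU)
  have g2 := ((h.target.reindex σ').isGen_wedge hU).tmul hU (hξ.isGen_wedge hU)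
  have g3 := h.kernel.isGen_wedge hU
  have g4 := h.coker.isGen_wedge hU
  obtain ⟨fA, hfA, eA⟩ := (g1.tmul hU g1).exists_coeff mA
  obtain ⟨fA', hfA', eA'⟩ := (g2.tmul hU g2).exists_coeff mA'
  obtain ⟨fK, hfK, eK⟩ := (g3.tmul hU g3).exists_coeff mK
  obtain ⟨fQ, hfQ, eQ⟩ := (g4.tmul hU g4).exists_coeff mQ
  exact ⟨_, hU, ⟨hx₁, hx₂⟩, k, a, z, ξ, fA, fA', fK, fQ, h, hξ, hfA, hfA', hfK, hfQ, eA,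
    eA', eK, eQ⟩

variable {Φ b hb σ σ' mA mA' mK mQ}

theorem map_subIncl (k : (Φ.kerBundle b hb).sec) (x : M) : Φ.map x ((A.subIncl k).1 x) = 0 :=
  LinearMap.mem_ker.1 (k.1 x).2

/-- Applying the morphism to a combination of an adapted frame kills the kernel components. -/
theorem map_sum_add_sum {ι κ : Type*} [Fintype ι] [Fintype κ] (k : ι → (Φ.kerBundle b hb).sec)
    (a : κ → A.sec) (c : ι → ℝ) (d : κ → ℝ) (x : M) :
    Φ.map x (∑ i, c i • (A.subIncl (k i)).1 x + ∑ j, d j • (a j).1 x) =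
      ∑ j, d j • (Φ.onSec (a j)).1 x := by
  rw [map_add, map_sum, map_sum, Finset.sum_eq_zero fun i _ => by
    rw [map_smul, map_subIncl, smul_zero], zero_add]
  exact Finset.sum_congr rfl fun j _ => map_smul _ _ _

/-- Reducing a combination of an adapted frame modulo the image kills the components along the
image. -/
theorem mkQ_sum_add_sum {ι κ : Type*} [Fintype ι] [Fintype κ] (a : ι → A.sec) (z : κ → A'.sec)
    (c : ι → ℝ) (d : κ → ℝ) (x : M) :
    (LinearMap.range (Φ.map x)).mkQ (∑ i, c i • (Φ.onSec (a i)).1 x + ∑ j, d j • (z j).1 x) =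
      ∑ j, d j • (A'.quotMk _ b hb (z j)).1 x := by
  have h1 : ∀ i, (LinearMap.range (Φ.map x)).mkQ (c i • (Φ.onSec (a i)).1 x) = 0 := fun i => by
    rw [Submodule.mkQ_apply, Submodule.Quotient.mk_eq_zero]
    exact Submodule.smul_mem _ _ ⟨(a i).1 x, rfl⟩
  rw [map_add, map_sum, map_sum, Finset.sum_eq_zero fun i _ => h1 i, zero_add]
  exact Finset.sum_congr rfl fun j _ => map_smul _ _ _

theorem IsAdaptedFrame.exists_coeff_kernel {U : Set M} {k a z} (h : Φ.IsAdaptedFrame b hb U k a z)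
    {ι : Type*} (s : ι → (Φ.kerBundle b hb).sec) {x : M} (hx : x ∈ U) :
    ∃ c : ι → Fin (A.rank - b) → ℝ, (∀ i, (s i).1 x = ∑ j, c i j • (k j).1 x) ∧
      ∀ i, (A.subIncl (s i)).1 x = ∑ j, c i j • (A.subIncl (k j)).1 x := by
  obtain ⟨c, -, hc⟩ := h.kernel.exists_coeff_family s
  refine ⟨fun i j => c i j x, fun i => hc i x hx, fun i => ?_⟩
  have h1 := congrArg Subtype.val (hc i x hx)
  rw [Submodule.coe_sum] at h1
  exact h1

theorem IsAdaptedFrame.exists_coeff_source {U : Set M} {k a z} (h : Φ.IsAdaptedFrame b hb U k a z)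
    {ι : Type*} (s : ι → A.sec) {x : M} (hx : x ∈ U) :
    ∃ (c : ι → Fin (A.rank - b) → ℝ) (d : ι → Fin b → ℝ),
      (∀ i, (s i).1 x = ∑ j, c i j • (A.subIncl (k j)).1 x + ∑ j, d i j • (a j).1 x) ∧
      ∀ i, (Φ.onSec (s i)).1 x = ∑ j, d i j • (Φ.onSec (a j)).1 x := by
  obtain ⟨c, -, hc⟩ := h.source.exists_coeff_family s
  have h1 : ∀ i, (s i).1 x = ∑ j, c i (Sum.inl j) x • (A.subIncl (k j)).1 x +
      ∑ j, c i (Sum.inr j) x • (a j).1 x := fun i => by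
    rw [hc i x hx, Fintype.sum_sum_type]
    rfl
  refine ⟨fun i j => c i (Sum.inl j) x, fun i j => c i (Sum.inr j) x, h1, fun i => ?_⟩
  rw [← map_sum_add_sum k a (fun j => c i (Sum.inl j) x), ← h1]
  rfl

theorem IsAdaptedFrame.exists_coeff_target {U : Set M} {k a z} (h : Φ.IsAdaptedFrame b hb U k a z)
    {ι : Type*} (s : ι → A'.sec) {x : M} (hx : x ∈ U) :
    ∃ (c : ι → Fin b → ℝ) (d : ι → Fin (A'.rank - b) → ℝ),
      (∀ i, (s i).1 x = ∑ j, c i j • (Φ.onSec (a j)).1 x + ∑ j, d i j • (z j).1 x) ∧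
      ∀ i, (A'.quotMk _ b hb (s i)).1 x = ∑ j, d i j • (A'.quotMk _ b hb (z j)).1 x := by
  obtain ⟨c, -, hc⟩ := h.target.exists_coeff_family s
  have h1 : ∀ i, (s i).1 x = ∑ j, c i (Sum.inl j) x • (Φ.onSec (a j)).1 x +
      ∑ j, c i (Sum.inr j) x • (z j).1 x := fun i => by
    rw [hc i x hx, Fintype.sum_sum_type]
    rfl
  refine ⟨fun i j => c i (Sum.inl j) x, fun i j => c i (Sum.inr j) x, h1, fun i => ?_⟩
  rw [← mkQ_sum_add_sum a z (fun j => c i (Sum.inl j) x), ← h1]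
  rfl

/-- The ratio `hA hQ / (hA' hK)` does not depend on the frames: it expresses the canonical
isomorphism of `⋀^top A ⊗ ⋀^top (A'/B)` with `⋀^top A' ⊗ ⋀^top C`. -/
theorem IsAdaptedData.ratio_eq {U k a z ξ fA fA' fK fQ}
    (h : Φ.IsAdaptedData b hb σ σ' mA mA' mK mQ U k a z ξ fA fA' fK fQ)
    {U₁ k₁ a₁ z₁ ξ₁ gA gA' gK gQ}
    (h₁ : Φ.IsAdaptedData b hb σ σ' mA mA' mK mQ U₁ k₁ a₁ z₁ ξ₁ gA gA' gK gQ) {x : M} (hx : x ∈ U)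
    (hx₁ : x ∈ U₁) (hmA : mA.1 x ≠ 0) (hmA' : mA'.1 x ≠ 0) (hmK : mK.1 x ≠ 0) (hmQ : mQ.1 x ≠ 0) :
    fA x * fQ x / (fA' x * fK x) = gA x * gQ x / (gA' x * gK x) := by
  obtain ⟨P, hP, hP'⟩ := h.frame.exists_coeff_kernel k₁ hx
  obtain ⟨Q, N, hN, hN'⟩ := h.frame.exists_coeff_source a₁ hx
  obtain ⟨Q', S, hS, hS'⟩ := h.frame.exists_coeff_target z₁ hx
  obtain ⟨c, -, hc⟩ := h.form.exists_coeff_family ξ₁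
  have hξ := wedge_eq_det_smul (Matrix.of fun i j => c i j x) fun i => hc i x hx
  have w1 := wedge_sumElim_eq_det_smul σ (Matrix.of P) (Matrix.of Q) (Matrix.of N) hP' hN
  have w2 := wedge_sumElim_eq_det_smul σ' (Matrix.of N) (Matrix.of Q') (Matrix.of S) hN' hS
  have w3 := wedge_eq_det_smul (E := Φ.kerBundle b hb) (Matrix.of P) hP
  have w4 := wedge_eq_det_smul (E := Φ.cokerBundle b hb) (Matrix.of S) hS'
  obtain ⟨e1, n1, n1'⟩ := coeff_tmul_self hmA (h.source x hx) (h₁.source x hx₁)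
    (tmul_smul_smul_apply w1 hξ)
  obtain ⟨e2, n2, n2'⟩ := coeff_tmul_self hmA' (h.target x hx) (h₁.target x hx₁)
    (tmul_smul_smul_apply w2 hξ)
  obtain ⟨e3, n3, n3'⟩ := coeff_tmul_self hmK (h.ker x hx) (h₁.ker x hx₁) w3
  obtain ⟨e4, n4, n4'⟩ := coeff_tmul_self hmQ (h.coker x hx) (h₁.coker x hx₁) w4
  rw [e1, e2, e3, e4]
  generalize (Matrix.of P).det = dP at *
  generalize (Matrix.of N).det = dN at *
  generalize (Matrix.of S).det = dS at *
  generalize (Matrix.of fun i j => c i j x).det = dT at *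
  have m1 := right_ne_zero_of_mul n2
  have m2 := right_ne_zero_of_mul (left_ne_zero_of_mul n1)
  field_simp

end Ratio

end Hom

end LieAlgebroid

/-! ### The modular class of the morphism -/

namespace LieAlgebroid

open SmoothFamily

namespace Hom

section ModularClass

variable {n : ℕ} {M : Type u} [TopologicalSpace M] [ChartedSpace (EuclideanSpace ℝ (Fin n)) M]
  [IsManifold (𝓡 n) ∞ M] [T2Space M]
  {F : Type*} [NormedAddCommGroup F] [NormedSpace ℝ F] [FiniteDimensional ℝ F]
  {V : M → Type v} [∀ x, AddCommGroup (V x)] [∀ x, Module ℝ (V x)] [∀ x, TopologicalSpace (V x)]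
  [TopologicalSpace (TotalSpace F V)] [FiberBundle F V] [VectorBundle ℝ F V]
  [ContMDiffVectorBundle ∞ F V (𝓡 n)]
  {F' : Type*} [NormedAddCommGroup F'] [NormedSpace ℝ F'] [FiniteDimensional ℝ F']
  {V' : M → Type w} [∀ x, AddCommGroup (V' x)] [∀ x, Module ℝ (V' x)] [∀ x, TopologicalSpace (V' x)]
  [TopologicalSpace (TotalSpace F' V')] [FiberBundle F' V'] [VectorBundle ℝ F' V']
  [ContMDiffVectorBundle ∞ F' V' (𝓡 n)]
  {L : LieAlgebroid (ofBundle n F V)} {L' : LieAlgebroid (ofBundle n F' V')} {Φ : L.Hom L'} {b : ℕ}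
  {hb : ∀ x, finrank ℝ (LinearMap.range (Φ.map x)) = b}

/-- The actions of `X` on the generators `k ∧ a ⊗ ξ`, `Φ a ∧ z ⊗ ξ`, `k` and `z` given by an adapted
frame `(k, a, z)` and a frame `ξ` of `1`-forms are multiplications by `κ + β + τ`, `β + ζ + τ`, `κ`
and `ζ`, the traces on the kernel, the image, the cokernel and the `1`-forms being `κ`, `β`, `ζ`
and `τ`. -/
theorem IsAdaptedFrame.exists_traces {U : Set M} {k a z} (h : Φ.IsAdaptedFrame b hb U k a z)
    {ξ : Fin (tangent n M).dual.rank → (tangent n M).dual.sec}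
    (hξ : (tangent n M).dual.IsFrameOn U ξ) {x : M} (hx : x ∈ U) (X : (ofBundle n F V).sec)
    (σ : Fin (ofBundle n F V).rank ≃ Fin ((ofBundle n F V).rank - b) ⊕ Fin b)
    (σ' : Fin (ofBundle n F' V').rank ≃ Fin b ⊕ Fin ((ofBundle n F' V').rank - b))
    {RA : L.Rep (modularLine (ofBundle n F V))} (hRA : L.IsCanonicalRep RA)
    {RA' : L'.Rep (modularLine (ofBundle n F' V'))} (hRA' : L'.IsCanonicalRep RA')
    {DK : (Φ.image b hb).Rep (Φ.kerBundle b hb).top} (hDK : Φ.IsKernelRep b hb DK)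
    {DQ : (Φ.image b hb).Rep (Φ.cokerBundle b hb).top} (hDQ : Φ.IsCokernelRep b hb DQ) :
    ∃ κ β ζ τ : ℝ,
      (RA.D X (tmul (wedge fun i => Sum.elim (fun i => subIncl _ (k i)) a (σ i)) (wedge ξ))).1 x =
        (κ + β + τ) •
          (tmul (wedge fun i => Sum.elim (fun i => subIncl _ (k i)) a (σ i)) (wedge ξ)).1 x ∧
      (RA'.D (Φ.onSec X)
          (tmul (wedge fun i => Sum.elim (fun j => Φ.onSec (a j)) z (σ' i)) (wedge ξ))).1 x =
        (β + ζ + τ) •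
          (tmul (wedge fun i => Sum.elim (fun j => Φ.onSec (a j)) z (σ' i)) (wedge ξ)).1 x ∧
      (DK.D ((Φ.toImage b hb).onSec X) (wedge k)).1 x = κ • (wedge k).1 x ∧
      (DQ.D ((Φ.toImage b hb).onSec X) (wedge fun l => quotMk _ _ b hb (z l))).1 x =
        ζ • (wedge fun l => quotMk _ _ b hb (z l)).1 x := by
  obtain ⟨RK, hRK, hDK⟩ := hDK
  obtain ⟨RQ, hRQ, hDQ⟩ := hDQ
  obtain ⟨P, hP, hP'⟩ := h.exists_coeff_kernel (fun i => (Φ.adjointRep b hb).D X (k i)) hx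
  obtain ⟨Q, N, hN, hN'⟩ := h.exists_coeff_source (fun j => L.bracket X (a j)) hx
  obtain ⟨Q', S, hS, hS'⟩ := h.exists_coeff_target (fun l => L'.bracket (Φ.onSec X) (z l)) hx
  obtain ⟨c, -, hc⟩ := hξ.exists_coeff_family fun i => lieForm (L.anchorSec X) (ξ i)
  have hτ := wedgeDeriv_eq_trace (lieForm (L.anchorSec X)) ξ x (fun i j => c i j x)
    fun i => hc i x hx
  have hanchor : L'.anchorSec (Φ.onSec X) = L.anchorSec X := by
    ext y : 2
    exact Φ.anchor_map y _
  refine ⟨∑ i, P i i, ∑ i, N i i, ∑ i, S i i, ∑ i, c i i x, ?_, ?_, ?_, ?_⟩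
  · exact hRA.apply_eq_smul (wedgeDeriv_sumElim_eq_trace σ (L.bracket X) P Q N hP' hN) hτ
  · refine hRA'.apply_eq_smul (wedgeDeriv_sumElim_eq_trace σ' (L'.bracket (Φ.onSec X)) N Q' S
      (fun j => ?_) hS) ?_
    · rw [← Φ.onSec_bracket]
      exact hN' j
    · rw [hanchor]
      exact hτ
  · rw [hDK, hRK]
    exact wedgeDeriv_eq_trace (E := Φ.kerBundle b hb) _ k x P hP
  · rw [hDQ]
    refine wedgeDeriv_eq_trace (E := Φ.cokerBundle b hb) _ _ x S fun l => ?_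
    rw [hRQ]
    exact hS' l

variable [SecondCountableTopology M]

/-- The formula for the modular class of a morphism of constant rank. The traces on the kernel, the
image, the cokernel and the `1`-forms cancel in the combination of characteristic cocycles, which
leaves the differential of the logarithm of the ratio `hA hQ / (hA' hK)`. -/
theorem modularClass_eq {DK : (Φ.image b hb).Rep (Φ.kerBundle b hb).top}
    (hDK : Φ.IsKernelRep b hb DK) {DQ : (Φ.image b hb).Rep (Φ.cokerBundle b hb).top}
    (hDQ : Φ.IsCokernelRep b hb DQ) :
    Φ.modularClass = (Φ.toImage b hb).pullback (DK.char - DQ.char) := by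
  have hA := locallyFree_ofBundle (n := n) (F := F) (V := V)
  have hA' := locallyFree_ofBundle (n := n) (F := F') (V := V')
  have hB := Φ.locallyFree_imBundle b hb hA hA'
  have lA := locallyLine_modularLine (n := n) hA
  have lA' := locallyLine_modularLine (n := n) hA'
  have lK := (Φ.locallyFree_kerBundle b hb hA hA').top
  have lQ := (Φ.locallyFree_cokerBundle b hb hA hA').top
  obtain ⟨RA, hRA⟩ := L.exists_isCanonicalRep hA
  obtain ⟨RA', hRA'⟩ := L'.exists_isCanonicalRep hA'
  obtain ⟨SA, hSA⟩ := RA.exists_isTensor lA lA RA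
  obtain ⟨SA', hSA'⟩ := RA'.exists_isTensor lA' lA' RA'
  obtain ⟨SK, hSK⟩ := DK.exists_isTensor lK lK DK
  obtain ⟨SQ, hSQ⟩ := DQ.exists_isTensor lQ lQ DQ
  obtain ⟨mA, nA⟩ := lA.exists_sec_tensor_ne_zero
  obtain ⟨mA', nA'⟩ := lA'.exists_sec_tensor_ne_zero
  obtain ⟨mK, nK⟩ := lK.exists_sec_tensor_ne_zero
  obtain ⟨mQ, nQ⟩ := lQ.exists_sec_tensor_ne_zero
  obtain ⟨αA, hαA⟩ := SA.exists_cocycle hA (lA.tensor lA) nA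
  obtain ⟨αA', hαA'⟩ := SA'.exists_cocycle hA' (lA'.tensor lA') nA'
  obtain ⟨αK, hαK⟩ := SK.exists_cocycle hB (lK.tensor lK) nK
  obtain ⟨αQ, hαQ⟩ := SQ.exists_cocycle hB (lQ.tensor lQ) nQ
  have cA : L.modularClass = (1 / 2 : ℝ) • L.cls αA :=
    (RA.isCharClass_iff hA lA hSA ⟨mA, nA, hαA⟩ _).1
      ((isModularClass_iff hA hRA _).1 (L.isModularClass_modularClass hA))
  have cA' : L'.modularClass = (1 / 2 : ℝ) • L'.cls αA' :=
    (RA'.isCharClass_iff hA' lA' hSA' ⟨mA', nA', hαA'⟩ _).1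
      ((isModularClass_iff hA' hRA' _).1 (L'.isModularClass_modularClass hA'))
  have cK : DK.char = (1 / 2 : ℝ) • (Φ.image b hb).cls αK :=
    (DK.isCharClass_iff hB lK hSK ⟨mK, nK, hαK⟩ _).1 (DK.isCharClass_char hB lK)
  have cQ : DQ.char = (1 / 2 : ℝ) • (Φ.image b hb).cls αQ :=
    (DQ.isCharClass_iff hB lQ hSQ ⟨mQ, nQ, hαQ⟩ _).1 (DQ.isCharClass_char hB lQ)
  -- it suffices that this combination of cocycles is exact
  suffices hex : αA - Φ.pullbackCocycle αA' -
      (Φ.toImage b hb).pullbackCocycle (αK - αQ) ∈ L.coboundaries by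
    have h1 : L.cls αA - L.cls (Φ.pullbackCocycle αA') -
        (L.cls ((Φ.toImage b hb).pullbackCocycle αK) -
          L.cls ((Φ.toImage b hb).pullbackCocycle αQ)) = 0 := by
      have h2 := (Submodule.Quotient.mk_eq_zero L.coboundaries).2 hex
      rw [map_sub] at h2
      exact h2
    have hp : Φ.pullback (L'.cls αA') = L.cls (Φ.pullbackCocycle αA') := rfl
    have hK : (Φ.toImage b hb).pullback ((Φ.image b hb).cls αK) =
      L.cls ((Φ.toImage b hb).pullbackCocycle αK) := rfl
    have hQ : (Φ.toImage b hb).pullback ((Φ.image b hb).cls αQ) =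
      L.cls ((Φ.toImage b hb).pullbackCocycle αQ) := rfl
    rw [modularClass, cA, cA', cK, cQ, map_smul, map_sub, map_smul, map_smul, hp, hK, hQ,
      ← smul_sub, ← smul_sub, sub_eq_zero.1 h1]
  -- a point is needed for `b ≤ rank A` and `b ≤ rank A'`, hence for the bijections `σ` and `σ'`
  rcases isEmpty_or_nonempty M with hM | ⟨⟨x₁⟩⟩
  · exact ⟨0, fun x => isEmptyElim x⟩
  have hbA : b ≤ (ofBundle n F V).rank := Φ.le_rank_source b hb x₁
  have hbA' : b ≤ (ofBundle n F' V').rank := Φ.le_rank_target b hb x₁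
  let σ : Fin (ofBundle n F V).rank ≃ Fin ((ofBundle n F V).rank - b) ⊕ Fin b :=
    (finSumFinEquiv.trans (finCongr (Nat.sub_add_cancel hbA))).symm
  let σ' : Fin (ofBundle n F' V').rank ≃ Fin b ⊕ Fin ((ofBundle n F' V').rank - b) :=
    (finSumFinEquiv.trans (finCongr (Nat.add_sub_cancel' hbA'))).symm
  choose U hU hxU k a z ξ fA fA' fK fQ hdata using
    Φ.exists_adaptedData b hb σ σ' mA mA' mK mQ hA hA'
  -- the ratios of the local data agree on overlaps, so that they define one global function
  let r : M → M → ℝ := fun x₀ x => fA x₀ x * fQ x₀ x / (fA' x₀ x * fK x₀ x)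
  have hr : ∀ x₀, ∀ x ∈ U x₀, r x x = r x₀ x := fun x₀ x hx =>
    (hdata x).ratio_eq (hdata x₀) (hxU x) hx (nA x) (nA' x) (nK x) (nQ x)
  have ne : ∀ x₀, ∀ x ∈ U x₀, fA x₀ x ≠ 0 ∧ fA' x₀ x ≠ 0 ∧ fK x₀ x ≠ 0 ∧ fQ x₀ x ≠ 0 :=
    fun x₀ x hx => ⟨
      fun h0 => nA x (by rw [(hdata x₀).source x hx, h0, zero_smul]),
      fun h0 => nA' x (by rw [(hdata x₀).target x hx, h0, zero_smul]),
      fun h0 => nK x (by rw [(hdata x₀).ker x hx, h0, zero_smul]),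
      fun h0 => nQ x (by rw [(hdata x₀).coker x hx, h0, zero_smul])⟩
  -- the ratio may be negative: `Real.log` is the logarithm of the absolute value
  have hlog : ∀ x₀, ∀ᶠ x in 𝓝 x₀, Real.log (r x x) = Real.log (fA x₀ x) + Real.log (fQ x₀ x) -
      (Real.log (fA' x₀ x) + Real.log (fK x₀ x)) := fun x₀ => by
    filter_upwards [(hU x₀).mem_nhds (hxU x₀)] with x hx
    obtain ⟨h1, h2, h3, h4⟩ := ne x₀ x hx
    rw [hr x₀ x hx, Real.log_div (mul_ne_zero h1 h4) (mul_ne_zero h2 h3), Real.log_mul h1 h4,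
      Real.log_mul h2 h3]
  have sA : ∀ x₀, SmoothAt n (fun x => Real.log (fA x₀ x)) x₀ := fun x₀ =>
    smoothAt_log ((hdata x₀).smooth_source x₀ (hxU x₀)) (ne x₀ x₀ (hxU x₀)).1
  have sA' : ∀ x₀, SmoothAt n (fun x => Real.log (fA' x₀ x)) x₀ := fun x₀ =>
    smoothAt_log ((hdata x₀).smooth_target x₀ (hxU x₀)) (ne x₀ x₀ (hxU x₀)).2.1
  have sK : ∀ x₀, SmoothAt n (fun x => Real.log (fK x₀ x)) x₀ := fun x₀ =>
    smoothAt_log ((hdata x₀).smooth_ker x₀ (hxU x₀)) (ne x₀ x₀ (hxU x₀)).2.2.1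
  have sQ : ∀ x₀, SmoothAt n (fun x => Real.log (fQ x₀ x)) x₀ := fun x₀ =>
    smoothAt_log ((hdata x₀).smooth_coker x₀ (hxU x₀)) (ne x₀ x₀ (hxU x₀)).2.2.2
  have sAQ : ∀ x₀, SmoothAt n (fun x => Real.log (fA x₀ x) + Real.log (fQ x₀ x)) x₀ :=
    fun x₀ => (sA x₀).add (sQ x₀)
  have sAK : ∀ x₀, SmoothAt n (fun x => Real.log (fA' x₀ x) + Real.log (fK x₀ x)) x₀ :=
    fun x₀ => (sA' x₀).add (sK x₀)
  refine ⟨⟨fun x => Real.log (r x x), fun x₀ =>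
    ((sAQ x₀).sub (sAK x₀)).congr_of_eventuallyEq (hlog x₀)⟩, fun x w => ?_⟩
  obtain ⟨X, rfl⟩ := hA.exists_sec_eq x w
  change pair αA.1 x (X.1 x) - pair αA'.1 x ((Φ.onSec X).1 x) -
    (pair αK.1 x (((Φ.toImage b hb).onSec X).1 x) - pair αQ.1 x (((Φ.toImage b hb).onSec X).1 x)) =
    dirDeriv (fun x => Real.log (r x x)) x (L.anchor x (X.1 x))
  have hd := hdata x
  have hxx := hxU x
  obtain ⟨nA₀, nA'₀, nK₀, nQ₀⟩ := ne x x hxx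
  obtain ⟨κ, β, ζ, τ, tA, tA', tK, tQ⟩ :=
    hd.frame.exists_traces hd.form hxx X σ σ' hRA hRA' hDK hDQ
  have hUx := (hU x).mem_nhds hxx
  have eA := Rep.pair_cocycle_eq hSA hαA hUx hd.smooth_source hd.source (nA x) tA
  have eA' := Rep.pair_cocycle_eq hSA' hαA' hUx hd.smooth_target hd.target (nA' x) tA'
  have eK := Rep.pair_cocycle_eq hSK hαK hUx hd.smooth_ker hd.ker (nK x) tK
  have eQ := Rep.pair_cocycle_eq hSQ hαQ hUx hd.smooth_coker hd.coker (nQ x) tQ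
  have a1 : L'.anchor x ((Φ.onSec X).1 x) = L.anchor x (X.1 x) := Φ.anchor_map x _
  have a2 : (Φ.image b hb).anchor x (((Φ.toImage b hb).onSec X).1 x) = L.anchor x (X.1 x) :=
    Φ.anchor_map x _
  rw [a1] at eA'
  rw [a2] at eK eQ
  rw [eA, eA', eK, eQ, dirDeriv_congr (hlog x),
    dirDeriv_sub_at (sAQ x) (sAK x), dirDeriv_add_at (sA x) (sQ x),
    dirDeriv_add_at (sA' x) (sK x), dirDeriv_log (hd.smooth_source x hxx) nA₀,
    dirDeriv_log (hd.smooth_target x hxx) nA'₀, dirDeriv_log (hd.smooth_ker x hxx) nK₀,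
    dirDeriv_log (hd.smooth_coker x hxx) nQ₀]
  ring

end ModularClass

end Hom

end LieAlgebroid

theorem theorem4p7 {n : ℕ} {M : Type*} [TopologicalSpace M]
    [ChartedSpace (EuclideanSpace ℝ (Fin n)) M] [IsManifold (𝓡 n) ∞ M]
    [T2Space M] [SecondCountableTopology M]
    {F : Type*} [NormedAddCommGroup F] [NormedSpace ℝ F] [FiniteDimensional ℝ F]
    {V : M → Type*} [∀ x, AddCommGroup (V x)] [∀ x, Module ℝ (V x)] [∀ x, TopologicalSpace (V x)]
    [TopologicalSpace (TotalSpace F V)] [FiberBundle F V] [VectorBundle ℝ F V]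
    [ContMDiffVectorBundle ∞ F V (𝓡 n)]
    {F' : Type*} [NormedAddCommGroup F'] [NormedSpace ℝ F'] [FiniteDimensional ℝ F']
    {V' : M → Type*} [∀ x, AddCommGroup (V' x)] [∀ x, Module ℝ (V' x)]
    [∀ x, TopologicalSpace (V' x)] [TopologicalSpace (TotalSpace F' V')] [FiberBundle F' V']
    [VectorBundle ℝ F' V'] [ContMDiffVectorBundle ∞ F' V' (𝓡 n)]
    (A : LieAlgebroid (SmoothFamily.ofBundle n F V))
    (A' : LieAlgebroid (SmoothFamily.ofBundle n F' V'))
    (Φ : A.Hom A')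
    (b : ℕ) (hb : ∀ x, finrank ℝ (LinearMap.range (Φ.map x)) = b)
    (hC : (Φ.kernel b hb).IsLieAlgebraBundle)
    (hCu : (Φ.kernel b hb).IsUnimodular) :
    -- the modular classes of `A` and `A'` are well defined
    (∃! c, A.IsModularClass c) ∧ (∃! c, A'.IsModularClass c) ∧
    -- so are the representations of `B` on the two line bundles, and their characteristic classes
    ∃ (DK : (Φ.image b hb).Rep (Φ.kerBundle b hb).top)
      (DQ : (Φ.image b hb).Rep (Φ.cokerBundle b hb).top),
      Φ.IsKernelRep b hb DK ∧ (∀ D, Φ.IsKernelRep b hb D → D = DK) ∧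
      Φ.IsCokernelRep b hb DQ ∧ (∀ D, Φ.IsCokernelRep b hb D → D = DQ) ∧
      (∃! c, DK.IsCharClass c) ∧ (∃! c, DQ.IsCharClass c) ∧
      -- `Mod Φ = Φ_B^* (char D^{B, ⋀^top C} - char D^{B, ⋀^top (A'/B)})`
      Φ.modularClass = (Φ.toImage b hb).pullback (DK.char - DQ.char) := by
  have hA := SmoothFamily.locallyFree_ofBundle (n := n) (F := F) (V := V)
  have hA' := SmoothFamily.locallyFree_ofBundle (n := n) (F := F') (V := V')
  have hB := Φ.locallyFree_imBundle b hb hA hA'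
  obtain ⟨DK, hDK, hDK'⟩ := Φ.exists_isKernelRep b hb hCu
  obtain ⟨DQ, hDQ, hDQ'⟩ := Φ.exists_isCokernelRep b hb
  exact ⟨A.existsUnique_isModularClass hA, A'.existsUnique_isModularClass hA', DK, DQ, hDK, hDK',
    hDQ, hDQ', DK.existsUnique_isCharClass hB (Φ.locallyFree_kerBundle b hb hA hA').top,
    DQ.existsUnique_isCharClass hB (Φ.locallyFree_cokerBundle b hb hA hA').top,
    LieAlgebroid.Hom.modularClass_eq hDK hDQ⟩
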